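/- Let $\mathcal E$ be a finite-dimensional Euclidean space, $\mathcal M\subset\mathcal E$ an embedded smooth $m$-dimensional submanifold, and $\mathsf g:\mathcal M\to\mathfrak L(\mathcal E,\mathcal E)$ a smooth map whose values $\mathsf g_x$ are self-adjoint and positive-definite. Give $\mathcal M$ the Riemannian metric $\langle\xi,\mathsf g_x\eta\rangle_{\mathcal E}$. Let $\mathfrak q:\mathcal M\to\mathcal B$ be a (surjective) Riemannian submersion onto a Riemannian $n$-manifold. Write $\mathcal V_x\mathcal M$ for the tangent space at $x$ of the fiber of $\mathfrak q$ through $x$, and $\mathcal H_x\mathcal M$ for its orthogonal complement in $\mathcal T_x\mathcal M$. Let $\Pi_x,\mathtt H_x,\mathtt V_x$ be the projections of $\mathcal E$ onto $\mathcal T_x\mathcal M,\mathcal H_x\mathcal M,\mathcal V_x\mathcal M$ that are orthogonal for the inner product $\langle\omega_1,\mathsf g_x\omega_2\rangle_{\mathcal E}$; they depend smoothly on $x\in\mathcal M$, and $\mathrm D_\xi$ denotes the derivative in a tangent direction $\xi$. Then: 1. $\mathcal H\mathcal M=\{(x,v): x\in\mathcal M,\ \mathtt H_xv=v\}$ is a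 submanifold of $\mathcal E^2$ (of dimension $m+n$). 2. $d\mathfrak q_{|\mathcal H\mathcal M}:\mathcal H\mathcal M\to\mathcal T\mathcal B$ is a (surjective) differentiable submersion. Its fiber over $(b,v_b)$ is the submanifold $\{(x,v_{b,x}) : x\in\mathfrak q^{-1}(b)\}$ (of dimension $m-n$), where $v_{b,x}$ is the horizontal lift of $v_b$ at $x$, that is, the unique vector of $\mathcal H_x\mathcal M$ that $d\mathfrak q$ maps to $v_b$. 3. $\mathcal T\mathcal H\mathcal M$ is the submanifold of $\mathcal E^4$ (of dimension $2(m+n)$) of all $(x,v,\Delta_{\mathfrak m},\Delta_{\mathfrak t})$ with $x\in\mathcal M$, $\mathtt H_xv=v$, $\Pi_x\Delta_{\mathfrak m}=\Delta_{\mathfrak m}$ and $(\mathrm D_{\Delta_{\mathfrak m}}\mathtt H)_xv+\mathtt H_x\Delta_{\mathfrak t}=\Delta_{\mathfrak t}$. 4. The formula $\mathtt Q(\Delta_{\mathfrak m},\Delta_{\mathfrak t})=(\mathtt H_x\Delta_{\mathfrak m},\,(\mathrm D_{\mathtt H_x\Delta_{\mathfrak m}}\mathtt H)_xv+\mathtt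 H_x\Delta_{\mathfrak t})$ on $\mathcal T_{(x,v)}\mathcal H\mathcal M$ defines a smooth bundle map $\mathtt Q:\mathcal T\mathcal H\mathcal M\to\mathcal T\mathcal H\mathcal M$ over $\mathcal H\mathcal M$ with $\mathtt Q^2=\mathtt Q$. Its image is a smooth subbundle $\mathcal Q\mathcal H\mathcal M$ (of rank $2n$), whose fiber over $(x,v)$ consists of all $(\delta_{\mathfrak m},\delta_{\mathfrak t})$ with $\mathtt H_x\delta_{\mathfrak m}=\delta_{\mathfrak m}$ and $(\mathrm D_{\delta_{\mathfrak m}}\mathtt H)_xv+\mathtt H_x\delta_{\mathfrak t}=\delta_{\mathfrak t}$. 5. Let $\mathcal V_{(x,v)}\mathcal H\mathcal M\subset\mathcal T_{(x,v)}\mathcal H\mathcal M$ be the kernel of $d(d\mathfrak q_{|\mathcal H\mathcal M})$; these spaces form a smooth subbundle $\mathcal V\mathcal H\mathcal M$ (of rank $m-n$). For every $(x,v)\in\mathcal H\mathcal M$ and every $\epsilon_{\mathfrak m}\in\mathcal V_x\mathcal M$ there is a unique $\epsilon_{\mathfrak t}\in\mathcal E$ with $(\epsilon_{\mathfrak m},\epsilon_{\mathfrak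 t})\in\mathcal V_{(x,v)}\mathcal H\mathcal M$, and $$\epsilon_{\mathfrak t}=(\mathrm D_{\epsilon_{\mathfrak m}}\mathtt H)_xv-(\mathrm D_v\mathtt H)_x\epsilon_{\mathfrak m}=(\mathrm D_v\mathtt V)_x\epsilon_{\mathfrak m}-(\mathrm D_{\epsilon_{\mathfrak m}}\mathtt V)_xv=\Gamma_{\mathcal H}(v,\epsilon_{\mathfrak m})-\Gamma_{\mathcal H}(\epsilon_{\mathfrak m},v).$$ Here $\Gamma_{\mathcal H}(\xi,\eta)=-(\mathrm D_\xi\mathtt H)\eta+\mathtt H\,\Gamma(\xi,\eta)$, and $\Gamma$ is any Christoffel function, i.e. any smooth function on $\mathcal M$ whose values are $\mathcal E$-valued bilinear maps on $\mathcal E$ such that $\mathrm D_XY+\Gamma(X,Y)$ is the Levi-Civita connection of $\mathcal M$. The vector $(\mathrm D_v\mathtt H)_x\epsilon_{\mathfrak m}$ is horizontal and $(\mathrm D_{\epsilon_{\mathfrak m}}\mathtt V)_xv$ is vertical. So $\mathrm B_v:\epsilon_{\mathfrak m}\mapsto\epsilon_{\mathfrak t}$ is a linear map from $\mathcal V_x\mathcal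 M$ to $\mathcal E$, and $\mathrm b:\epsilon_{\mathfrak m}\mapsto(\epsilon_{\mathfrak m},\mathrm B_v\epsilon_{\mathfrak m})$ is a bijection from $\mathcal V_x\mathcal M$ onto $\mathcal V_{(x,v)}\mathcal H\mathcal M$. 6. There is a differentiable bundle decomposition $\mathcal T\mathcal H\mathcal M=\mathcal Q\mathcal H\mathcal M\oplus\mathcal V\mathcal H\mathcal M$, given by $$(\Delta_{\mathfrak m},\Delta_{\mathfrak t})=\bigl(\mathtt H_x\Delta_{\mathfrak m},\ \Delta_{\mathfrak t}-\mathrm B_v\mathtt V_x\Delta_{\mathfrak m}\bigr)+\bigl(\mathtt V_x\Delta_{\mathfrak m},\ \mathrm B_v\mathtt V_x\Delta_{\mathfrak m}\bigr).$$ 7. For each $(x,v)\in\mathcal H\mathcal M$, $d(d\mathfrak q_{|\mathcal H\mathcal M})$ restricts to a linear bijection from $\mathcal Q_{(x,v)}\mathcal H\mathcal M$ onto $\mathcal T_{d\mathfrak q(x,v)}\mathcal T\mathcal B$. 8. The map $\mathrm b$ and the subbundle $\mathcal Q\mathcal H\mathcal M$ (hence the projections of the decomposition in 6) are intrinsic: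 they depend only on the Riemannian submersion $\mathfrak q:\mathcal M\to\mathcal B$, not on the embedding or on the choice of $\mathsf g$. Indeed, with $\pi:\mathcal H\mathcal M\to\mathcal M$ the bundle projection, $\mathrm b(\epsilon_{\mathfrak m})$ is the only vector of $\mathcal T_{(x,v)}\mathcal H\mathcal M$ that $d\pi$ maps to $\epsilon_{\mathfrak m}$ and $d(d\mathfrak q_{|\mathcal H\mathcal M})$ maps to zero, and $\mathcal Q_{(x,v)}\mathcal H\mathcal M$ is the set of vectors of $\mathcal T_{(x,v)}\mathcal H\mathcal M$ that $d\pi$ maps into $\mathcal H_x\mathcal M$. Moreover, if $(\mathcal M_2,\mathsf g_2,\mathcal E_2)$ with $\mathfrak q_2:\mathcal M_2\to\mathcal B$ is a second such structure over the same $\mathcal B$ and $\varphi:\mathcal M\to\mathcal M_2$ is an isometry with $\mathfrak q_2\circ\varphi=\mathfrak q$, then $d\varphi$ maps $\mathcal H\mathcal M$ bijectively and smoothly onto $\mathcal H\mathcal M_2$, and its differential carries $\mathrm b$, $\mathcal Q\mathcal H\mathcal M$ and the projections of 6 to those of $\mathcal M_2$. -/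

import Mathlib

open Set
open scoped Manifold ContDiff InnerProductSpace Topology

noncomputable section

namespace SubmersedAmbient

/-! ### Submanifolds of a vector space, their tangent spaces, and calculus on them

Smoothness of a map on an embedded submanifold `S` of a finite-dimensional space `F` is Mathlib's
`ContDiffOn ℝ ∞ f S` (or `ContMDiffOn` if the target is a manifold); for embedded submanifolds this
is smoothness in charts of `S`, equivalently the existence of local smooth extensions.
The derivative of such a map in a direction `w` tangent to `S` is `fderivWithin ℝ f S p w`
(or `mfderivWithin`). On tangent vectors it does not depend on the choice of the derivative, see
`hasDerivAt_comp_curve` and `hasMFDerivAt_comp_curve`. -/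

section Submanifold

variable {F : Type*} [NormedAddCommGroup F] [NormedSpace ℝ F]

/-- `S` is an embedded smooth `d`-dimensional submanifold of `F`: near each of its points there is
a smooth chart of `F` in which `S` is a `d`-dimensional linear subspace. -/
def IsEmbSubmanifold (d : ℕ) (S : Set F) : Prop :=
  ∀ p ∈ S, ∃ (Φ : OpenPartialHomeomorph F F) (W : Submodule ℝ F),
    p ∈ Φ.source ∧ ContDiffOn ℝ ∞ Φ Φ.source ∧ ContDiffOn ℝ ∞ Φ.symm Φ.target ∧
    Module.finrank ℝ W = d ∧ ∀ y ∈ Φ.source, (y ∈ S ↔ Φ y ∈ W)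

/-- `w` is the velocity at time `0` of a smooth curve in `S` that passes through `p` at time `0`. -/
def IsVelocity (S : Set F) (p w : F) : Prop :=
  ∃ (c : ℝ → F) (N : Set ℝ), N ∈ 𝓝 (0 : ℝ) ∧ ContDiffOn ℝ ∞ c N ∧ MapsTo c N S ∧
    c 0 = p ∧ HasDerivAt c w 0

/-- The tangent space of `S` at `p`, as a subspace of `F`. (For a submanifold the velocities
already form a subspace; the span only turns this set into a `Submodule`.) -/
def tangentSpaceAt (S : Set F) (p : F) : Submodule ℝ F :=
  Submodule.span ℝ {w | IsVelocity S p w}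

/-- The tangent bundle of `S` as a subset of `F × F`. -/
def tangentBundleSet (S : Set F) : Set (F × F) :=
  {z | z.1 ∈ S ∧ z.2 ∈ tangentSpaceAt S z.1}

/-- `W` is a smooth rank `k` vector subbundle of the trivial bundle `S × G` over the submanifold
`S`: locally it has a smooth frame. (A subbundle of another subbundle `T` of `S × G` is a
subbundle of `S × G` all of whose fibers lie in those of `T`.) -/
def IsSmoothSubbundle {G : Type*} [NormedAddCommGroup G] [NormedSpace ℝ G] (k : ℕ)
    (S : Set F) (W : F → Submodule ℝ G) : Prop :=
  ∀ p ∈ S, ∃ (U : Set F) (s : Fin k → F → G), IsOpen U ∧ p ∈ U ∧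
    (∀ i, ContDiffOn ℝ ∞ (s i) (S ∩ U)) ∧
    ∀ y ∈ S ∩ U, LinearIndependent ℝ (fun i => s i y) ∧
      Submodule.span ℝ (range fun i => s i y) = W y

/-- The derivative of a function differentiable along `S` in the direction of the velocity `w` of a
curve in `S` is the derivative along the curve. -/
theorem hasDerivAt_comp_curve {G : Type*} [NormedAddCommGroup G] [NormedSpace ℝ G]
    {S : Set F} {f : F → G} {c : ℝ → F} {w : F}
    (hf : DifferentiableWithinAt ℝ f S (c 0)) (hc : HasDerivAt c w 0) (hS : ∀ᶠ t in 𝓝 0, c t ∈ S) :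
    HasDerivAt (f ∘ c) (fderivWithin ℝ f S (c 0) w) 0 :=
  hf.hasFDerivWithinAt.comp_hasDerivAt 0 hc hS

/-- The same for a map to a manifold. -/
theorem hasMFDerivAt_comp_curve {K : Type*} [NormedAddCommGroup K] [NormedSpace ℝ K]
    {H : Type*} [TopologicalSpace H] {I : ModelWithCorners ℝ K H}
    {N : Type*} [TopologicalSpace N] [ChartedSpace H N]
    {S : Set F} {f : F → N} {c : ℝ → F} {w : F}
    (hf : MDifferentiableWithinAt 𝓘(ℝ, F) I f S (c 0))
    (hc : HasDerivAt c w 0) (hS : ∀ᶠ t in 𝓝 0, c t ∈ S) :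
    HasMFDerivAt 𝓘(ℝ, ℝ) I (f ∘ c) 0
      ((mfderivWithin 𝓘(ℝ, F) I f S (c 0)).comp (ContinuousLinearMap.toSpanSingleton ℝ w)) := by
  have h1 : HasMFDerivWithinAt 𝓘(ℝ, ℝ) 𝓘(ℝ, F) c (c ⁻¹' S) 0
      (ContinuousLinearMap.toSpanSingleton ℝ w) :=
    (hasMFDerivAt_iff_hasFDerivAt.2 hc.hasFDerivAt).hasMFDerivWithinAt
  have h2 := hf.hasMFDerivWithinAt.comp (0 : ℝ) h1 (fun t ht => ht)
  exact h2.hasMFDerivAt hS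

end Submanifold

/-! ### Ambient structures and Riemannian submersions -/

section Ambient

variable {E : Type*} [NormedAddCommGroup E] [InnerProductSpace ℝ E] [FiniteDimensional ℝ E]

/-- The projection of `E` onto the subspace `W` that is orthogonal for the inner product
`⟪u₁, A u₂⟫` of a positive-definite operator `A`: with `N` the inclusion of `W` and `Nᵀ` its
adjoint, it is `N (Nᵀ A N)⁻¹ Nᵀ A`. -/
def opProj (A : E →L[ℝ] E) (W : Submodule ℝ E) : E →L[ℝ] E :=
  W.subtypeL ∘L Ring.inverse (W.subtypeL.adjoint ∘L A ∘L W.subtypeL) ∘L W.subtypeL.adjoint ∘L A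

/-- Self-adjoint and positive-definite. -/
def IsPosDefOp (A : E →L[ℝ] E) : Prop :=
  (∀ v w : E, ⟪A v, w⟫_ℝ = ⟪v, A w⟫_ℝ) ∧ ∀ v : E, v ≠ 0 → 0 < ⟪v, A v⟫_ℝ

theorem opProj_mem (A : E →L[ℝ] E) (W : Submodule ℝ E) (u : E) : opProj A W u ∈ W :=
  Submodule.coe_mem _

theorem inner_opProj {A : E →L[ℝ] E} (hA : IsPosDefOp A) (W : Submodule ℝ E) (u : E)
    {η : E} (hη : η ∈ W) : ⟪opProj A W u, A η⟫_ℝ = ⟪u, A η⟫_ℝ := by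
  set T : W →L[ℝ] W := W.subtypeL.adjoint ∘L A ∘L W.subtypeL with hT
  have hinj : Function.Injective T.toLinearMap := by
    rw [← LinearMap.ker_eq_bot, LinearMap.ker_eq_bot']
    intro v hv
    by_contra hne
    have h1 : ⟪(v : E), A v⟫_ℝ = 0 := by
      have : ⟪v, T v⟫_ℝ = 0 := by
        have : T v = 0 := hv
        rw [this, inner_zero_right]
      simpa [hT, ContinuousLinearMap.adjoint_inner_right] using this
    exact (hA.2 v (by simpa using hne)).ne' h1
  have hu : IsUnit T := by
    have hl : IsUnit T.toLinearMap :=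
      (LinearMap.isUnit_iff_ker_eq_bot _).2 (LinearMap.ker_eq_bot.2 hinj)
    obtain ⟨e, hu⟩ := hl
    refine ⟨⟨T, LinearMap.toContinuousLinearMap (e.inv), ?_, ?_⟩, rfl⟩
    · ext1 x
      have := LinearMap.congr_fun e.mul_inv x
      rw [hu] at this
      simpa using congrArg Subtype.val this
    · ext1 x
      have := LinearMap.congr_fun e.inv_mul x
      rw [hu] at this
      simpa using congrArg Subtype.val this
  have h2 : T (Ring.inverse T (W.subtypeL.adjoint (A u))) = W.subtypeL.adjoint (A u) := by
    have := Ring.mul_inverse_cancel T hu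
    exact DFunLike.congr_fun this (W.subtypeL.adjoint (A u))
  have h3 := congrArg (fun z => ⟪z, (⟨η, hη⟩ : W)⟫_ℝ) h2
  simp only [hT, ContinuousLinearMap.comp_apply, ContinuousLinearMap.adjoint_inner_left] at h3
  rw [← hA.1, ← hA.1]
  exact h3

/-- Smooth tangent vector fields on `M`. -/
def IsVectorField (M : Set E) (X : E → E) : Prop :=
  ContDiffOn ℝ ∞ X M ∧ ∀ x ∈ M, X x ∈ tangentSpaceAt M x

/-- `nabla` is the Levi-Civita connection of the Riemannian metric `⟪ξ, g_x η⟫` on the submanifold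
`M` of `E`; only values on vector fields of `M` at points of `M` matter. -/
structure IsLeviCivita (M : Set E) (g : E → E →L[ℝ] E)
    (nabla : (E → E) → (E → E) → E → E) : Prop where
  isVectorField : ∀ X Y, IsVectorField M X → IsVectorField M Y → IsVectorField M (nabla X Y)
  add_left : ∀ X X₁ Y, IsVectorField M X → IsVectorField M X₁ → IsVectorField M Y →
    ∀ x ∈ M, nabla (X + X₁) Y x = nabla X Y x + nabla X₁ Y x
  smul_left : ∀ (f : E → ℝ) X Y, ContDiffOn ℝ ∞ f M → IsVectorField M X → IsVectorField M Y →
    ∀ x ∈ M, nabla (fun y => f y • X y) Y x = f x • nabla X Y x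
  add_right : ∀ X Y Y₁, IsVectorField M X → IsVectorField M Y → IsVectorField M Y₁ →
    ∀ x ∈ M, nabla X (Y + Y₁) x = nabla X Y x + nabla X Y₁ x
  leibniz : ∀ (f : E → ℝ) X Y, ContDiffOn ℝ ∞ f M → IsVectorField M X → IsVectorField M Y →
    ∀ x ∈ M, nabla X (fun y => f y • Y y) x =
      fderivWithin ℝ f M x (X x) • Y x + f x • nabla X Y x
  metric : ∀ X Y Z, IsVectorField M X → IsVectorField M Y → IsVectorField M Z →
    ∀ x ∈ M, fderivWithin ℝ (fun y => ⟪X y, g y (Y y)⟫_ℝ) M x (Z x) =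
      ⟪nabla Z X x, g x (Y x)⟫_ℝ + ⟪X x, g x (nabla Z Y x)⟫_ℝ
  torsion_free : ∀ X Y, IsVectorField M X → IsVectorField M Y →
    ∀ x ∈ M, nabla X Y x - nabla Y X x =
      fderivWithin ℝ Y M x (X x) - fderivWithin ℝ X M x (Y x)

/-- `Γ` is a Christoffel function of `(M, g, E)`: a smooth function on `M` with bilinear values such
that `D_X Y + Γ(X, Y)` is the Levi-Civita connection. -/
def IsChristoffel (M : Set E) (g : E → E →L[ℝ] E) (Γ : E → E →L[ℝ] E →L[ℝ] E) : Prop :=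
  ContDiffOn ℝ ∞ Γ M ∧
    IsLeviCivita M g (fun X Y x => fderivWithin ℝ Y M x (X x) + Γ x (X x) (Y x))

variable (n : ℕ) {B : Type*} [TopologicalSpace B] [ChartedSpace (EuclideanSpace ℝ (Fin n)) B]
  [IsManifold (𝓡 n) ∞ B]

/-- The vertical space at `x`: the tangent space of the fiber of `q` through `x`. -/
def vertSpace (M : Set E) (q : E → B) (x : E) : Submodule ℝ E :=
  tangentSpaceAt {y | y ∈ M ∧ q y = q x} x

/-- The horizontal space at `x`: the tangent vectors orthogonal to the vertical space. -/
def horSpace (M : Set E) (g : E → E →L[ℝ] E) (q : E → B) (x : E) : Submodule ℝ E where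
  carrier := {ξ | ξ ∈ tangentSpaceAt M x ∧ ∀ ε ∈ vertSpace M q x, ⟪ξ, g x ε⟫_ℝ = 0}
  zero_mem' := ⟨zero_mem _, fun _ _ => inner_zero_left _⟩
  add_mem' := fun {a b} ha hb => ⟨add_mem ha.1 hb.1, fun ε hε => by
    rw [inner_add_left, ha.2 ε hε, hb.2 ε hε, add_zero]⟩
  smul_mem' := fun c {a} ha => ⟨Submodule.smul_mem _ c ha.1, fun ε hε => by
    rw [real_inner_smul_left, ha.2 ε hε, mul_zero]⟩

/-- `Π`, the tangent projection. -/
def projT (M : Set E) (g : E → E →L[ℝ] E) (x : E) : E →L[ℝ] E :=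
  opProj (g x) (tangentSpaceAt M x)

/-- `𝙷`, the horizontal projection. -/
def projH (M : Set E) (g : E → E →L[ℝ] E) (q : E → B) (x : E) : E →L[ℝ] E :=
  opProj (g x) (horSpace M g q x)

/-- `𝚅`, the vertical projection. -/
def projV (M : Set E) (g : E → E →L[ℝ] E) (q : E → B) (x : E) : E →L[ℝ] E :=
  opProj (g x) (vertSpace M q x)

/-- `(D_ξ 𝙷)_x`, the directional derivative of `𝙷 : M → L(E, E)`, for `ξ` tangent to `M` at `x`. -/
def derivH (M : Set E) (g : E → E →L[ℝ] E) (q : E → B) (x : E) : E →L[ℝ] E →L[ℝ] E :=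
  fderivWithin ℝ (projH M g q) M x

/-- `(D_ξ 𝚅)_x`, the directional derivative of `𝚅 : M → L(E, E)`, for `ξ` tangent to `M` at `x`. -/
def derivV (M : Set E) (g : E → E →L[ℝ] E) (q : E → B) (x : E) : E →L[ℝ] E →L[ℝ] E :=
  fderivWithin ℝ (projV M g q) M x

/-- The horizontal Christoffel function `Γ_H(ξ, η) = - (D_ξ 𝙷) η + 𝙷 Γ(ξ, η)`. -/
def christoffelH (M : Set E) (g : E → E →L[ℝ] E) (q : E → B) (Γ : E → E →L[ℝ] E →L[ℝ] E)
    (x ξ η : E) : E :=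
  -(derivH M g q x ξ η) + projH M g q x (Γ x ξ η)

/-- The differential `dq_x` of `q : M → B` at `x`, for vectors tangent to `M` at `x`. -/
def dqAt (M : Set E) (q : E → B) (x : E) : E →L[ℝ] TangentSpace (𝓡 n) (q x) :=
  mfderivWithin 𝓘(ℝ, E) (𝓡 n) q M x

/-- The differential `dq : (x, v) ↦ (q x, dq_x v)` with values in the tangent bundle of `B`, for
`(x, v)` in the tangent bundle of `M`. -/
def dq (M : Set E) (q : E → B) (p : E × E) : TangentBundle (𝓡 n) B :=
  ⟨q p.1, dqAt n M q p.1 p.2⟩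

/-- `(M, q, B, g, E)` is a submersed ambient structure: `M` is an `m`-dimensional embedded
submanifold of `E`, `g` is a smooth field of positive-definite operators on `M`, which gives `M` the
Riemannian metric `⟪ξ, g_x η⟫`, and `q : M → B` is a Riemannian submersion onto the Riemannian
manifold `(B, gB)`. The values of `g` and `q` outside `M` are irrelevant. -/
structure IsSubmersedAmbient (m : ℕ) (M : Set E) (g : E → E →L[ℝ] E)
    (q : E → B)
    (gB : Bundle.ContMDiffRiemannianMetric (𝓡 n) ∞ (EuclideanSpace ℝ (Fin n))
      (fun b : B => TangentSpace (𝓡 n) b)) : Prop where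
  submanifold : IsEmbSubmanifold m M
  smooth_g : ContDiffOn ℝ ∞ g M
  posDef_g : ∀ x ∈ M, IsPosDefOp (g x)
  smooth_q : ContMDiffOn 𝓘(ℝ, E) (𝓡 n) ∞ q M
  onto : SurjOn q M univ
  submersion : ∀ x ∈ M, SurjOn (dqAt n M q x) (tangentSpaceAt M x) univ
  isometry : ∀ x ∈ M, ∀ ξ ∈ horSpace M g q x, ∀ η ∈ horSpace M g q x,
    gB.inner (q x) (dqAt n M q x ξ) (dqAt n M q x η) = ⟪ξ, g x η⟫_ℝ

/-! ### The horizontal bundle and the subbundles of its tangent bundle -/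

/-- The horizontal bundle as a subset of `E × E`. -/
def HM (M : Set E) (g : E → E →L[ℝ] E) (q : E → B) : Set (E × E) :=
  {p | p.1 ∈ M ∧ p.2 ∈ horSpace M g q p.1}

/-- The tangent space of the horizontal bundle at `p = (x, v)`. -/
def THM (M : Set E) (g : E → E →L[ℝ] E) (q : E → B) (p : E × E) : Submodule ℝ (E × E) :=
  tangentSpaceAt (HM M g q) p

/-- The differential at `p = (x, v)` of the restriction of `dq` to the horizontal bundle, for
vectors in `THM p`. -/
def ddq (M : Set E) (g : E → E →L[ℝ] E) (q : E → B) (p : E × E) :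
    E × E →L[ℝ] TangentSpace (𝓡 n).tangent (dq n M q p) :=
  mfderivWithin 𝓘(ℝ, E × E) (𝓡 n).tangent (dq n M q) (HM M g q) p

/-- The vertical space at `p` of the restriction of `dq` to the horizontal bundle: the vectors
tangent to the horizontal bundle that its differential maps to zero. -/
def VHM (M : Set E) (g : E → E →L[ℝ] E) (q : E → B) (p : E × E) :
    Submodule ℝ (E × E) :=
  THM M g q p ⊓ LinearMap.ker (ddq n M g q p).toLinearMap

/-- The operator `𝚀 : (Δm, Δt) ↦ (𝙷 Δm, (D_{𝙷 Δm} 𝙷) v + 𝙷 Δt)` at `p = (x, v)`. -/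
def opQ (M : Set E) (g : E → E →L[ℝ] E) (q : E → B) (p : E × E) : E × E →L[ℝ] E × E :=
  (projH M g q p.1 ∘L ContinuousLinearMap.fst ℝ E E).prod
    ((derivH M g q p.1).flip p.2 ∘L projH M g q p.1 ∘L ContinuousLinearMap.fst ℝ E E +
      projH M g q p.1 ∘L ContinuousLinearMap.snd ℝ E E)

/-- The image of the tangent space of the horizontal bundle under `𝚀`. -/
def QHM (M : Set E) (g : E → E →L[ℝ] E) (q : E → B) (p : E × E) : Submodule ℝ (E × E) :=
  (THM M g q p).map (opQ M g q p).toLinearMap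

/-- `B_v : ε ↦ (D_ε 𝙷) v - (D_v 𝙷) ε` at `p = (x, v)`, for vertical `ε`. -/
def opB (M : Set E) (g : E → E →L[ℝ] E) (q : E → B) (p : E × E) : E →L[ℝ] E :=
  (derivH M g q p.1).flip p.2 - derivH M g q p.1 p.2

/-- The map `b : ε ↦ (ε, B_v ε)` at `p = (x, v)`. -/
def bMap (M : Set E) (g : E → E →L[ℝ] E) (q : E → B) (p : E × E) : E →L[ℝ] E × E :=
  (ContinuousLinearMap.id ℝ E).prod (opB M g q p)

/-- The map `(Δm, Δt) ↦ b(𝚅 Δm)` at `p = (x, v)`. -/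
def projVHM (M : Set E) (g : E → E →L[ℝ] E) (q : E → B) (p : E × E) : E × E →L[ℝ] E × E :=
  bMap M g q p ∘L projV M g q p.1 ∘L ContinuousLinearMap.fst ℝ E E

/-- The horizontal lift at `x` of a tangent vector `w` of `B` with base point `q x`. -/
def horLift (M : Set E) (g : E → E →L[ℝ] E) (q : E → B) (x : E) (w : TangentBundle (𝓡 n) B) : E :=
  Classical.epsilon fun v => v ∈ horSpace M g q x ∧ dq n M q (x, v) = w

/-- `φ` is an isometry between the Riemannian manifolds `(M₁, g₁)` and `(M₂, g₂)`, which may be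
embedded in different spaces, over the identity of `B`: two embeddings of one Riemannian manifold
with one map to `B`, with arbitrary metric operators that induce its metric. -/
structure IsSubmersionIsometry {E₂ : Type*} [NormedAddCommGroup E₂] [InnerProductSpace ℝ E₂]
    (M₁ : Set E) (g₁ : E → E →L[ℝ] E) (q₁ : E → B)
    (M₂ : Set E₂) (g₂ : E₂ → E₂ →L[ℝ] E₂) (q₂ : E₂ → B) (φ : E → E₂) : Prop where
  smooth : ContDiffOn ℝ ∞ φ M₁
  bijOn : BijOn φ M₁ M₂
  smooth_inverse : ∃ ψ : E₂ → E, ContDiffOn ℝ ∞ ψ M₂ ∧ ∀ x ∈ M₁, ψ (φ x) = x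
  metric : ∀ x ∈ M₁, ∀ ξ ∈ tangentSpaceAt M₁ x, ∀ η ∈ tangentSpaceAt M₁ x,
    ⟪fderivWithin ℝ φ M₁ x ξ, g₂ (φ x) (fderivWithin ℝ φ M₁ x η)⟫_ℝ = ⟪ξ, g₁ x η⟫_ℝ
  comp : ∀ x ∈ M₁, q₂ (φ x) = q₁ x

/-- The differential `dφ : (x, v) ↦ (φ x, dφ_x v)`, for `(x, v)` in the tangent bundle of `M`. -/
def tangentMapSet {E₂ : Type*} [NormedAddCommGroup E₂] [InnerProductSpace ℝ E₂]
    (M : Set E) (φ : E → E₂) (p : E × E) : E₂ × E₂ :=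
  (φ p.1, fderivWithin ℝ φ M p.1 p.2)

end Ambient

end SubmersedAmbient

end

/-! Submanifolds are handled through smooth retractions. Near each of its points a submanifold `S`
is the image of a smooth idempotent map `r` of an open set. At points of `S` the differential of `r`
is then an idempotent whose image is the tangent space (`IsRetractionOn.mem_tangentSpaceAt`), and on
tangent vectors the derivative along `S` of a function `f` is the ordinary derivative of its
extension `f ∘ r`. For a smooth field `P` of projections on `S`, the map `(x, v) ↦ (r x, P (r x) v)`
retracts onto the total space of the images of `P`. With `P = 𝙷` its derivative yields at once the
submanifold `HM` and the equations of its tangent bundle (`mem_tangentSpaceAt_totalSet`).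

The heart is the formula for `B_v`. Let `f` be `q` read in a chart of `B` and extended by `r`. In
charts `dq` is `(x, v) ↦ (f x, Df_x v)`, so its differential kills a vector `(ε, εt)` tangent to
`HM` exactly when `Df ε = 0` and `D²f(ε, v) + Df εt = 0`. The first equation says that `ε` is
vertical. Differentiating `Df ∘ 𝚅 = 0` in the direction `v` gives `D²f(v, ε) + Df((D_v 𝚅) ε) = 0`.
Since `D²f` is symmetric and `(D_ε 𝚅) v` is vertical, `εt = (D_v 𝚅) ε - (D_ε 𝚅) v` solves the second
equation (`bMap_mem_VHM`). The expression with `𝙷` agrees because `𝙷 + 𝚅 = Π` and `DΠ` is symmetric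
on tangent vectors (`fderivWithin_projT_symm`); the one with `Γ` agrees because the connection has
no torsion. Two solutions differ by a vector that is horizontal and vertical, hence zero
(`eq_zero_of_mem_VHM`).

Thus `VHM` is a graph over the vertical spaces, whereas `QHM` consists of the tangent vectors with
horizontal base component. They meet in zero, and subtracting `b(𝚅 Δm)` splits every tangent vector.
Both bundles are described by the differentials of `π` and of `dq` alone. An isometry over `B`
commutes with `π` and with `dq`, so its tangent map carries the whole structure along. -/

namespace SubmersedAmbient

/-! ### Smooth retractions, tangent spaces and derivatives along a set -/

section Retraction

variable {F : Type*} [NormedAddCommGroup F] [NormedSpace ℝ F]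
  {G : Type*} [NormedAddCommGroup G] [NormedSpace ℝ G]

/-- `r` is a smooth retraction of the open set `U` onto the part of `S` that lies in `U`. -/
structure IsRetractionOn (S U : Set F) (r : F → F) : Prop where
  isOpen : IsOpen U
  smooth : ContDiffOn ℝ ∞ r U
  mem : ∀ y ∈ U, r y ∈ S
  mem_dom : ∀ y ∈ U, r y ∈ U
  eq_self : ∀ y ∈ S, y ∈ U → r y = y

/-- Every point of `S` has a neighbourhood that retracts smoothly onto `S`. -/
def IsSmoothRetract (S : Set F) : Prop :=
  ∀ p ∈ S, ∃ (U : Set F) (r : F → F), p ∈ U ∧ IsRetractionOn S U r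

/-- Shrinking to `U ∩ r ⁻¹' U` makes the domain invariant, because `r` fixes the point `r y` of `S`
once it lies in `U`. -/
theorem isRetractionOn_of_maps {S U : Set F} {r : F → F} (hU : IsOpen U)
    (hr : ContDiffOn ℝ ∞ r U) (hm : ∀ y ∈ U, r y ∈ S) (he : ∀ y ∈ S, y ∈ U → r y = y) :
    IsRetractionOn S (U ∩ r ⁻¹' U) r where
  isOpen := hr.continuousOn.isOpen_inter_preimage hU hU
  smooth := hr.mono inter_subset_left
  mem y hy := hm y hy.1
  mem_dom y hy := ⟨hy.2, by rw [mem_preimage, he _ (hm y hy.1) hy.2]; exact hy.2⟩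
  eq_self y hS hy := he y hS hy.1

namespace IsRetractionOn

variable {S U : Set F} {r : F → F}

theorem restrict (h : IsRetractionOn S U r) {V : Set F} (hV : IsOpen V) :
    IsRetractionOn S ((U ∩ V) ∩ r ⁻¹' (U ∩ V)) r :=
  isRetractionOn_of_maps (h.isOpen.inter hV) (h.smooth.mono inter_subset_left)
    (fun y hy => h.mem y hy.1) (fun y hS hy => h.eq_self y hS hy.1)

theorem mem_nhds (h : IsRetractionOn S U r) {p : F} (hp : p ∈ U) : U ∈ 𝓝 p :=
  h.isOpen.mem_nhds hp

theorem contDiffAt (h : IsRetractionOn S U r) {p : F} (hp : p ∈ U) : ContDiffAt ℝ ∞ r p :=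
  h.smooth.contDiffAt (h.mem_nhds hp)

theorem hasFDerivAt (h : IsRetractionOn S U r) {p : F} (hp : p ∈ U) :
    HasFDerivAt r (fderiv ℝ r p) p :=
  ((h.contDiffAt hp).differentiableAt (by simp)).hasFDerivAt

theorem comp_contDiffOn (h : IsRetractionOn S U r) {f : F → G} (hf : ContDiffOn ℝ ∞ f S) :
    ContDiffOn ℝ ∞ (f ∘ r) U :=
  hf.comp h.smooth (fun y hy => h.mem y hy)

theorem comp_contDiffAt (h : IsRetractionOn S U r) {f : F → G} (hf : ContDiffOn ℝ ∞ f S)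
    {p : F} (hp : p ∈ U) : ContDiffAt ℝ ∞ (f ∘ r) p :=
  (h.comp_contDiffOn hf).contDiffAt (h.mem_nhds hp)

theorem fderiv_idem (h : IsRetractionOn S U r) {p : F} (hS : p ∈ S) (hp : p ∈ U) (w : F) :
    fderiv ℝ r p (fderiv ℝ r p w) = fderiv ℝ r p w := by
  have hrp : r p = p := h.eq_self p hS hp
  have h1 : HasFDerivAt (r ∘ r) ((fderiv ℝ r p).comp (fderiv ℝ r p)) p := by
    refine HasFDerivAt.comp p ?_ (h.hasFDerivAt hp)
    rw [hrp]
    exact h.hasFDerivAt hp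
  have h2 : r ∘ r =ᶠ[𝓝 p] r := by
    filter_upwards [h.mem_nhds hp] with y hy
    exact h.eq_self _ (h.mem y hy) (h.mem_dom y hy)
  have h3 := (h1.congr_of_eventuallyEq h2.symm).unique (h.hasFDerivAt hp)
  exact DFunLike.congr_fun h3 w

/-- The curve is the image under `r` of the straight line through `p` with velocity `w`. -/
theorem isVelocity_fderiv (h : IsRetractionOn S U r) {p : F} (hS : p ∈ S) (hp : p ∈ U) (w : F) :
    IsVelocity S p (fderiv ℝ r p w) := by
  have hl : ContDiff ℝ ∞ (fun t : ℝ => p + t • w) := by fun_prop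
  refine ⟨fun t => r (p + t • w), (fun t : ℝ => p + t • w) ⁻¹' U, ?_, ?_, ?_, ?_, ?_⟩
  · exact hl.continuous.continuousAt.preimage_mem_nhds (by simpa using h.mem_nhds hp)
  · exact h.smooth.comp hl.contDiffOn (fun t ht => ht)
  · exact fun t ht => h.mem _ ht
  · simpa using h.eq_self p hS hp
  · have h1 : HasDerivAt (fun t : ℝ => p + t • w) w 0 := by
      simpa using ((hasDerivAt_id (0 : ℝ)).smul_const w).const_add p
    have h2 : HasFDerivAt r (fderiv ℝ r p) (p + (0 : ℝ) • w) := by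
      simpa using h.hasFDerivAt hp
    exact h2.comp_hasDerivAt (0 : ℝ) h1

theorem fderiv_of_isVelocity (h : IsRetractionOn S U r) {p w : F} (hp : p ∈ U)
    (hw : IsVelocity S p w) : fderiv ℝ r p w = w := by
  obtain ⟨c, N, hN, -, hm, h0, hc⟩ := hw
  subst h0
  have h1 : HasDerivAt (r ∘ c) (fderiv ℝ r (c 0) w) 0 :=
    (h.hasFDerivAt hp).comp_hasDerivAt (0 : ℝ) hc
  have h2 : r ∘ c =ᶠ[𝓝 0] c := by
    filter_upwards [hN, hc.continuousAt.preimage_mem_nhds (h.mem_nhds hp)] with t ht ht'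
    exact h.eq_self _ (hm ht) ht'
  exact (h1.congr_of_eventuallyEq h2.symm).unique hc

/-- Curves in `S` are fixed by `r`, so velocities are fixed by its differential; conversely every
value of the differential is a velocity. In particular the span in the definition of the tangent
space adds nothing. -/
theorem mem_tangentSpaceAt (h : IsRetractionOn S U r) {p w : F} (hS : p ∈ S) (hp : p ∈ U) :
    w ∈ tangentSpaceAt S p ↔ fderiv ℝ r p w = w := by
  constructor
  · intro hw
    induction hw using Submodule.span_induction with
    | mem x hx => exact h.fderiv_of_isVelocity hp hx
    | zero => simp
    | add x y _ _ hx hy => rw [map_add, hx, hy]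
    | smul a x _ hx => rw [map_smul, hx]
  · intro hw
    rw [← hw]
    exact Submodule.subset_span (h.isVelocity_fderiv hS hp w)

theorem fderiv_mem (h : IsRetractionOn S U r) {p : F} (hS : p ∈ S) (hp : p ∈ U) (w : F) :
    fderiv ℝ r p w ∈ tangentSpaceAt S p :=
  (h.mem_tangentSpaceAt hS hp).2 (h.fderiv_idem hS hp w)

theorem isVelocity (h : IsRetractionOn S U r) {p w : F} (hS : p ∈ S) (hp : p ∈ U)
    (hw : w ∈ tangentSpaceAt S p) : IsVelocity S p w := by
  rw [← (h.mem_tangentSpaceAt hS hp).1 hw]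
  exact h.isVelocity_fderiv hS hp w

theorem range_fderiv (h : IsRetractionOn S U r) {p : F} (hS : p ∈ S) (hp : p ∈ U) :
    (fderiv ℝ r p).range = tangentSpaceAt S p := by
  ext w
  constructor
  · rintro ⟨u, rfl⟩
    exact h.fderiv_mem hS hp u
  · intro hw
    exact ⟨w, (h.mem_tangentSpaceAt hS hp).1 hw⟩

end IsRetractionOn

/-- Derivatives within a submanifold of positive codimension are not unique, so `fderivWithin` is an
arbitrary choice. On a velocity all choices return the derivative along the curve, and linearity
extends this to the span. -/
theorem HasFDerivWithinAt.eq_on_tangent {S : Set F} {f : F → G} {f₁ f₂ : F →L[ℝ] G} {p w : F}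
    (h₁ : HasFDerivWithinAt f f₁ S p) (h₂ : HasFDerivWithinAt f f₂ S p)
    (hw : w ∈ tangentSpaceAt S p) : f₁ w = f₂ w := by
  induction hw using Submodule.span_induction with
  | mem x hx =>
    obtain ⟨c, N, hN, -, hm, h0, hc⟩ := hx
    subst h0
    have hS : ∀ᶠ t in 𝓝 (0 : ℝ), c t ∈ S := by filter_upwards [hN] with t ht using hm ht
    exact (h₁.comp_hasDerivAt (0 : ℝ) hc hS).unique (h₂.comp_hasDerivAt (0 : ℝ) hc hS)
  | zero => simp
  | add x y _ _ hx hy => rw [map_add, hx, hy, map_add]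
  | smul a x _ hx => rw [map_smul, hx, map_smul]

theorem HasFDerivWithinAt.fderivWithin_apply {S : Set F} {f : F → G} {f' : F →L[ℝ] G} {p w : F}
    (h : HasFDerivWithinAt f f' S p) (hw : w ∈ tangentSpaceAt S p) :
    fderivWithin ℝ f S p w = f' w :=
  HasFDerivWithinAt.eq_on_tangent h.differentiableWithinAt.hasFDerivWithinAt h hw

/-- On tangent vectors the derivative along `S` is the derivative of any extension. -/
theorem fderivWithin_apply_of_eqOn {S U : Set F} {f f' : F → G} {p w : F} (hU : U ∈ 𝓝 p)
    (hp : p ∈ S) (hf : DifferentiableAt ℝ f' p) (he : ∀ y ∈ S, y ∈ U → f y = f' y)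
    (hw : w ∈ tangentSpaceAt S p) : fderivWithin ℝ f S p w = fderiv ℝ f' p w := by
  refine HasFDerivWithinAt.fderivWithin_apply ?_ hw
  refine hf.hasFDerivAt.hasFDerivWithinAt.congr_of_eventuallyEq ?_ (he p hp (mem_of_mem_nhds hU))
  filter_upwards [self_mem_nhdsWithin, mem_nhdsWithin_of_mem_nhds hU] with y h1 h2 using he y h1 h2

theorem IsRetractionOn.fderivWithin_apply {S U : Set F} {r : F → F} (h : IsRetractionOn S U r)
    {f : F → G} (hf : ContDiffOn ℝ ∞ f S) {p w : F} (hS : p ∈ S) (hp : p ∈ U)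
    (hw : w ∈ tangentSpaceAt S p) : fderivWithin ℝ f S p w = fderiv ℝ (f ∘ r) p w :=
  fderivWithin_apply_of_eqOn (h.mem_nhds hp) hS
    ((h.comp_contDiffAt hf hp).differentiableAt (by simp))
    (fun y h1 h2 => by rw [Function.comp_apply, h.eq_self y h1 h2]) hw

theorem IsVelocity.map {S : Set F} {S' : Set G} {f : F → G} (hf : ContDiffOn ℝ ∞ f S)
    (hm : MapsTo f S S') {p w : F} (hp : p ∈ S) (hw : IsVelocity S p w) :
    IsVelocity S' (f p) (fderivWithin ℝ f S p w) := by
  obtain ⟨c, N, hN, hs, hmc, h0, hc⟩ := hw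
  subst h0
  exact ⟨f ∘ c, N, hN, hf.comp hs hmc, hm.comp hmc, rfl,
    hasDerivAt_comp_curve ((hf _ hp).differentiableWithinAt (by simp)) hc
      (by filter_upwards [hN] with t ht using hmc ht)⟩

theorem fderivWithin_mem_tangentSpaceAt {S : Set F} {S' : Set G} {f : F → G}
    (hf : ContDiffOn ℝ ∞ f S) (hm : MapsTo f S S') {p w : F} (hp : p ∈ S)
    (hw : w ∈ tangentSpaceAt S p) : fderivWithin ℝ f S p w ∈ tangentSpaceAt S' (f p) := by
  induction hw using Submodule.span_induction with
  | mem x hx => exact Submodule.subset_span (hx.map hf hm hp)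
  | zero => simp
  | add x y _ _ hx hy => rw [map_add]; exact add_mem hx hy
  | smul a x _ hx => rw [map_smul]; exact Submodule.smul_mem _ _ hx

theorem IsVelocity.mono {S S' : Set F} (h : S ⊆ S') {p w : F} (hw : IsVelocity S p w) :
    IsVelocity S' p w := by
  obtain ⟨c, N, hN, hs, hmc, h0, hc⟩ := hw
  exact ⟨c, N, hN, hs, fun t ht => h (hmc ht), h0, hc⟩

theorem tangentSpaceAt_mono {S S' : Set F} (h : S ⊆ S') (p : F) :
    tangentSpaceAt S p ≤ tangentSpaceAt S' p :=
  Submodule.span_mono fun _ hw => IsVelocity.mono h hw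

theorem fderivWithin_comp_apply_of_mem {K : Type*} [NormedAddCommGroup K] [NormedSpace ℝ K]
    {S : Set F} {S' : Set G} {f : F → G} {f' : G → K}
    (hf : ContDiffOn ℝ ∞ f S) (hf' : ContDiffOn ℝ ∞ f' S') (hm : MapsTo f S S') {p w : F}
    (hp : p ∈ S) (hw : w ∈ tangentSpaceAt S p) :
    fderivWithin ℝ (f' ∘ f) S p w = fderivWithin ℝ f' S' (f p) (fderivWithin ℝ f S p w) :=
  HasFDerivWithinAt.fderivWithin_apply
    (((hf' _ (hm hp)).differentiableWithinAt (by simp)).hasFDerivWithinAt.comp p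
      ((hf _ hp).differentiableWithinAt (by simp)).hasFDerivWithinAt hm) hw

/-- Smoothness of the derivative along `S`, evaluated on a smooth field of tangent vectors. -/
theorem IsSmoothRetract.contDiffOn_fderivWithin {X : Type*} [NormedAddCommGroup X]
    [NormedSpace ℝ X] {S : Set F} (hS : IsSmoothRetract S) {f : F → G} (hf : ContDiffOn ℝ ∞ f S)
    {Z : Set X} {a w : X → F} (ha : ContDiffOn ℝ ∞ a Z) (hw : ContDiffOn ℝ ∞ w Z)
    (hm : MapsTo a Z S) (ht : ∀ z ∈ Z, w z ∈ tangentSpaceAt S (a z)) :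
    ContDiffOn ℝ ∞ (fun z => fderivWithin ℝ f S (a z) (w z)) Z := by
  intro z hz
  obtain ⟨U, r, hU, hr⟩ := hS (a z) (hm hz)
  -- The choice `fderivWithin` itself need not be smooth; the ordinary derivative of the extension
  -- `f ∘ r` is, and tangency of `w` makes the two agree.
  have h1 : ContDiffAt ℝ ∞ (fderiv ℝ (f ∘ r)) (a z) :=
    ((hr.comp_contDiffOn hf).fderiv_of_isOpen hr.isOpen (by simp)).contDiffAt (hr.mem_nhds hU)
  have h2 : ContDiffWithinAt ℝ ∞ (fun z => fderiv ℝ (f ∘ r) (a z) (w z)) Z z :=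
    (h1.comp_contDiffWithinAt z (ha z hz)).clm_apply (hw z hz)
  refine h2.congr_of_eventuallyEq ?_ (hr.fderivWithin_apply hf (hm hz) hU (ht z hz))
  filter_upwards [self_mem_nhdsWithin,
    (ha z hz).continuousWithinAt.preimage_mem_nhdsWithin (hr.mem_nhds hU)] with y h3 h4
  exact hr.fderivWithin_apply hf (hm h3) h4 (ht y h3)

/-- The product rule along `S` for an identity `A_y B_y u = C_y u` between operator fields. -/
theorem fderivWithin_comp_of_eventuallyEq {G₁ G₂ G₃ : Type*} [NormedAddCommGroup G₁] [NormedSpace ℝ G₁]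
    [NormedAddCommGroup G₂] [NormedSpace ℝ G₂] [NormedAddCommGroup G₃] [NormedSpace ℝ G₃]
    {S : Set F} {A : F → G₂ →L[ℝ] G₃} {B : F → G₁ →L[ℝ] G₂} {C : F → G₁ →L[ℝ] G₃} {p w : F}
    (hp : p ∈ S) (hA : DifferentiableWithinAt ℝ A S p) (hB : DifferentiableWithinAt ℝ B S p)
    (he : ∀ᶠ y in 𝓝[S] p, ∀ u, A y (B y u) = C y u) (hw : w ∈ tangentSpaceAt S p) (u : G₁) :
    fderivWithin ℝ A S p w (B p u) + A p (fderivWithin ℝ B S p w u) =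
      fderivWithin ℝ C S p w u := by
  have h1 := hA.hasFDerivWithinAt.clm_comp hB.hasFDerivWithinAt
  have h2 := h1.congr_of_eventuallyEq (f₁ := C)
    (he.mono fun y hy => by ext u; exact (hy u).symm)
    (by ext u; exact (he.self_of_nhdsWithin hp u).symm)
  rw [HasFDerivWithinAt.fderivWithin_apply h2 hw]
  simp [add_comm]

end Retraction

/-! ### Submanifolds, regular values and total spaces of subbundles -/

section Submanifolds

variable {F : Type*} [NormedAddCommGroup F] [NormedSpace ℝ F] [FiniteDimensional ℝ F]
  {G : Type*} [NormedAddCommGroup G] [NormedSpace ℝ G] [FiniteDimensional ℝ G]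

omit [FiniteDimensional ℝ F] in
theorem IsEmbSubmanifold.of_local {d : ℕ} {S : Set F}
    (h : ∀ p ∈ S, ∃ O, IsOpen O ∧ p ∈ O ∧ IsEmbSubmanifold d (S ∩ O)) :
    IsEmbSubmanifold d S := by
  intro p hp
  obtain ⟨O, hO, hpO, hS⟩ := h p hp
  obtain ⟨Φ, W, h1, h2, h3, h4, h5⟩ := hS p ⟨hp, hpO⟩
  refine ⟨Φ.restrOpen O hO, W, ⟨h1, hpO⟩, h2.mono inter_subset_left,
    h3.mono inter_subset_left, h4, fun y hy => ?_⟩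
  change _ ↔ Φ y ∈ W
  rw [← h5 y hy.1]
  exact ⟨fun hyS => ⟨hyS, hy.2⟩, fun hyS => hyS.1⟩

theorem exists_projection (W : Submodule ℝ F) :
    ∃ P : F →L[ℝ] F, (∀ x, P x ∈ W) ∧ ∀ x ∈ W, P x = x := by
  obtain ⟨s, hs⟩ := LinearMap.exists_leftInverse_of_injective W.subtype W.ker_subtype
  refine ⟨LinearMap.toContinuousLinearMap (W.subtype ∘ₗ s), fun x => Submodule.coe_mem _, ?_⟩
  intro x hx
  have := LinearMap.congr_fun hs ⟨x, hx⟩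
  simpa using congrArg Subtype.val this

/-- A submanifold is locally a smooth retract, with tangent spaces of the expected dimension. -/
theorem IsEmbSubmanifold.exists_retraction {d : ℕ} {S : Set F} (h : IsEmbSubmanifold d S)
    {p : F} (hp : p ∈ S) : ∃ (U : Set F) (r : F → F), p ∈ U ∧ IsRetractionOn S U r ∧
      Module.finrank ℝ (tangentSpaceAt S p) = d := by
  obtain ⟨Φ, W, hpΦ, hΦ, hΦ', hW, hS⟩ := h p hp
  obtain ⟨P, hP, hPW⟩ := exists_projection W
  -- In the chart `S` is the subspace `W`, onto which a linear projection retracts.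
  set r : F → F := fun y => Φ.symm (P (Φ y)) with hr
  set U₀ : Set F := Φ.source ∩ (fun y => P (Φ y)) ⁻¹' Φ.target with hU₀
  have hPΦ : ContDiffOn ℝ ∞ (fun y => P (Φ y)) Φ.source := P.contDiff.comp_contDiffOn hΦ
  have hU₀o : IsOpen U₀ := hPΦ.continuousOn.isOpen_inter_preimage Φ.open_source Φ.open_target
  have hrs : ContDiffOn ℝ ∞ r U₀ :=
    hΦ'.comp (hPΦ.mono inter_subset_left) (fun y hy => hy.2)
  have heq : ∀ y ∈ S, y ∈ Φ.source → P (Φ y) = Φ y := fun y hy hyΦ =>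
    hPW _ ((hS y hyΦ).1 hy)
  have hret : IsRetractionOn S (U₀ ∩ r ⁻¹' U₀) r := by
    refine isRetractionOn_of_maps hU₀o hrs ?_ ?_
    · intro y hy
      rw [hS _ (Φ.map_target hy.2), Φ.right_inv hy.2]
      exact hP _
    · intro y hy hyU
      rw [hr]
      simp only [heq y hy hyU.1, Φ.left_inv hyU.1]
  have hpU₀ : p ∈ U₀ := ⟨hpΦ, by rw [mem_preimage, heq p hp hpΦ]; exact Φ.map_source hpΦ⟩
  have hrp : r p = p := by simp only [hr, heq p hp hpΦ, Φ.left_inv hpΦ]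
  have hpU : p ∈ U₀ ∩ r ⁻¹' U₀ := ⟨hpU₀, by rw [mem_preimage, hrp]; exact hpU₀⟩
  refine ⟨_, r, hpU, hret, ?_⟩
  set A := fderiv ℝ Φ p
  set A' := fderiv ℝ Φ.symm (Φ p)
  have hA : HasFDerivAt Φ A p :=
    ((hΦ.contDiffAt (Φ.open_source.mem_nhds hpΦ)).differentiableAt (by simp)).hasFDerivAt
  have hA' : HasFDerivAt Φ.symm A' (Φ p) :=
    ((hΦ'.contDiffAt (Φ.open_target.mem_nhds (Φ.map_source hpΦ))).differentiableAt
      (by simp)).hasFDerivAt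
  have h1 : A'.comp A = ContinuousLinearMap.id ℝ F := by
    refine ((hA'.comp p hA).congr_of_eventuallyEq ?_).unique (hasFDerivAt_id p)
    filter_upwards [Φ.open_source.mem_nhds hpΦ] with y hy using (Φ.left_inv hy).symm
  have h2 : A.comp A' = ContinuousLinearMap.id ℝ F := by
    have hA2 : HasFDerivAt Φ A (Φ.symm (Φ p)) := by rw [Φ.left_inv hpΦ]; exact hA
    refine ((hA2.comp (Φ p) hA').congr_of_eventuallyEq ?_).unique (hasFDerivAt_id (Φ p))
    filter_upwards [Φ.open_target.mem_nhds (Φ.map_source hpΦ)] with y hy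
      using (Φ.right_inv hy).symm
  have h3 : fderiv ℝ r p = A'.comp (P.comp A) := by
    refine HasFDerivAt.fderiv (HasFDerivAt.comp p ?_ (P.hasFDerivAt.comp p hA))
    rw [heq p hp hpΦ]
    exact hA'
  let e : F ≃ₗ[ℝ] F := LinearEquiv.ofLinearMap A.toLinearMap A'.toLinearMap
    (by ext u; exact DFunLike.congr_fun h2 u) (by ext u; exact DFunLike.congr_fun h1 u)
  -- The differential of `r` is `P` conjugated by the differential of the chart, so its fixed space
  -- is the preimage of `W`.
  have h4 : tangentSpaceAt S p = W.comap (e : F →ₗ[ℝ] F) := by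
    ext w
    rw [hret.mem_tangentSpaceAt hp hpU, h3, Submodule.mem_comap]
    change A' (P (A w)) = w ↔ A w ∈ W
    constructor
    · intro hw
      have := DFunLike.congr_fun h2 (P (A w))
      change A (A' (P (A w))) = P (A w) at this
      rw [hw] at this
      rw [this]
      exact hP _
    · intro hw
      rw [hPW _ hw]
      exact DFunLike.congr_fun h1 w
  rw [h4, ← hW]
  exact (e.ofSubmodule' W).finrank_eq

theorem IsEmbSubmanifold.isSmoothRetract {d : ℕ} {S : Set F} (h : IsEmbSubmanifold d S) :
    IsSmoothRetract S := fun p hp => by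
  obtain ⟨U, r, h1, h2, -⟩ := h.exists_retraction hp
  exact ⟨U, r, h1, h2⟩

theorem IsEmbSubmanifold.finrank_tangentSpaceAt {d : ℕ} {S : Set F} (h : IsEmbSubmanifold d S)
    {p : F} (hp : p ∈ S) : Module.finrank ℝ (tangentSpaceAt S p) = d := by
  obtain ⟨U, r, -, -, h3⟩ := h.exists_retraction hp
  exact h3

/-- Near `p`, the set `Z` is the level set in `S` of a smooth map that is submersive at `p`. -/
def IsSubmersiveLevelAt (G : Type*) [NormedAddCommGroup G] [NormedSpace ℝ G]
    (S Z : Set F) (p : F) (f : F → G) : Prop :=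
  ∃ (U : Set F) (r : F → F), p ∈ U ∧ IsRetractionOn S U r ∧ ContDiffOn ℝ ∞ f U ∧
    (∀ y ∈ S, y ∈ U → (y ∈ Z ↔ f y = f p)) ∧
    ∀ c : G, ∃ w ∈ tangentSpaceAt S p, fderiv ℝ f p w = c

-- Rank-nullity for the differential of `f` restricted to the tangent space of `S`, where it is
-- onto.
omit [FiniteDimensional ℝ G] in
theorem IsSubmersiveLevelAt.finrank_ker {S Z : Set F} {p : F} {f : F → G}
    (h : IsSubmersiveLevelAt G S Z p f) :
    Module.finrank ℝ ↥(tangentSpaceAt S p ⊓ LinearMap.ker (fderiv ℝ f p).toLinearMap) +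
      Module.finrank ℝ G = Module.finrank ℝ (tangentSpaceAt S p) := by
  obtain ⟨U, r, -, -, -, -, hs⟩ := h
  set D := (fderiv ℝ f p).toLinearMap.domRestrict (tangentSpaceAt S p)
  have h1 := D.finrank_range_add_finrank_ker
  have h2 : LinearMap.range D = ⊤ := by
    rw [LinearMap.range_eq_top]
    intro c
    obtain ⟨w, hw, hc⟩ := hs c
    exact ⟨⟨w, hw⟩, hc⟩
  have h3 : tangentSpaceAt S p ⊓ LinearMap.ker (fderiv ℝ f p).toLinearMap =
      (LinearMap.ker D).map (tangentSpaceAt S p).subtype := by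
    ext w
    simp only [Submodule.mem_inf, LinearMap.mem_ker, Submodule.mem_map]
    constructor
    · rintro ⟨h4, h5⟩
      exact ⟨⟨w, h4⟩, h5, rfl⟩
    · rintro ⟨⟨y, hy⟩, h5, rfl⟩
      exact ⟨hy, h5⟩
  rw [h2, finrank_top] at h1
  rw [h3, Submodule.finrank_map_subtype_eq]
  omega

/-- The regular value theorem for maps on a submanifold. -/
theorem isEmbSubmanifold_of_levelSet {d : ℕ} {S Z : Set F} (hZ : Z ⊆ S)
    (h : ∀ p ∈ Z, ∃ f : F → G, IsSubmersiveLevelAt G S Z p f)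
    (hd : ∀ p ∈ Z, Module.finrank ℝ (tangentSpaceAt S p) = d + Module.finrank ℝ G) :
    IsEmbSubmanifold d Z := by
  intro p hpZ
  obtain ⟨f, hlev⟩ := h p hpZ
  have hdim := hlev.finrank_ker
  rw [hd p hpZ] at hdim
  obtain ⟨U, r, hpU, hr, hf, hfZ, hs⟩ := hlev
  have hpS : p ∈ S := hZ hpZ
  set P := fderiv ℝ r p with hPdef
  set D := fderiv ℝ f p with hDdef
  have hPP : ∀ w, P (P w) = P w := hr.fderiv_idem hpS hpU
  have hrp : r p = p := hr.eq_self p hpS hpU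
  have hrr : ∀ y ∈ U, r (r y) = r y := fun y hy => hr.eq_self _ (hr.mem y hy) (hr.mem_dom y hy)
  have hDP : LinearMap.range (D ∘L P).toLinearMap = ⊤ := by
    rw [LinearMap.range_eq_top]
    intro c
    obtain ⟨w, hw, hc⟩ := hs c
    refine ⟨w, ?_⟩
    change D (P w) = c
    rw [(hr.mem_tangentSpaceAt hpS hpU).1 hw]
    exact hc
  obtain ⟨s₀, hs₀⟩ := LinearMap.exists_rightInverse_of_surjective _ hDP
  -- A right inverse of `D` with values in the tangent space of `S`.
  set σ : G →L[ℝ] F := P ∘L LinearMap.toContinuousLinearMap s₀ with hσ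
  have hDσ : ∀ c, D (σ c) = c := fun c => LinearMap.congr_fun hs₀ c
  have hPσ : ∀ c, P (σ c) = σ c := fun c => hPP _
  -- The projection onto the kernel of `D` in the tangent space, along the range of `σ` and the
  -- kernel of `P`.
  set N : F →L[ℝ] F := P - σ ∘L D ∘L P with hN
  have hPN : ∀ w, P (N w) = N w := fun w => by simp [hN, hPP, hPσ]
  have hDN : ∀ w, D (N w) = 0 := fun w => by simp [hN, hDσ]
  -- The three terms record the position along the level set, the value of `f`, and the displacement
  -- from `S`. Their differentials at `p` are complementary projections, so the differential of `Φ`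
  -- there is the identity.
  set Φ : F → F := fun y => N (r y - p) + σ (f (r y) - f p) +
    (ContinuousLinearMap.id ℝ F - P) (y - r y) with hΦ
  have hfr : ContDiffOn ℝ ∞ (fun y => f (r y)) U := hf.comp hr.smooth hr.mem_dom
  have hΦs : ContDiffOn ℝ ∞ Φ U :=
    ((N.contDiff.comp_contDiffOn (hr.smooth.sub contDiffOn_const)).add
      (σ.contDiff.comp_contDiffOn (hfr.sub contDiffOn_const))).add
      ((ContinuousLinearMap.id ℝ F - P).contDiff.comp_contDiffOn (contDiffOn_id.sub hr.smooth))
  have hrd : HasFDerivAt r P p := hr.hasFDerivAt hpU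
  have hfd : HasFDerivAt (fun y => f (r y)) (D ∘L P) p := by
    refine HasFDerivAt.comp p ?_ hrd
    rw [hrp]
    exact ((hf.contDiffAt (hr.mem_nhds hpU)).differentiableAt (by simp)).hasFDerivAt
  have hΦd : HasFDerivAt Φ
      ((ContinuousLinearEquiv.refl ℝ F : F ≃L[ℝ] F) : F →L[ℝ] F) p := by
    have h1 := ((N.hasFDerivAt.comp p (hrd.sub_const p)).add
      (σ.hasFDerivAt.comp p (hfd.sub_const (f p)))).add
      ((ContinuousLinearMap.id ℝ F - P).hasFDerivAt.comp p ((hasFDerivAt_id p).sub hrd))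
    refine h1.congr_fderiv ?_
    ext w
    simp [hN, hPP]
  have hΦp : ContDiffAt ℝ ∞ Φ p := hΦs.contDiffAt (hr.mem_nhds hpU)
  set φ := hΦp.toOpenPartialHomeomorph Φ hΦd (by simp) with hφ
  have hpφ : p ∈ φ.source := hΦp.mem_toOpenPartialHomeomorph_source hΦd (by simp)
  -- The inverse function theorem gives smoothness of the inverse at one point only; it holds
  -- throughout the target once the differential is invertible on the whole source.
  have hinv : IsOpen (U ∩ fderiv ℝ Φ ⁻¹' range
      (ContinuousLinearEquiv.toContinuousLinearMap : (F ≃L[ℝ] F) → F →L[ℝ] F)) :=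
    (hΦs.continuousOn_fderiv_of_isOpen hr.isOpen (by simp)).isOpen_inter_preimage hr.isOpen
      ContinuousLinearEquiv.isOpen
  set V := φ.source ∩ (U ∩ fderiv ℝ Φ ⁻¹' range
      (ContinuousLinearEquiv.toContinuousLinearMap : (F ≃L[ℝ] F) → F →L[ℝ] F)) with hV
  have hVo : IsOpen V := φ.open_source.inter hinv
  have hpV : p ∈ V := ⟨hpφ, hpU, by rw [mem_preimage, hΦd.fderiv]; exact ⟨_, rfl⟩⟩
  -- The source is made invariant under `r`, since injectivity is applied below to both `y` and `r
  -- y`.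
  have hr' := hr.restrict hVo
  set U' := (U ∩ V) ∩ r ⁻¹' (U ∩ V) with hU'
  have hpU' : p ∈ U' := ⟨⟨hpU, hpV⟩, by rw [mem_preimage, hrp]; exact ⟨hpU, hpV⟩⟩
  refine ⟨φ.restrOpen U' hr'.isOpen,
    tangentSpaceAt S p ⊓ LinearMap.ker (fderiv ℝ f p).toLinearMap, ⟨hpφ, hpU'⟩,
    hΦs.mono fun y hy => hy.2.1.1, ?_, by rw [← hDdef]; omega, ?_⟩
  · intro a ha
    have hy := (φ.restrOpen U' hr'.isOpen).map_target ha
    obtain ⟨e, he⟩ := hy.2.1.2.2.2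
    have hcd : ContDiffAt ℝ ∞ Φ ((φ.restrOpen U' hr'.isOpen).symm a) :=
      hΦs.contDiffAt (hr.mem_nhds hy.2.1.1)
    refine (OpenPartialHomeomorph.contDiffAt_symm (φ.restrOpen U' hr'.isOpen) (f₀' := e) ha ?_
      hcd).contDiffWithinAt
    have := (hcd.differentiableAt (by simp)).hasFDerivAt
    rw [← he] at this
    exact this
  · rintro y ⟨hyφ, hyU'⟩
    have hyU : y ∈ U := hyU'.1.1
    change y ∈ Z ↔ Φ y ∈ _
    rw [Submodule.mem_inf, hr.mem_tangentSpaceAt hpS hpU, LinearMap.mem_ker]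
    change _ ↔ P (Φ y) = Φ y ∧ D (Φ y) = 0
    constructor
    · intro hyZ
      have h1 : r y = y := hr.eq_self y (hZ hyZ) hyU
      have h2 : f y = f p := (hfZ y (hZ hyZ) hyU).1 hyZ
      have h3 : Φ y = N (y - p) := by simp only [hΦ, h1, h2, sub_self, map_zero, add_zero]
      rw [h3]
      exact ⟨hPN _, hDN _⟩
    · rintro ⟨h1, h2⟩
      have hPz : ∀ w, P ((ContinuousLinearMap.id ℝ F - P) w) = 0 := fun w => by simp [hPP]
      have h3 : (ContinuousLinearMap.id ℝ F - P) (y - r y) = 0 := by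
        have h4 : P (Φ y) = N (r y - p) + σ (f (r y) - f p) := by
          simp only [hΦ, map_add, hPN, hPσ, hPz, add_zero]
        rw [h4] at h1
        simpa [hΦ] using h1
      -- Only the normal component of `y - r y` is known to vanish; that `y` itself lies in `S`
      -- follows from injectivity of the chart.
      have h5 : Φ (r y) = Φ y := by
        simp only [hΦ, hrr y hyU, h3, sub_self, map_zero]
      have h6 : r y = y := φ.injOn hyU'.2.2.1 hyφ h5
      have hyS : y ∈ S := h6 ▸ hr.mem y hyU
      rw [hfZ y hyS hyU]
      have h7 : Φ y = N (y - p) + σ (f y - f p) := by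
        simp only [hΦ, h6, sub_self, map_zero, add_zero]
      rw [h7, map_add, hDN, hDσ, zero_add] at h2
      exact sub_eq_zero.1 h2

/-- A smooth retract with tangent spaces of constant dimension is a submanifold. -/
theorem IsSmoothRetract.isEmbSubmanifold {d : ℕ} {S : Set F} (h : IsSmoothRetract S)
    (hd : ∀ p ∈ S, Module.finrank ℝ (tangentSpaceAt S p) = d) : IsEmbSubmanifold d S := by
  -- The regular value theorem with a zero-dimensional target: the level set is `S` itself.
  refine isEmbSubmanifold_of_levelSet (G := Fin 0 → ℝ) subset_rfl (fun p hp => ?_)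
    (fun p hp => by simpa using hd p hp)
  obtain ⟨U, r, hpU, hr⟩ := h p hp
  exact ⟨fun _ => 0, U, r, hpU, hr, contDiffOn_const, fun y hy _ => by simp [hy],
    fun c => ⟨0, zero_mem _, Subsingleton.elim _ _⟩⟩

/-- As `f` is constant on `Z` near `p`, zero is one of its derivatives within `Z`, which gives the
inclusion of the left side in the right. Equality follows by comparing dimensions. -/
theorem tangentSpaceAt_levelSet {d : ℕ} {S Z : Set F} (hZ : Z ⊆ S)
    (h : ∀ p ∈ Z, ∃ f : F → G, IsSubmersiveLevelAt G S Z p f)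
    (hd : ∀ p ∈ Z, Module.finrank ℝ (tangentSpaceAt S p) = d + Module.finrank ℝ G)
    {p : F} (hp : p ∈ Z) {f : F → G} (hf : IsSubmersiveLevelAt G S Z p f) :
    tangentSpaceAt Z p =
      tangentSpaceAt S p ⊓ LinearMap.ker (fderiv ℝ f p).toLinearMap := by
  have h1 := (isEmbSubmanifold_of_levelSet hZ h hd).finrank_tangentSpaceAt hp
  have h2 := hf.finrank_ker
  refine Submodule.eq_of_le_of_finrank_eq ?_ (by have := hd p hp; omega)
  obtain ⟨U, r, hpU, hr, hfs, hfZ, -⟩ := hf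
  intro w hw
  refine ⟨tangentSpaceAt_mono hZ p hw, ?_⟩
  have h3 : HasFDerivWithinAt f (fderiv ℝ f p) Z p :=
    ((hfs.contDiffAt (hr.mem_nhds hpU)).differentiableAt (by simp)).hasFDerivAt.hasFDerivWithinAt
  have h4 : HasFDerivWithinAt f (0 : F →L[ℝ] G) Z p := by
    refine (hasFDerivWithinAt_const (f p) p Z).congr_of_eventuallyEq ?_ rfl
    filter_upwards [self_mem_nhdsWithin, mem_nhdsWithin_of_mem_nhds (hr.mem_nhds hpU)] with y h5 h6
    exact (hfZ y (hZ h5) h6).1 h5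
  exact HasFDerivWithinAt.eq_on_tangent h3 h4 hw

/-! ### Total spaces of subbundles -/

/-- The total space of the subbundle that is the image of the projections `P`. -/
def totalSet (S : Set F) (P : F → G →L[ℝ] G) : Set (F × G) :=
  {z | z.1 ∈ S ∧ P z.1 z.2 = z.2}

omit [FiniteDimensional ℝ F] [FiniteDimensional ℝ G] in
theorem isRetractionOn_totalSet {S U : Set F} {r : F → F} (hr : IsRetractionOn S U r)
    {P : F → G →L[ℝ] G} (hP : ContDiffOn ℝ ∞ P S) (hPP : ∀ y ∈ S, ∀ v, P y (P y v) = P y v) :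
    IsRetractionOn (totalSet S P) (Prod.fst ⁻¹' U) (fun z => (r z.1, P (r z.1) z.2)) where
  isOpen := hr.isOpen.preimage continuous_fst
  smooth := by
    have h1 : ContDiffOn ℝ ∞ (Prod.fst : F × G → F) (Prod.fst ⁻¹' U) := contDiff_fst.contDiffOn
    refine (hr.smooth.comp h1 fun z hz => hz).prodMk ?_
    exact ((hr.comp_contDiffOn hP).comp h1 fun z hz => hz).clm_apply contDiff_snd.contDiffOn
  mem z hz := ⟨hr.mem _ hz, hPP _ (hr.mem _ hz) _⟩
  mem_dom z hz := hr.mem_dom _ hz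
  eq_self z hz hzU := Prod.ext (hr.eq_self _ hz.1 hzU) (by
    simp only [hr.eq_self _ hz.1 hzU, hz.2])

-- These are the fixed vectors of the differential of the retraction `(x, v) ↦ (r x, P (r x) v)`.
omit [FiniteDimensional ℝ F] [FiniteDimensional ℝ G] in
theorem mem_tangentSpaceAt_totalSet {S : Set F} (hS : IsSmoothRetract S)
    {P : F → G →L[ℝ] G} (hP : ContDiffOn ℝ ∞ P S) (hPP : ∀ y ∈ S, ∀ v, P y (P y v) = P y v)
    {z : F × G} (hz : z ∈ totalSet S P) {Δ : F × G} :
    Δ ∈ tangentSpaceAt (totalSet S P) z ↔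
      Δ.1 ∈ tangentSpaceAt S z.1 ∧ fderivWithin ℝ P S z.1 Δ.1 z.2 + P z.1 Δ.2 = Δ.2 := by
  obtain ⟨U, r, hzU, hr⟩ := hS z.1 hz.1
  have hrt := isRetractionOn_totalSet hr hP hPP
  have hrz : r z.1 = z.1 := hr.eq_self _ hz.1 hzU
  have h1 : HasFDerivAt (fun y : F × G => r y.1)
      ((fderiv ℝ r z.1).comp (ContinuousLinearMap.fst ℝ F G)) z :=
    (hr.hasFDerivAt hzU).comp z hasFDerivAt_fst
  have h2 : HasFDerivAt (fun y : F × G => P (r y.1))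
      ((fderiv ℝ (P ∘ r) z.1).comp (ContinuousLinearMap.fst ℝ F G)) z :=
    (((hr.comp_contDiffAt hP hzU).differentiableAt (by simp)).hasFDerivAt).comp z hasFDerivAt_fst
  have h3 := h1.prodMk (h2.clm_apply hasFDerivAt_snd)
  rw [hrt.mem_tangentSpaceAt hz hzU, h3.fderiv, hr.mem_tangentSpaceAt hz.1 hzU, Prod.ext_iff]
  refine and_congr_right fun h4 => ?_
  have h4' : fderiv ℝ r z.1 Δ.1 = Δ.1 := h4
  rw [hr.fderivWithin_apply hP hz.1 hzU ((hr.mem_tangentSpaceAt hz.1 hzU).2 h4')]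
  simp [hrz, add_comm]

omit [FiniteDimensional ℝ F] [FiniteDimensional ℝ G] in
theorem isSmoothRetract_totalSet {S : Set F} (hS : IsSmoothRetract S)
    {P : F → G →L[ℝ] G} (hP : ContDiffOn ℝ ∞ P S) (hPP : ∀ y ∈ S, ∀ v, P y (P y v) = P y v) :
    IsSmoothRetract (totalSet S P) := fun z hz => by
  obtain ⟨U, r, hzU, hr⟩ := hS z.1 hz.1
  exact ⟨_, _, hzU, isRetractionOn_totalSet hr hP hPP⟩

omit [FiniteDimensional ℝ F] [FiniteDimensional ℝ G] in
/-- The derivative of a field of projections maps their image into their kernel. -/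
theorem proj_fderivWithin_apply {S : Set F}
    {P : F → G →L[ℝ] G} (hP : ContDiffOn ℝ ∞ P S) (hPP : ∀ y ∈ S, ∀ v, P y (P y v) = P y v)
    {x w : F} (hx : x ∈ S) (hw : w ∈ tangentSpaceAt S x) {v : G} (hv : P x v = v) :
    P x (fderivWithin ℝ P S x w v) = 0 := by
  have hd := (hP x hx).differentiableWithinAt (by simp)
  have h := fderivWithin_comp_of_eventuallyEq hx hd hd
    (Filter.eventually_of_mem self_mem_nhdsWithin hPP) hw v
  rw [hv] at h
  simpa using h

theorem isEmbSubmanifold_totalSet {d k : ℕ} {S : Set F} (hS : IsEmbSubmanifold d S)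
    {P : F → G →L[ℝ] G} (hP : ContDiffOn ℝ ∞ P S) (hPP : ∀ y ∈ S, ∀ v, P y (P y v) = P y v)
    (hk : ∀ y ∈ S, Module.finrank ℝ (P y).range = k) :
    IsEmbSubmanifold (d + k) (totalSet S P) := by
  have hSr := hS.isSmoothRetract
  refine (isSmoothRetract_totalSet hSr hP hPP).isEmbSubmanifold fun z hz => ?_
  set T := tangentSpaceAt S z.1 with hT
  set W := (P z.1).range with hW
  have hPW : ∀ w ∈ W, P z.1 w = w := by
    rintro _ ⟨u, rfl⟩
    exact hPP _ hz.1 u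
  -- For the dimension count, the tangent space is parametrized by `(w, u) ↦ (w, (D_w P) v + u)`.
  -- This lands in it because `P` kills `(D_w P) v` and fixes `u`.
  let A : (T × W) →ₗ[ℝ] F × G :=
    (T.subtype ∘ₗ LinearMap.fst ℝ T W).prod
      (((fderivWithin ℝ P S z.1).flip z.2).toLinearMap ∘ₗ T.subtype ∘ₗ LinearMap.fst ℝ T W +
        W.subtype ∘ₗ LinearMap.snd ℝ T W)
  have hA : ∀ u, A u = ((u.1 : F), fderivWithin ℝ P S z.1 u.1 z.2 + (u.2 : G)) := fun u => rfl
  have hinj : Function.Injective A := by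
    intro u u' h
    rw [hA, hA, Prod.ext_iff] at h
    have h1 : u.1 = u'.1 := Subtype.ext h.1
    have h2 := h.2
    simp only [h1, add_right_inj] at h2
    exact Prod.ext h1 (Subtype.ext h2)
  have hrange : LinearMap.range A = tangentSpaceAt (totalSet S P) z := by
    ext Δ
    rw [mem_tangentSpaceAt_totalSet hSr hP hPP hz]
    constructor
    · rintro ⟨u, rfl⟩
      rw [hA]
      refine ⟨u.1.2, ?_⟩
      simp only [map_add, proj_fderivWithin_apply hP hPP hz.1 u.1.2 hz.2, hPW _ u.2.2, zero_add]
    · rintro ⟨h1, h2⟩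
      exact ⟨(⟨Δ.1, h1⟩, ⟨P z.1 Δ.2, Δ.2, rfl⟩), Prod.ext rfl h2⟩
  rw [← hrange, LinearMap.finrank_range_of_inj hinj, Module.finrank_prod,
    hS.finrank_tangentSpaceAt hz.1, hk _ hz.1]

omit [FiniteDimensional ℝ F] in
theorem IsEmbSubmanifold.inter_open {d : ℕ} {S O : Set F} (hS : IsEmbSubmanifold d S)
    (hO : IsOpen O) : IsEmbSubmanifold d (S ∩ O) := by
  rintro p ⟨hp, hpO⟩
  obtain ⟨Φ, W, h1, h2, h3, h4, h5⟩ := hS p hp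
  refine ⟨Φ.restrOpen O hO, W, ⟨h1, hpO⟩, h2.mono inter_subset_left,
    h3.mono inter_subset_left, h4, fun y hy => ?_⟩
  change _ ↔ Φ y ∈ W
  rw [← h5 y hy.1]
  exact ⟨fun hyS => hyS.1, fun hyS => ⟨hyS, hy.2⟩⟩

/-- The tangent bundle of a submanifold is a submanifold. -/
theorem IsEmbSubmanifold.tangentBundleSet {d : ℕ} {S : Set F} (hS : IsEmbSubmanifold d S) :
    IsEmbSubmanifold (2 * d) (tangentBundleSet S) := by
  refine IsEmbSubmanifold.of_local fun z hz => ?_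
  obtain ⟨U, r, hzU, hr⟩ := hS.isSmoothRetract z.1 hz.1
  refine ⟨Prod.fst ⁻¹' U, hr.isOpen.preimage continuous_fst, hzU, ?_⟩
  -- Locally the differentials of `r` are themselves a smooth field of projections onto the tangent
  -- spaces.
  have h1 : SubmersedAmbient.tangentBundleSet S ∩ Prod.fst ⁻¹' U =
      totalSet (S ∩ U) (fderiv ℝ r) := by
    ext y
    constructor
    · rintro ⟨⟨h2, h3⟩, h4⟩
      exact ⟨⟨h2, h4⟩, (hr.mem_tangentSpaceAt h2 h4).1 h3⟩
    · rintro ⟨⟨h2, h4⟩, h3⟩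
      exact ⟨⟨h2, (hr.mem_tangentSpaceAt h2 h4).2 h3⟩, h4⟩
  rw [h1, two_mul]
  refine isEmbSubmanifold_totalSet (hS.inter_open hr.isOpen)
    ((hr.smooth.fderiv_of_isOpen hr.isOpen (by simp)).mono inter_subset_right)
    (fun y hy => hr.fderiv_idem hy.1 hy.2) (fun y hy => ?_)
  rw [hr.range_fderiv hy.1 hy.2, hS.finrank_tangentSpaceAt hy.1]

omit [FiniteDimensional ℝ F] in
/-- The images of a smooth field of projections of constant rank form a smooth subbundle. -/
theorem isSmoothSubbundle_of_projections {k : ℕ} {S : Set F} {W : F → Submodule ℝ G}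
    {P : F → G →L[ℝ] G} (hP : ContDiffOn ℝ ∞ P S) (hmem : ∀ y ∈ S, ∀ v, P y v ∈ W y)
    (hid : ∀ y ∈ S, ∀ v ∈ W y, P y v = v) (hk : ∀ y ∈ S, Module.finrank ℝ (W y) = k) :
    IsSmoothSubbundle k S W := by
  intro p hp
  let b := Module.finBasisOfFinrankEq ℝ (W p) (hk p hp)
  -- A basis of the fiber at `p` is projected to the nearby fibers; independence is an open
  -- condition, and the rank forces the frame to span.
  let s : Fin k → F → G := fun i y => P y (b i : G)
  have hs : ∀ i, ContDiffOn ℝ ∞ (s i) S := fun i => hP.clm_apply contDiffOn_const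
  have hsp : (fun i => s i p) = fun i => (b i : G) := funext fun i => hid p hp _ (b i).2
  have hli : LinearIndependent ℝ (fun i => s i p) := by
    rw [hsp]
    exact b.linearIndependent.map' (W p).subtype (W p).ker_subtype
  have hcont : ContinuousWithinAt (fun y i => s i y) S p :=
    continuousWithinAt_pi.2 fun i => ((hs i).continuousOn p hp)
  obtain ⟨U, hU, hpU, hUS⟩ := mem_nhdsWithin.1 (hcont hli.eventually)
  refine ⟨U, s, hU, hpU, fun i => (hs i).mono inter_subset_left, fun y hy => ?_⟩
  have hli' : LinearIndependent ℝ (fun i => s i y) := hUS ⟨hy.2, hy.1⟩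
  refine ⟨hli', Submodule.eq_of_le_of_finrank_eq ?_ ?_⟩
  · rw [Submodule.span_le]
    rintro _ ⟨i, rfl⟩
    exact hmem y hy.1 _
  · rw [finrank_span_eq_card hli', hk y hy.1, Fintype.card_fin]

end Submanifolds

/-! ### Orthogonal projections for a varying inner product -/

section Projections

theorem isUnit_of_injective {E : Type*} [NormedAddCommGroup E] [NormedSpace ℝ E]
    [FiniteDimensional ℝ E] {T : E →L[ℝ] E} (h : Function.Injective T) : IsUnit T := by
  let e := (LinearEquiv.ofInjectiveEndo T.toLinearMap h).toContinuousLinearEquiv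
  exact ⟨⟨T, (e.symm : E →L[ℝ] E), by ext x; exact e.apply_symm_apply x,
    by ext x; exact e.symm_apply_apply x⟩, rfl⟩

variable {E : Type*} [NormedAddCommGroup E] [InnerProductSpace ℝ E] [FiniteDimensional ℝ E]

/-- Two candidates differ by a vector of `W` that is orthogonal to itself. -/
theorem opProj_eq_of_mem {A : E →L[ℝ] E} (hA : IsPosDefOp A) {W : Submodule ℝ E} {u w : E}
    (hw : w ∈ W) (h : ∀ η ∈ W, ⟪w, A η⟫_ℝ = ⟪u, A η⟫_ℝ) : opProj A W u = w := by
  by_contra hne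
  have hd : opProj A W u - w ∈ W := sub_mem (opProj_mem A W u) hw
  have h1 : ⟪opProj A W u - w, A (opProj A W u - w)⟫_ℝ = 0 := by
    rw [inner_sub_left, inner_opProj hA W u hd, h _ hd, sub_self]
  exact (hA.2 _ (sub_ne_zero.2 hne)).ne' h1

theorem opProj_apply_of_mem {A : E →L[ℝ] E} (hA : IsPosDefOp A) {W : Submodule ℝ E} {u : E}
    (hu : u ∈ W) : opProj A W u = u :=
  opProj_eq_of_mem hA hu fun _ _ => rfl

theorem opProj_eq_self_iff {A : E →L[ℝ] E} (hA : IsPosDefOp A) {W : Submodule ℝ E} {u : E} :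
    opProj A W u = u ↔ u ∈ W :=
  ⟨fun h => h ▸ opProj_mem A W u, opProj_apply_of_mem hA⟩

theorem opProj_apply_of_orthogonal {A : E →L[ℝ] E} (hA : IsPosDefOp A) {W : Submodule ℝ E} {u : E}
    (hu : ∀ η ∈ W, ⟪u, A η⟫_ℝ = 0) : opProj A W u = 0 :=
  opProj_eq_of_mem hA (zero_mem W) fun η hη => by rw [hu η hη, inner_zero_left]

theorem range_opProj {A : E →L[ℝ] E} (hA : IsPosDefOp A) (W : Submodule ℝ E) :
    (opProj A W).range = W := by
  ext w
  exact ⟨fun ⟨u, hu⟩ => hu ▸ opProj_mem A W u, fun hw => ⟨w, opProj_apply_of_mem hA hw⟩⟩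

theorem contDiff_adjoint :
    ContDiff ℝ ∞ (fun T : E →L[ℝ] E => ContinuousLinearMap.adjoint T) := by
  let a : (E →L[ℝ] E) →ₗ[ℝ] (E →L[ℝ] E) :=
    { toFun := fun T => ContinuousLinearMap.adjoint T
      map_add' := fun S T => map_add _ S T
      map_smul' := fun c T => by simp }
  exact (LinearMap.toContinuousLinearMap a).contDiff

/-- The operator `PᵀAP + (1 - P)ᵀ(1 - P)`. -/
noncomputable def gramOp (A P : E →L[ℝ] E) : E →L[ℝ] E :=
  P.adjoint ∘L A ∘L P + (ContinuousLinearMap.id ℝ E - P).adjoint ∘L (ContinuousLinearMap.id ℝ E - P)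

/-- Its quadratic form is `⟪Pv, A P v⟫ + ‖v - Pv‖²`, which vanishes only for `v = 0`. -/
theorem isUnit_gramOp {A : E →L[ℝ] E} (hA : IsPosDefOp A) (P : E →L[ℝ] E) :
    IsUnit (gramOp A P) := by
  refine isUnit_of_injective fun u u' h => ?_
  rw [← sub_eq_zero] at h ⊢
  rw [← map_sub] at h
  set v := u - u'
  have h1 : ⟪P v, A (P v)⟫_ℝ + ⟪v - P v, v - P v⟫_ℝ = 0 := by
    have h2 : ⟪v, gramOp A P v⟫_ℝ = 0 := by rw [h, inner_zero_right]
    simpa only [gramOp, add_apply, ContinuousLinearMap.comp_apply, inner_add_right,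
      ContinuousLinearMap.adjoint_inner_right, sub_apply, ContinuousLinearMap.id_apply] using h2
  have h3 : P v = 0 := by
    by_contra hne
    have := hA.2 _ hne
    have h4 : 0 ≤ ⟪v - P v, v - P v⟫_ℝ := real_inner_self_nonneg
    linarith
  simpa [h3] using h1

/-- `opProj` inverts an operator on `W`, a space that moves with the point. Here the inverse is
taken on the fixed space `E`, so that smoothness in a parameter is visible. Pairing with a vector of
`W` removes the summand with `1 - P`, which leaves the defining equations of the orthogonal
projection. -/
theorem opProj_eq_gramOp {A P : E →L[ℝ] E} (hA : IsPosDefOp A) {W : Submodule ℝ E}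
    (hP : ∀ u, P u ∈ W) (hPW : ∀ u ∈ W, P u = u) :
    opProj A W = P ∘L Ring.inverse (gramOp A P) ∘L P.adjoint ∘L A := by
  ext u
  refine opProj_eq_of_mem hA (hP _) fun η hη => ?_
  set z := Ring.inverse (gramOp A P) (P.adjoint (A u)) with hz
  have h1 : gramOp A P z = P.adjoint (A u) :=
    DFunLike.congr_fun (Ring.mul_inverse_cancel _ (isUnit_gramOp hA P)) (P.adjoint (A u))
  have h2 := congrArg (fun y => ⟪y, η⟫_ℝ) h1
  simp only [gramOp, add_apply, ContinuousLinearMap.comp_apply, inner_add_left,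
    ContinuousLinearMap.adjoint_inner_left, sub_apply,
    ContinuousLinearMap.id_apply, hPW η hη, sub_self, inner_zero_right, add_zero] at h2
  rw [← hA.1, ← hA.1]
  exact h2

/-- The orthogonal projections for a smooth family of inner products onto a smooth family of
subspaces depend smoothly on the parameter. -/
theorem contDiffWithinAt_opProj {X : Type*} [NormedAddCommGroup X] [NormedSpace ℝ X] {s : Set X}
    {x : X} (hx : x ∈ s) {A P : X → E →L[ℝ] E} {W : X → Submodule ℝ E}
    (hA : ContDiffWithinAt ℝ ∞ A s x) (hP : ContDiffWithinAt ℝ ∞ P s x)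
    (hpos : ∀ y ∈ s, IsPosDefOp (A y))
    (hW : ∀ᶠ y in 𝓝[s] x, (∀ u, P y u ∈ W y) ∧ ∀ u ∈ W y, P y u = u) :
    ContDiffWithinAt ℝ ∞ (fun y => opProj (A y) (W y)) s x := by
  have hP' : ContDiffWithinAt ℝ ∞ (fun y => (P y).adjoint) s x :=
    contDiff_adjoint.contDiffAt.comp_contDiffWithinAt x hP
  have hQ : ContDiffWithinAt ℝ ∞ (fun y => ContinuousLinearMap.id ℝ E - P y) s x :=
    contDiffWithinAt_const.sub hP
  have hQ' : ContDiffWithinAt ℝ ∞ (fun y => (ContinuousLinearMap.id ℝ E - P y).adjoint) s x :=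
    contDiff_adjoint.contDiffAt.comp_contDiffWithinAt x hQ
  have hG : ContDiffWithinAt ℝ ∞ (fun y => gramOp (A y) (P y)) s x :=
    (hP'.clm_comp (hA.clm_comp hP)).add (hQ'.clm_comp hQ)
  have hI : ContDiffWithinAt ℝ ∞ (fun y => Ring.inverse (gramOp (A y) (P y))) s x := by
    obtain ⟨e, he⟩ := isUnit_gramOp (hpos x hx) (P x)
    have := contDiffAt_ringInverse ℝ (n := ∞) e
    rw [he] at this
    exact this.comp_contDiffWithinAt x hG
  refine (hP.clm_comp (hI.clm_comp (hP'.clm_comp hA))).congr_of_eventuallyEq ?_ ?_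
  · filter_upwards [hW, self_mem_nhdsWithin] with y hy hys
    exact opProj_eq_gramOp (hpos y hys) hy.1 hy.2
  · have hy := hW.self_of_nhdsWithin hx
    exact opProj_eq_gramOp (hpos x hx) hy.1 hy.2

end Projections

/-! ### Vertical and horizontal spaces and their projections -/

section Submersion

set_option linter.unusedSectionVars false

variable {E : Type*} [NormedAddCommGroup E] [InnerProductSpace ℝ E] [FiniteDimensional ℝ E]
  {m n : ℕ} {B : Type*} [TopologicalSpace B] [ChartedSpace (EuclideanSpace ℝ (Fin n)) B]
  [IsManifold (𝓡 n) ∞ B] {M : Set E} {g : E → E →L[ℝ] E} {q : E → B}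
  {gB : Bundle.ContMDiffRiemannianMetric (𝓡 n) ∞ (EuclideanSpace ℝ (Fin n))
      (fun b : B => TangentSpace (𝓡 n) b)}

/-- The map `q` in the chart of `B` at `b`. -/
noncomputable def chartMap (n : ℕ) {B : Type*} [TopologicalSpace B]
    [ChartedSpace (EuclideanSpace ℝ (Fin n)) B] (q : E → B) (b : B) (x : E) :
    EuclideanSpace ℝ (Fin n) :=
  extChartAt (𝓡 n) b (q x)

/-- A retraction onto `M` whose image `q` maps into the domain of the chart of `B` at `b`. -/
def IsAdapted (n : ℕ) {B : Type*} [TopologicalSpace B]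
    [ChartedSpace (EuclideanSpace ℝ (Fin n)) B] (M : Set E) (q : E → B) (b : B)
    (U : Set E) (r : E → E) : Prop :=
  IsRetractionOn M U r ∧ ∀ y ∈ M, y ∈ U → q y ∈ (chartAt (EuclideanSpace ℝ (Fin n)) b).source

namespace IsSubmersedAmbient

theorem exists_adapted (hM : IsSubmersedAmbient n m M g q gB) {x : E} (hx : x ∈ M) :
    ∃ (U : Set E) (r : E → E), x ∈ U ∧ IsAdapted n M q (q x) U r := by
  obtain ⟨U, r, hxU, hr⟩ := hM.submanifold.isSmoothRetract x hx
  have h1 : q ⁻¹' (chartAt (EuclideanSpace ℝ (Fin n)) (q x)).source ∈ 𝓝[M] x :=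
    (hM.smooth_q x hx).continuousWithinAt.preimage_mem_nhdsWithin
      ((chartAt (EuclideanSpace ℝ (Fin n)) (q x)).open_source.mem_nhds (mem_chart_source _ _))
  obtain ⟨V, hV, hxV, hVM⟩ := mem_nhdsWithin.1 h1
  refine ⟨_, r, ?_, hr.restrict hV, fun y hy hyU => hVM ⟨hyU.1.2, hy⟩⟩
  exact ⟨⟨hxU, hxV⟩, by rw [mem_preimage, hr.eq_self x hx hxU]; exact ⟨hxU, hxV⟩⟩

theorem contDiffOn_chartMap (hM : IsSubmersedAmbient n m M g q gB) {b : B} {U : Set E} {r : E → E}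
    (h : IsAdapted n M q b U r) : ContDiffOn ℝ ∞ (chartMap n q b ∘ r) U := by
  rw [← contMDiffOn_iff_contDiffOn]
  have h1 : ContMDiffOn 𝓘(ℝ, E) 𝓘(ℝ, E) ∞ r U := contMDiffOn_iff_contDiffOn.2 h.1.smooth
  exact (contMDiffOn_extChartAt (x := b)).comp (hM.smooth_q.comp h1 h.1.mem)
    (fun y hy => h.2 _ (h.1.mem y hy) (h.1.mem_dom y hy))

theorem contDiffAt_chartMap (hM : IsSubmersedAmbient n m M g q gB) {b : B} {U : Set E} {r : E → E}
    (h : IsAdapted n M q b U r) {x : E} (hx : x ∈ U) :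
    ContDiffAt ℝ ∞ (chartMap n q b ∘ r) x :=
  (hM.contDiffOn_chartMap h).contDiffAt (h.1.mem_nhds hx)

theorem hasMFDerivWithinAt (hM : IsSubmersedAmbient n m M g q gB) {x : E} (hx : x ∈ M) :
    HasMFDerivWithinAt 𝓘(ℝ, E) (𝓡 n) q M x (dqAt n M q x) :=
  ((hM.smooth_q x hx).mdifferentiableWithinAt (by simp)).hasMFDerivWithinAt

/-- Both sides are derivatives within `M` of `q` followed by the chart, so they agree on tangent
vectors. -/
theorem fderiv_chartMap_apply (hM : IsSubmersedAmbient n m M g q gB) {b : B} {U : Set E}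
    {r : E → E} (h : IsAdapted n M q b U r) {x w : E} (hx : x ∈ M) (hxU : x ∈ U)
    (hw : w ∈ tangentSpaceAt M x) :
    fderiv ℝ (chartMap n q b ∘ r) x w =
      mfderiv (𝓡 n) 𝓘(ℝ, EuclideanSpace ℝ (Fin n)) (extChartAt (𝓡 n) b) (q x)
        (dqAt n M q x w) := by
  have h1 : HasMFDerivAt (𝓡 n) 𝓘(ℝ, EuclideanSpace ℝ (Fin n)) (extChartAt (𝓡 n) b) (q x)
      (mfderiv (𝓡 n) 𝓘(ℝ, EuclideanSpace ℝ (Fin n)) (extChartAt (𝓡 n) b) (q x)) :=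
    (mdifferentiableAt_extChartAt (h.2 x hx hxU)).hasMFDerivAt
  have h2 := hasMFDerivWithinAt_iff_hasFDerivWithinAt.1
    (h1.comp_hasMFDerivWithinAt x (hM.hasMFDerivWithinAt hx))
  have h3 : HasFDerivWithinAt (chartMap n q b) (fderiv ℝ (chartMap n q b ∘ r) x) M x := by
    refine ((hM.contDiffAt_chartMap h hxU).differentiableAt
      (by simp)).hasFDerivAt.hasFDerivWithinAt.congr_of_eventuallyEq ?_ ?_
    · filter_upwards [self_mem_nhdsWithin, mem_nhdsWithin_of_mem_nhds (h.1.mem_nhds hxU)]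
        with y h4 h5
      rw [Function.comp_apply, h.1.eq_self y h4 h5]
    · rw [Function.comp_apply, h.1.eq_self x hx hxU]
  exact HasFDerivWithinAt.eq_on_tangent h3 h2 hw

theorem mfderiv_extChartAt_bijective {b b' : B}
    (h : b' ∈ (chartAt (EuclideanSpace ℝ (Fin n)) b).source) :
    Function.Bijective (mfderiv (𝓡 n) 𝓘(ℝ, EuclideanSpace ℝ (Fin n)) (extChartAt (𝓡 n) b) b') := by
  obtain ⟨e, he⟩ := isInvertible_mfderiv_extChartAt (I := 𝓡 n) (x := b) (y := b')
    (by rwa [extChartAt_source])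
  rw [← he]
  exact e.bijective

theorem fderiv_chartMap_eq_zero_iff (hM : IsSubmersedAmbient n m M g q gB) {b : B} {U : Set E}
    {r : E → E} (h : IsAdapted n M q b U r) {x w : E} (hx : x ∈ M) (hxU : x ∈ U)
    (hw : w ∈ tangentSpaceAt M x) :
    fderiv ℝ (chartMap n q b ∘ r) x w = 0 ↔ dqAt n M q x w = 0 := by
  rw [hM.fderiv_chartMap_apply h hx hxU hw]
  exact map_eq_zero_iff _ (mfderiv_extChartAt_bijective (h.2 x hx hxU)).1

theorem fderiv_chartMap_surj (hM : IsSubmersedAmbient n m M g q gB) {b : B} {U : Set E}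
    {r : E → E} (h : IsAdapted n M q b U r) {x : E} (hx : x ∈ M) (hxU : x ∈ U)
    (c : EuclideanSpace ℝ (Fin n)) :
    ∃ w ∈ tangentSpaceAt M x, fderiv ℝ (chartMap n q b ∘ r) x w = c := by
  obtain ⟨c', hc'⟩ := (mfderiv_extChartAt_bijective (h.2 x hx hxU)).2 c
  obtain ⟨w, hw, hwc⟩ := hM.submersion x hx (mem_univ c')
  exact ⟨w, hw, by rw [hM.fderiv_chartMap_apply h hx hxU hw, hwc, hc']⟩

/-- Since the chart is injective on its domain, fibers of `q` are locally level sets of its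
coordinate expression. -/
theorem isSubmersiveLevelAt_fiber (hM : IsSubmersedAmbient n m M g q gB) {b : B} {U : Set E}
    {r : E → E} (h : IsAdapted n M q b U r) {x : E} (hx : x ∈ M) (hxU : x ∈ U) :
    IsSubmersiveLevelAt (EuclideanSpace ℝ (Fin n)) M {y | y ∈ M ∧ q y = q x} x
      (chartMap n q b ∘ r) := by
  refine ⟨U, r, hxU, h.1, hM.contDiffOn_chartMap h, fun y hy hyU => ?_,
    hM.fderiv_chartMap_surj h hx hxU⟩
  rw [Function.comp_apply, Function.comp_apply, h.1.eq_self y hy hyU, h.1.eq_self x hx hxU]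
  refine ⟨fun h1 => by rw [chartMap, chartMap, h1.2], fun h1 => ⟨hy, ?_⟩⟩
  refine (extChartAt (𝓡 n) b).injOn ?_ ?_ h1
  · rw [extChartAt_source]; exact h.2 y hy hyU
  · rw [extChartAt_source]; exact h.2 x hx hxU

theorem le_dim (hM : IsSubmersedAmbient n m M g q gB) {x : E} (hx : x ∈ M) : n ≤ m := by
  obtain ⟨U, r, hxU, h⟩ := hM.exists_adapted hx
  have h1 := (hM.isSubmersiveLevelAt_fiber h hx hxU).finrank_ker
  rw [hM.submanifold.finrank_tangentSpaceAt hx, finrank_euclideanSpace_fin] at h1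
  omega

theorem exists_levelAt (hM : IsSubmersedAmbient n m M g q gB) {x : E} :
    ∀ p ∈ {y | y ∈ M ∧ q y = q x}, ∃ f : E → EuclideanSpace ℝ (Fin n),
      IsSubmersiveLevelAt (EuclideanSpace ℝ (Fin n)) M {y | y ∈ M ∧ q y = q x} p f := by
  rintro p ⟨hp, hpx⟩
  obtain ⟨U, r, hpU, h⟩ := hM.exists_adapted hp
  have := hM.isSubmersiveLevelAt_fiber h hp hpU
  rw [hpx] at this
  exact ⟨_, this⟩

theorem finrank_tangent_eq (hM : IsSubmersedAmbient n m M g q gB) {x : E} (hx : x ∈ M) :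
    Module.finrank ℝ (tangentSpaceAt M x) =
      (m - n) + Module.finrank ℝ (EuclideanSpace ℝ (Fin n)) := by
  have := hM.le_dim hx
  rw [hM.submanifold.finrank_tangentSpaceAt hx, finrank_euclideanSpace_fin]
  omega

/-- The vertical space is the kernel of the differential of the submersion. -/
theorem mem_vertSpace (hM : IsSubmersedAmbient n m M g q gB) {b : B} {U : Set E} {r : E → E}
    (h : IsAdapted n M q b U r) {x w : E} (hx : x ∈ M) (hxU : x ∈ U) :
    w ∈ vertSpace M q x ↔
      w ∈ tangentSpaceAt M x ∧ fderiv ℝ (chartMap n q b ∘ r) x w = 0 := by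
  rw [vertSpace, tangentSpaceAt_levelSet (fun y hy => hy.1) hM.exists_levelAt
    (fun _ hp => hM.finrank_tangent_eq hp.1) ⟨hx, rfl⟩ (hM.isSubmersiveLevelAt_fiber h hx hxU)]
  rfl

theorem mem_vertSpace_iff_dqAt (hM : IsSubmersedAmbient n m M g q gB) {x w : E} (hx : x ∈ M) :
    w ∈ vertSpace M q x ↔ w ∈ tangentSpaceAt M x ∧ dqAt n M q x w = 0 := by
  obtain ⟨U, r, hxU, h⟩ := hM.exists_adapted hx
  rw [hM.mem_vertSpace h hx hxU]
  exact and_congr_right fun hw => hM.fderiv_chartMap_eq_zero_iff h hx hxU hw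

theorem finrank_vertSpace (hM : IsSubmersedAmbient n m M g q gB) {x : E} (hx : x ∈ M) :
    Module.finrank ℝ (vertSpace M q x) = m - n :=
  (isEmbSubmanifold_of_levelSet (fun y (hy : y ∈ {y | y ∈ M ∧ q y = q x}) => hy.1)
    hM.exists_levelAt
    (fun _ hp => hM.finrank_tangent_eq hp.1)).finrank_tangentSpaceAt ⟨hx, rfl⟩

theorem _root_.SubmersedAmbient.vertSpace_le (M : Set E) (q : E → B) (x : E) :
    vertSpace M q x ≤ tangentSpaceAt M x :=
  tangentSpaceAt_mono (fun _ hy => hy.1) x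

/-! ### Smoothness of the three projections -/

theorem contDiffOn_projT (hM : IsSubmersedAmbient n m M g q gB) :
    ContDiffOn ℝ ∞ (projT M g) M := by
  intro x hx
  obtain ⟨U, r, hxU, h⟩ := hM.submanifold.isSmoothRetract x hx
  refine contDiffWithinAt_opProj (P := fderiv ℝ r) hx (hM.smooth_g x hx) ?_ hM.posDef_g ?_
  · exact ((h.smooth.fderiv_of_isOpen h.isOpen (by simp)).contDiffAt
      (h.mem_nhds hxU)).contDiffWithinAt
  · filter_upwards [self_mem_nhdsWithin, mem_nhdsWithin_of_mem_nhds (h.mem_nhds hxU)] with y hy hyU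
    exact ⟨h.fderiv_mem hy hyU, fun u hu => (h.mem_tangentSpaceAt hy hyU).1 hu⟩

/-- By `contDiffWithinAt_opProj` any smooth field of projections onto the vertical spaces suffices,
orthogonal or not. One is built by removing from a tangent vector a correction with the same image
under the differential of `q`. -/
theorem contDiffOn_projV (hM : IsSubmersedAmbient n m M g q gB) :
    ContDiffOn ℝ ∞ (projV M g q) M := by
  intro x hx
  obtain ⟨U, r, hxU, h⟩ := hM.exists_adapted hx
  set R := fderiv ℝ r
  set L := fderiv ℝ (chartMap n q (q x) ∘ r)
  have hR : ContDiffAt ℝ ∞ R x :=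
    (h.1.smooth.fderiv_of_isOpen h.1.isOpen (by simp)).contDiffAt (h.1.mem_nhds hxU)
  have hL : ContDiffAt ℝ ∞ L x :=
    ((hM.contDiffOn_chartMap h).fderiv_of_isOpen h.1.isOpen (by simp)).contDiffAt
      (h.1.mem_nhds hxU)
  have hsurj : LinearMap.range (L x ∘L R x).toLinearMap = ⊤ := by
    rw [LinearMap.range_eq_top]
    intro c
    obtain ⟨w, hw, hc⟩ := hM.fderiv_chartMap_surj h hx hxU c
    refine ⟨w, ?_⟩
    change L x (R x w) = c
    rw [(h.1.mem_tangentSpaceAt hx hxU).1 hw]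
    exact hc
  obtain ⟨s₀, hs₀⟩ := LinearMap.exists_rightInverse_of_surjective _ hsurj
  set σ : EuclideanSpace ℝ (Fin n) →L[ℝ] E := LinearMap.toContinuousLinearMap s₀
  -- As `σ` is a right inverse of `L R` at `x`, `K` is the identity there and stays invertible
  -- nearby; `R σ K⁻¹` is then a tangent right inverse of `L` at nearby points of `M`.
  set K : E → EuclideanSpace ℝ (Fin n) →L[ℝ] EuclideanSpace ℝ (Fin n) :=
    fun y => L y ∘L R y ∘L σ with hK
  have hKs : ContDiffAt ℝ ∞ K x := hL.clm_comp (hR.clm_comp contDiffAt_const)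
  have hKx : K x = 1 := by
    ext1 c
    exact LinearMap.congr_fun hs₀ c
  have hKi : ContDiffAt ℝ ∞ (fun y => Ring.inverse (K y)) x := by
    have h1 := contDiffAt_ringInverse ℝ (n := ∞)
      (1 : (EuclideanSpace ℝ (Fin n) →L[ℝ] EuclideanSpace ℝ (Fin n))ˣ)
    rw [Units.val_one, ← hKx] at h1
    exact h1.comp x hKs
  have hKu : ∀ᶠ y in 𝓝 x, IsUnit (K y) :=
    hKs.continuousAt.eventually_mem (Units.isOpen.mem_nhds (by
      change IsUnit (K x)
      rw [hKx]; exact isUnit_one))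
  refine contDiffWithinAt_opProj
    (P := fun y => R y - R y ∘L σ ∘L Ring.inverse (K y) ∘L L y ∘L R y) hx (hM.smooth_g x hx)
    ?_ hM.posDef_g ?_
  · exact (hR.sub (hR.clm_comp (contDiffAt_const.clm_comp (hKi.clm_comp
      (hL.clm_comp hR))))).contDiffWithinAt
  · filter_upwards [self_mem_nhdsWithin, mem_nhdsWithin_of_mem_nhds (h.1.mem_nhds hxU),
      mem_nhdsWithin_of_mem_nhds hKu] with y hy hyU hyK
    have hm : ∀ u, R y u ∈ tangentSpaceAt M y := h.1.fderiv_mem hy hyU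
    constructor
    · intro u
      refine (hM.mem_vertSpace h hy hyU).2 ⟨sub_mem (hm _) (hm _), ?_⟩
      have h2 := DFunLike.congr_fun (Ring.mul_inverse_cancel _ hyK) (L y (R y u))
      change L y (R y (σ (Ring.inverse (K y) (L y (R y u))))) = L y (R y u) at h2
      change L y (R y u - R y (σ (Ring.inverse (K y) (L y (R y u))))) = 0
      rw [map_sub, h2, sub_self]
    · intro u hu
      obtain ⟨h2, h3⟩ := (hM.mem_vertSpace h hy hyU).1 hu
      have h4 : R y u = u := (h.1.mem_tangentSpaceAt hy hyU).1 h2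
      change R y u - R y (σ (Ring.inverse (K y) (L y (R y u)))) = u
      have h5 : L y u = 0 := h3
      simp only [h4, h5, map_zero, sub_zero]

/-- The difference `Π u - 𝚅 u` has the properties that characterize `𝙷 u`. Smoothness of `𝙷` is
thereby inherited from `Π` and `𝚅`. -/
theorem projT_eq (hM : IsSubmersedAmbient n m M g q gB) {x : E} (hx : x ∈ M) (u : E) :
    projT M g x u = projH M g q x u + projV M g q x u := by
  have hA := hM.posDef_g x hx
  rw [← sub_eq_iff_eq_add]
  symm
  have hV : ∀ u, projV M g q x u ∈ vertSpace M q x := opProj_mem _ _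
  refine opProj_eq_of_mem hA ⟨sub_mem (opProj_mem _ _ _) (vertSpace_le M q x (hV u)), ?_⟩ ?_
  · intro ε hε
    rw [inner_sub_left, projT, projV, inner_opProj hA _ _ hε,
      inner_opProj hA _ _ (vertSpace_le M q x hε), sub_self]
  · intro η hη
    rw [inner_sub_left, projT, inner_opProj hA _ _ hη.1, ← hA.1 (projV M g q x u),
      real_inner_comm η, hη.2 _ (hV u), sub_zero]

theorem contDiffOn_projH (hM : IsSubmersedAmbient n m M g q gB) :
    ContDiffOn ℝ ∞ (projH M g q) M := by
  refine (hM.contDiffOn_projT.sub hM.contDiffOn_projV).congr fun x hx => ?_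
  ext u
  rw [sub_apply, hM.projT_eq hx, add_sub_cancel_right]

/-! ### Pointwise properties of the projections -/

theorem projT_eq_self (hM : IsSubmersedAmbient n m M g q gB) {x u : E} (hx : x ∈ M) :
    projT M g x u = u ↔ u ∈ tangentSpaceAt M x := opProj_eq_self_iff (hM.posDef_g x hx)

theorem projH_eq_self (hM : IsSubmersedAmbient n m M g q gB) {x u : E} (hx : x ∈ M) :
    projH M g q x u = u ↔ u ∈ horSpace M g q x := opProj_eq_self_iff (hM.posDef_g x hx)

theorem projV_eq_self (hM : IsSubmersedAmbient n m M g q gB) {x u : E} (hx : x ∈ M) :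
    projV M g q x u = u ↔ u ∈ vertSpace M q x := opProj_eq_self_iff (hM.posDef_g x hx)

theorem _root_.SubmersedAmbient.projH_mem (M : Set E) (g : E → E →L[ℝ] E) (q : E → B) (x u : E) :
    projH M g q x u ∈ horSpace M g q x := opProj_mem _ _ _

theorem _root_.SubmersedAmbient.projV_mem (M : Set E) (g : E → E →L[ℝ] E) (q : E → B) (x u : E) :
    projV M g q x u ∈ vertSpace M q x := opProj_mem _ _ _

theorem projH_projH (hM : IsSubmersedAmbient n m M g q gB) {x : E} (hx : x ∈ M) (u : E) :
    projH M g q x (projH M g q x u) = projH M g q x u :=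
  (hM.projH_eq_self hx).2 (projH_mem M g q x u)

theorem projV_projV (hM : IsSubmersedAmbient n m M g q gB) {x : E} (hx : x ∈ M) (u : E) :
    projV M g q x (projV M g q x u) = projV M g q x u :=
  (hM.projV_eq_self hx).2 (projV_mem M g q x u)

theorem projH_apply_vert (hM : IsSubmersedAmbient n m M g q gB) {x ε : E} (hx : x ∈ M)
    (hε : ε ∈ vertSpace M q x) : projH M g q x ε = 0 := by
  have hA := hM.posDef_g x hx
  refine opProj_apply_of_orthogonal hA fun η hη => ?_
  rw [← hA.1, real_inner_comm, hη.2 ε hε]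

theorem projV_apply_hor (hM : IsSubmersedAmbient n m M g q gB) {x v : E} (hx : x ∈ M)
    (hv : v ∈ horSpace M g q x) : projV M g q x v = 0 :=
  opProj_apply_of_orthogonal (hM.posDef_g x hx) hv.2

theorem projH_add_projV (hM : IsSubmersedAmbient n m M g q gB) {x u : E} (hx : x ∈ M)
    (hu : u ∈ tangentSpaceAt M x) : projH M g q x u + projV M g q x u = u := by
  rw [← hM.projT_eq hx, (hM.projT_eq_self hx).2 hu]

theorem eq_zero_of_mem_hor_of_mem_vert (hM : IsSubmersedAmbient n m M g q gB) {x v : E}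
    (hx : x ∈ M) (hv : v ∈ horSpace M g q x) (hv' : v ∈ vertSpace M q x) : v = 0 := by
  rw [← (hM.projH_eq_self hx).2 hv, hM.projH_apply_vert hx hv']

theorem finrank_horSpace (hM : IsSubmersedAmbient n m M g q gB) {x : E} (hx : x ∈ M) :
    Module.finrank ℝ (horSpace M g q x) = n := by
  have h1 := Submodule.finrank_sup_add_finrank_inf_eq (horSpace M g q x) (vertSpace M q x)
  have h2 : horSpace M g q x ⊓ vertSpace M q x = ⊥ := by
    rw [eq_bot_iff]
    rintro v ⟨hv, hv'⟩
    exact hM.eq_zero_of_mem_hor_of_mem_vert hx hv hv'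
  have h3 : horSpace M g q x ⊔ vertSpace M q x = tangentSpaceAt M x := by
    refine le_antisymm (sup_le (fun v hv => hv.1) (vertSpace_le M q x)) fun u hu => ?_
    rw [← hM.projH_add_projV hx hu]
    exact Submodule.add_mem_sup (projH_mem M g q x u) (projV_mem M g q x u)
  rw [h2, h3, finrank_bot, hM.submanifold.finrank_tangentSpaceAt hx,
    hM.finrank_vertSpace hx] at h1
  have := hM.le_dim hx
  omega

/-- Dropping the vertical component of a preimage does not change its image. -/
theorem exists_hor_fderiv_chartMap (hM : IsSubmersedAmbient n m M g q gB) {b : B} {U : Set E}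
    {r : E → E} (h : IsAdapted n M q b U r) {x : E} (hx : x ∈ M) (hxU : x ∈ U)
    (c : EuclideanSpace ℝ (Fin n)) :
    ∃ w ∈ horSpace M g q x, fderiv ℝ (chartMap n q b ∘ r) x w = c := by
  obtain ⟨w, hw, hc⟩ := hM.fderiv_chartMap_surj h hx hxU c
  refine ⟨projH M g q x w, projH_mem M g q x w, ?_⟩
  rw [← hc, ← sub_eq_zero, ← map_sub]
  have h1 : projH M g q x w - w = -projV M g q x w := by
    nth_rewrite 2 [← hM.projH_add_projV hx hw]
    abel
  rw [h1, map_neg, ((hM.mem_vertSpace h hx hxU).1 (projV_mem M g q x w)).2, neg_zero]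

end IsSubmersedAmbient

end Submersion

/-! ### The horizontal bundle and the differential of the submersion on it -/

section HorizontalBundle

set_option linter.unusedSectionVars false

variable {E : Type*} [NormedAddCommGroup E] [InnerProductSpace ℝ E] [FiniteDimensional ℝ E]
  {m n : ℕ} {B : Type*} [TopologicalSpace B] [ChartedSpace (EuclideanSpace ℝ (Fin n)) B]
  [IsManifold (𝓡 n) ∞ B] {M : Set E} {g : E → E →L[ℝ] E} {q : E → B}
  {gB : Bundle.ContMDiffRiemannianMetric (𝓡 n) ∞ (EuclideanSpace ℝ (Fin n))
      (fun b : B => TangentSpace (𝓡 n) b)}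

/-- The differential of `q` in the charts of `B` and of its tangent bundle at `b`. -/
noncomputable def dqChart (n : ℕ) {B : Type*} [TopologicalSpace B]
    [ChartedSpace (EuclideanSpace ℝ (Fin n)) B] (q : E → B) (b : B) (r : E → E) (p : E × E) :
    EuclideanSpace ℝ (Fin n) × EuclideanSpace ℝ (Fin n) :=
  ((chartMap n q b ∘ r) p.1, fderiv ℝ (chartMap n q b ∘ r) p.1 p.2)

namespace IsSubmersedAmbient

theorem HM_eq_totalSet (hM : IsSubmersedAmbient n m M g q gB) :
    HM M g q = totalSet M (projH M g q) := by
  ext p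
  exact and_congr_right fun hp => (hM.projH_eq_self hp).symm

theorem isEmbSubmanifold_HM (hM : IsSubmersedAmbient n m M g q gB) :
    IsEmbSubmanifold (m + n) (HM M g q) := by
  rw [hM.HM_eq_totalSet]
  refine isEmbSubmanifold_totalSet hM.submanifold hM.contDiffOn_projH (fun _ hy => hM.projH_projH hy)
    fun y hy => ?_
  rw [projH, range_opProj (hM.posDef_g y hy), hM.finrank_horSpace hy]

theorem mem_THM (hM : IsSubmersedAmbient n m M g q gB) {p : E × E} (hp : p ∈ HM M g q)
    {Δ : E × E} : Δ ∈ THM M g q p ↔ Δ.1 ∈ tangentSpaceAt M p.1 ∧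
      derivH M g q p.1 Δ.1 p.2 + projH M g q p.1 Δ.2 = Δ.2 := by
  have hp' := hp
  rw [hM.HM_eq_totalSet] at hp'
  rw [THM, hM.HM_eq_totalSet]
  exact mem_tangentSpaceAt_totalSet hM.submanifold.isSmoothRetract hM.contDiffOn_projH
    (fun _ hy => hM.projH_projH hy) hp'

theorem tangentBundleSet_HM (hM : IsSubmersedAmbient n m M g q gB) :
    tangentBundleSet (HM M g q) =
      {z : (E × E) × (E × E) | z.1.1 ∈ M ∧ projH M g q z.1.1 z.1.2 = z.1.2 ∧
        projT M g z.1.1 z.2.1 = z.2.1 ∧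
        derivH M g q z.1.1 z.2.1 z.1.2 + projH M g q z.1.1 z.2.2 = z.2.2} := by
  ext z
  constructor
  · rintro ⟨hz, hΔ⟩
    obtain ⟨h1, h2⟩ := (hM.mem_THM hz).1 hΔ
    exact ⟨hz.1, (hM.projH_eq_self hz.1).2 hz.2, (hM.projT_eq_self hz.1).2 h1, h2⟩
  · rintro ⟨h1, h2, h3, h4⟩
    have hz : z.1 ∈ HM M g q := ⟨h1, (hM.projH_eq_self h1).1 h2⟩
    exact ⟨hz, (hM.mem_THM hz).2 ⟨(hM.projT_eq_self h1).1 h3, h4⟩⟩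

theorem projH_derivH (hM : IsSubmersedAmbient n m M g q gB) {p : E × E} (hp : p ∈ HM M g q)
    {w : E} (hw : w ∈ tangentSpaceAt M p.1) :
    projH M g q p.1 (derivH M g q p.1 w p.2) = 0 :=
  proj_fderivWithin_apply hM.contDiffOn_projH (fun _ hy => hM.projH_projH hy) hp.1 hw
    ((hM.projH_eq_self hp.1).2 hp.2)

/-! ### The differential of the submersion in charts -/

theorem contDiffOn_dqChart (hM : IsSubmersedAmbient n m M g q gB) {b : B} {U : Set E} {r : E → E}
    (h : IsAdapted n M q b U r) : ContDiffOn ℝ ∞ (dqChart n q b r) (Prod.fst ⁻¹' U) := by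
  have h1 : ContDiffOn ℝ ∞ (Prod.fst : E × E → E) (Prod.fst ⁻¹' U) := contDiff_fst.contDiffOn
  refine ((hM.contDiffOn_chartMap h).comp h1 fun z hz => hz).prodMk ?_
  exact (((hM.contDiffOn_chartMap h).fderiv_of_isOpen h.1.isOpen (by simp)).comp h1
    fun z hz => hz).clm_apply contDiff_snd.contDiffOn

theorem contDiffAt_dqChart (hM : IsSubmersedAmbient n m M g q gB) {b : B} {U : Set E} {r : E → E}
    (h : IsAdapted n M q b U r) {p : E × E} (hp : p.1 ∈ U) :
    ContDiffAt ℝ ∞ (dqChart n q b r) p :=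
  (hM.contDiffOn_dqChart h).contDiffAt ((h.1.isOpen.preimage continuous_fst).mem_nhds hp)

theorem fderiv_dqChart (hM : IsSubmersedAmbient n m M g q gB) {b : B} {U : Set E} {r : E → E}
    (h : IsAdapted n M q b U r) {p : E × E} (hp : p.1 ∈ U) (Δ : E × E) :
    fderiv ℝ (dqChart n q b r) p Δ = (fderiv ℝ (chartMap n q b ∘ r) p.1 Δ.1,
      fderiv ℝ (fderiv ℝ (chartMap n q b ∘ r)) p.1 Δ.1 p.2 +
        fderiv ℝ (chartMap n q b ∘ r) p.1 Δ.2) := by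
  have h1 : HasFDerivAt (fun y : E × E => (chartMap n q b ∘ r) y.1)
      ((fderiv ℝ (chartMap n q b ∘ r) p.1).comp (ContinuousLinearMap.fst ℝ E E)) p :=
    ((hM.contDiffAt_chartMap h hp).differentiableAt (by simp)).hasFDerivAt.comp p hasFDerivAt_fst
  have h2 : ContDiffAt ℝ ∞ (fderiv ℝ (chartMap n q b ∘ r)) p.1 :=
    ((hM.contDiffOn_chartMap h).fderiv_of_isOpen h.1.isOpen (by simp)).contDiffAt
      (h.1.mem_nhds hp)
  have h3 : HasFDerivAt (fun y : E × E => fderiv ℝ (chartMap n q b ∘ r) y.1)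
      ((fderiv ℝ (fderiv ℝ (chartMap n q b ∘ r)) p.1).comp (ContinuousLinearMap.fst ℝ E E)) p :=
    (h2.differentiableAt (by simp)).hasFDerivAt.comp p hasFDerivAt_fst
  have h4 : HasFDerivAt (dqChart n q b r) _ p := h1.prodMk (h3.clm_apply hasFDerivAt_snd)
  rw [h4.fderiv]
  simp [add_comm]

/-- The trivialization of the tangent bundle at `b` acts on fibers as the differential of the chart
at `b`, so this is the chain rule. -/
theorem trivializationAt_dq (hM : IsSubmersedAmbient n m M g q gB) {b : B} {U : Set E}
    {r : E → E} (h : IsAdapted n M q b U r) {p : E × E} (hp : p ∈ HM M g q) (hpU : p.1 ∈ U) :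
    (trivializationAt (EuclideanSpace ℝ (Fin n)) (TangentSpace (𝓡 n)) b (dq n M q p)).2 =
      fderiv ℝ (chartMap n q b ∘ r) p.1 p.2 := by
  have hsrc := h.2 _ hp.1 hpU
  have h1 := TangentBundle.continuousLinearMapAt_trivializationAt (I := 𝓡 n) hsrc
  have h2 : (trivializationAt (EuclideanSpace ℝ (Fin n)) (TangentSpace (𝓡 n)) b).linearMapAt ℝ
      (q p.1) (dqAt n M q p.1 p.2) =
      (trivializationAt (EuclideanSpace ℝ (Fin n)) (TangentSpace (𝓡 n)) b
        ⟨q p.1, dqAt n M q p.1 p.2⟩).2 := by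
    rw [Bundle.Trivialization.coe_linearMapAt_of_mem]
    exact hsrc
  rw [hM.fderiv_chartMap_apply h hp.1 hpU hp.2.1]
  exact h2.symm.trans (DFunLike.congr_fun h1 (dqAt n M q p.1 p.2))

theorem extChartAt_dq (hM : IsSubmersedAmbient n m M g q gB) {w : TangentBundle (𝓡 n) B}
    {U : Set E} {r : E → E} (h : IsAdapted n M q w.proj U r) {p : E × E} (hp : p ∈ HM M g q)
    (hpU : p.1 ∈ U) : extChartAt (𝓡 n).tangent w (dq n M q p) = dqChart n q w.proj r p := by
  have h1 := hM.trivializationAt_dq h hp hpU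
  have hsrc := h.2 _ hp.1 hpU
  change extChartAt ((𝓡 n).prod 𝓘(ℝ, EuclideanSpace ℝ (Fin n))) w (dq n M q p) = _
  rw [FiberBundle.extChartAt]
  refine Prod.ext ?_ h1
  change extChartAt (𝓡 n) w.proj
    (trivializationAt (EuclideanSpace ℝ (Fin n)) (TangentSpace (𝓡 n)) w.proj (dq n M q p)).1 = _
  rw [Bundle.Trivialization.coe_fst']
  · simp only [dqChart, Function.comp_apply, h.1.eq_self _ hp.1 hpU]
    rfl
  · exact hsrc

/-- Smoothness into a total space means smoothness of the base map and of the fiber coordinate in a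
trivialization. -/
theorem contMDiffOn_dq (hM : IsSubmersedAmbient n m M g q gB) :
    ContMDiffOn 𝓘(ℝ, E × E) (𝓡 n).tangent ∞ (dq n M q) (HM M g q) := by
  intro p hp
  obtain ⟨U, r, hpU, h⟩ := hM.exists_adapted hp.1
  have hfst : ContMDiffOn 𝓘(ℝ, E × E) 𝓘(ℝ, E) ∞ (Prod.fst : E × E → E) (HM M g q) :=
    contMDiffOn_iff_contDiffOn.2 contDiff_fst.contDiffOn
  refine (Bundle.contMDiffWithinAt_totalSpace
    (E := fun b : B => TangentSpace (𝓡 n) b)).2 ⟨?_, ?_⟩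
  · exact (hM.smooth_q.comp hfst fun y hy => hy.1) p hp
  · rw [contMDiffWithinAt_iff_contDiffWithinAt]
    refine ((hM.contDiffAt_dqChart h hpU).snd.contDiffWithinAt).congr_of_eventuallyEq ?_
      (hM.trivializationAt_dq h hp hpU)
    filter_upwards [self_mem_nhdsWithin, mem_nhdsWithin_of_mem_nhds
      ((h.1.isOpen.preimage continuous_fst).mem_nhds hpU)] with y hy hyU
    exact hM.trivializationAt_dq h hy hyU

theorem hasMFDerivWithinAt_dq (hM : IsSubmersedAmbient n m M g q gB) {p : E × E}
    (hp : p ∈ HM M g q) : HasMFDerivWithinAt 𝓘(ℝ, E × E) (𝓡 n).tangent (dq n M q) (HM M g q) p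
      (ddq n M g q p) :=
  ((hM.contMDiffOn_dq p hp).mdifferentiableWithinAt (by simp)).hasMFDerivWithinAt

/-- `mfderivWithin` is the derivative of the map read in the preferred chart at its value. On `HM`
that reading coincides with `dqChart`, whose ordinary derivative is explicit. -/
theorem ddq_apply (hM : IsSubmersedAmbient n m M g q gB) {U : Set E} {r : E → E} {p : E × E}
    (h : IsAdapted n M q (q p.1) U r) (hp : p ∈ HM M g q) (hpU : p.1 ∈ U) {Δ : E × E}
    (hΔ : Δ ∈ THM M g q p) : ddq n M g q p Δ = fderiv ℝ (dqChart n q (q p.1) r) p Δ := by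
  have h1 := (hM.hasMFDerivWithinAt_dq hp).2
  simp only [writtenInExtChartAt, extChartAt_model_space_eq_id, PartialEquiv.refl_coe,
    PartialEquiv.refl_symm, Function.comp_id, preimage_id_eq, id_eq, modelWithCornersSelf_coe,
    range_id, inter_univ] at h1
  have h2 : HasFDerivWithinAt (extChartAt (𝓡 n).tangent (dq n M q p) ∘ dq n M q)
      (fderiv ℝ (dqChart n q (q p.1) r) p) (HM M g q) p := by
    refine ((hM.contDiffAt_dqChart h hpU).differentiableAt
      (by simp)).hasFDerivAt.hasFDerivWithinAt.congr_of_eventuallyEq ?_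
      (hM.extChartAt_dq (w := dq n M q p) h hp hpU)
    filter_upwards [self_mem_nhdsWithin, mem_nhdsWithin_of_mem_nhds
      ((h.1.isOpen.preimage continuous_fst).mem_nhds hpU)] with y hy hyU
    exact hM.extChartAt_dq (w := dq n M q p) h hy hyU
  exact HasFDerivWithinAt.eq_on_tangent h1 h2 hΔ

end IsSubmersedAmbient

end HorizontalBundle

/-! ### Horizontal lifts, the operator `𝚀`, the map `b` and the splitting -/

section Decomposition

set_option linter.unusedSectionVars false

variable {E : Type*} [NormedAddCommGroup E] [InnerProductSpace ℝ E] [FiniteDimensional ℝ E]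
  {m n : ℕ} {B : Type*} [TopologicalSpace B] [ChartedSpace (EuclideanSpace ℝ (Fin n)) B]
  [IsManifold (𝓡 n) ∞ B] {M : Set E} {g : E → E →L[ℝ] E} {q : E → B}
  {gB : Bundle.ContMDiffRiemannianMetric (𝓡 n) ∞ (EuclideanSpace ℝ (Fin n))
      (fun b : B => TangentSpace (𝓡 n) b)}

namespace IsSubmersedAmbient

/-! ### Horizontal lifts and the fibers of the differential -/

theorem eq_of_dqAt_eq (hM : IsSubmersedAmbient n m M g q gB) {x v v' : E} (hx : x ∈ M)
    (hv : v ∈ horSpace M g q x) (hv' : v' ∈ horSpace M g q x)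
    (h : dqAt n M q x v = dqAt n M q x v') : v = v' := by
  rw [← sub_eq_zero]
  have h1 : v - v' ∈ horSpace M g q x := sub_mem hv hv'
  refine hM.eq_zero_of_mem_hor_of_mem_vert hx h1 ((hM.mem_vertSpace_iff_dqAt hx).2 ⟨h1.1, ?_⟩)
  rw [map_sub, h, sub_self]

theorem existsUnique_horLift (hM : IsSubmersedAmbient n m M g q gB) {x : E} (hx : x ∈ M)
    (w : TangentBundle (𝓡 n) B) (hw : w.proj = q x) :
    ∃! v, v ∈ horSpace M g q x ∧ dq n M q (x, v) = w := by
  obtain ⟨b, c⟩ := w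
  change b = q x at hw
  subst hw
  obtain ⟨w, hw, hc⟩ := hM.submersion x hx (mem_univ c)
  have h1 : dqAt n M q x (projV M g q x w) = 0 :=
    ((hM.mem_vertSpace_iff_dqAt hx).1 (projV_mem M g q x w)).2
  have h2 : dqAt n M q x (projH M g q x w) = c := by
    rw [← hc]
    conv_rhs => rw [← hM.projH_add_projV hx hw, map_add, h1, add_zero]
  refine ⟨projH M g q x w, ⟨projH_mem M g q x w, ?_⟩, ?_⟩
  · exact congrArg (fun c' => (⟨q x, c'⟩ : TangentBundle (𝓡 n) B)) h2
  · rintro v ⟨hv, hvc⟩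
    refine hM.eq_of_dqAt_eq hx hv (projH_mem M g q x w) ?_
    rw [h2]
    have h3 : (⟨q x, dqAt n M q x v⟩ : TangentBundle (𝓡 n) B) = ⟨q x, c⟩ := hvc
    exact eq_of_heq (Bundle.TotalSpace.mk.inj h3).2

theorem surjOn_dq (hM : IsSubmersedAmbient n m M g q gB) :
    SurjOn (dq n M q) (HM M g q) univ := by
  intro w _
  obtain ⟨x, hx, hxw⟩ := hM.onto (mem_univ w.proj)
  obtain ⟨v, ⟨hv, hvw⟩, -⟩ := hM.existsUnique_horLift hx w hxw.symm
  exact ⟨(x, v), ⟨hx, hv⟩, hvw⟩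

theorem fiber_dq_eq (hM : IsSubmersedAmbient n m M g q gB) (w : TangentBundle (𝓡 n) B) :
    {p | p ∈ HM M g q ∧ dq n M q p = w} =
      {p | p.1 ∈ M ∧ q p.1 = w.proj ∧ p.2 = horLift n M g q p.1 w} := by
  ext ⟨x, v⟩
  constructor
  · rintro ⟨⟨hx, hv⟩, hw⟩
    have hxw : w.proj = q x := by rw [← hw]; rfl
    have h1 := hM.existsUnique_horLift hx w hxw
    exact ⟨hx, hxw.symm, h1.unique ⟨hv, hw⟩ (Classical.epsilon_spec h1.exists)⟩
  · rintro ⟨hx, hxw, hv⟩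
    have h1 := hM.existsUnique_horLift hx w hxw.symm
    have h2 := Classical.epsilon_spec h1.exists
    change v = _ at hv
    rw [hv]
    exact ⟨⟨hx, h2.1⟩, h2.2⟩

/-- The system is triangular: a horizontal `w` settles the first coordinate, and adding a horizontal
`w'` in the fiber direction then corrects the second. A horizontal base component is kept for the
surjectivity on `QHM`. -/
theorem exists_fderiv_dqChart (hM : IsSubmersedAmbient n m M g q gB) {b : B} {U : Set E}
    {r : E → E} (h : IsAdapted n M q b U r) {p : E × E} (hp : p ∈ HM M g q) (hpU : p.1 ∈ U)
    (c : EuclideanSpace ℝ (Fin n) × EuclideanSpace ℝ (Fin n)) :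
    ∃ Δ ∈ THM M g q p, Δ.1 ∈ horSpace M g q p.1 ∧ fderiv ℝ (dqChart n q b r) p Δ = c := by
  obtain ⟨w, hw, hwc⟩ := hM.exists_hor_fderiv_chartMap h hp.1 hpU c.1
  obtain ⟨w', hw', hwc'⟩ := hM.exists_hor_fderiv_chartMap h hp.1 hpU
    (c.2 - fderiv ℝ (fderiv ℝ (chartMap n q b ∘ r)) p.1 w p.2 -
      fderiv ℝ (chartMap n q b ∘ r) p.1 (derivH M g q p.1 w p.2))
  refine ⟨(w, derivH M g q p.1 w p.2 + w'), (hM.mem_THM hp).2 ⟨hw.1, ?_⟩, hw, ?_⟩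
  · simp only [map_add, hM.projH_derivH hp hw.1, (hM.projH_eq_self hp.1).2 hw', zero_add]
  · rw [hM.fderiv_dqChart h hpU]
    refine Prod.ext hwc ?_
    simp only [map_add, hwc']
    abel

theorem exists_ddq_eq (hM : IsSubmersedAmbient n m M g q gB) {p : E × E} (hp : p ∈ HM M g q)
    (c : TangentSpace (𝓡 n).tangent (dq n M q p)) :
    ∃ Δ ∈ THM M g q p, Δ.1 ∈ horSpace M g q p.1 ∧ ddq n M g q p Δ = c := by
  obtain ⟨U, r, hpU, h⟩ := hM.exists_adapted hp.1
  obtain ⟨Δ, h1, h2, h3⟩ := hM.exists_fderiv_dqChart h hp hpU c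
  exact ⟨Δ, h1, h2, (hM.ddq_apply h hp hpU h1).trans h3⟩

/-- The argument for the fibers of `q`, now with the chart of the tangent bundle of `B` at `dq p`.
-/
theorem isSubmersiveLevelAt_dq (hM : IsSubmersedAmbient n m M g q gB) {p : E × E}
    (hp : p ∈ HM M g q) : ∃ f : E × E → EuclideanSpace ℝ (Fin n) × EuclideanSpace ℝ (Fin n),
      IsSubmersiveLevelAt (EuclideanSpace ℝ (Fin n) × EuclideanSpace ℝ (Fin n)) (HM M g q)
        {y | y ∈ HM M g q ∧ dq n M q y = dq n M q p} p f := by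
  obtain ⟨U, r, hpU, h⟩ := hM.exists_adapted hp.1
  have hr := isRetractionOn_totalSet h.1 hM.contDiffOn_projH (fun _ hy => hM.projH_projH hy)
  rw [← hM.HM_eq_totalSet] at hr
  refine ⟨dqChart n q (q p.1) r, _, _, hpU, hr, hM.contDiffOn_dqChart h, fun y hy hyU => ?_,
    fun c => ?_⟩
  · have h2 : dqChart n q (q p.1) r y = extChartAt (𝓡 n).tangent (dq n M q p) (dq n M q y) :=
      (hM.extChartAt_dq (w := dq n M q p) h hy hyU).symm
    have h3 : dqChart n q (q p.1) r p = extChartAt (𝓡 n).tangent (dq n M q p) (dq n M q p) :=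
      (hM.extChartAt_dq (w := dq n M q p) h hp hpU).symm
    rw [h2, h3]
    refine ⟨fun h1 => by rw [h1.2], fun h1 => ⟨hy, ?_⟩⟩
    refine (extChartAt (𝓡 n).tangent (dq n M q p)).injOn ?_ (mem_extChartAt_source _) h1
    rw [extChartAt_source]
    exact (TangentBundle.mem_chart_source_iff (dq n M q y) (dq n M q p)).2 (h.2 _ hy.1 hyU)
  · obtain ⟨Δ, h1, -, h3⟩ := hM.exists_fderiv_dqChart h hp hpU c
    exact ⟨Δ, h1, h3⟩

theorem finrank_THM (hM : IsSubmersedAmbient n m M g q gB) {p : E × E} (hp : p ∈ HM M g q) :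
    Module.finrank ℝ (THM M g q p) = m + n :=
  hM.isEmbSubmanifold_HM.finrank_tangentSpaceAt hp

theorem isEmbSubmanifold_fiber_dq (hM : IsSubmersedAmbient n m M g q gB)
    (w : TangentBundle (𝓡 n) B) :
    IsEmbSubmanifold (m - n) {p | p ∈ HM M g q ∧ dq n M q p = w} := by
  refine isEmbSubmanifold_of_levelSet
    (G := EuclideanSpace ℝ (Fin n) × EuclideanSpace ℝ (Fin n)) (S := HM M g q)
    (fun p hp => hp.1) ?_ ?_
  · rintro p ⟨hp, rfl⟩
    exact hM.isSubmersiveLevelAt_dq hp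
  · rintro p ⟨hp, -⟩
    -- The count `m + n = (m - n) + 2 n` needs `n ≤ m`, the subtraction being truncated.
    have h1 := hM.le_dim hp.1
    have h2 := hM.finrank_THM hp
    rw [THM] at h2
    rw [h2, Module.finrank_prod, finrank_euclideanSpace_fin]
    omega

/-! ### The operator `𝚀` and its image -/

theorem _root_.SubmersedAmbient.opQ_apply (M : Set E)
    (g : E → E →L[ℝ] E) (q : E → B) (p Δ : E × E) :
    opQ M g q p Δ = (projH M g q p.1 Δ.1,
      derivH M g q p.1 (projH M g q p.1 Δ.1) p.2 + projH M g q p.1 Δ.2) := rfl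

/-- `Δ` need not be tangent. So `𝚀` is a projection of all of `E × E`, which is what the
construction of a smooth frame of its image requires. -/
theorem opQ_mem (hM : IsSubmersedAmbient n m M g q gB) {p : E × E} (hp : p ∈ HM M g q)
    (Δ : E × E) : opQ M g q p Δ ∈ THM M g q p ∧ (opQ M g q p Δ).1 ∈ horSpace M g q p.1 := by
  have h1 := projH_mem M g q p.1 Δ.1
  refine ⟨(hM.mem_THM hp).2 ⟨h1.1, ?_⟩, h1⟩
  simp only [opQ_apply, map_add, hM.projH_derivH hp h1.1, hM.projH_projH hp.1, zero_add]

theorem opQ_eq_self (hM : IsSubmersedAmbient n m M g q gB) {p Δ : E × E} (hp : p ∈ HM M g q)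
    (hΔ : Δ ∈ THM M g q p) (hΔ' : Δ.1 ∈ horSpace M g q p.1) : opQ M g q p Δ = Δ := by
  rw [opQ_apply, (hM.projH_eq_self hp.1).2 hΔ', ((hM.mem_THM hp).1 hΔ).2]

theorem mem_QHM (hM : IsSubmersedAmbient n m M g q gB) {p Δ : E × E} (hp : p ∈ HM M g q) :
    Δ ∈ QHM M g q p ↔ Δ ∈ THM M g q p ∧ Δ.1 ∈ horSpace M g q p.1 := by
  constructor
  · rintro ⟨Δ', -, rfl⟩
    exact hM.opQ_mem hp Δ'
  · rintro ⟨h1, h2⟩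
    exact ⟨Δ, h1, hM.opQ_eq_self hp h1 h2⟩

theorem coe_QHM (hM : IsSubmersedAmbient n m M g q gB) {p : E × E} (hp : p ∈ HM M g q) :
    (QHM M g q p : Set (E × E)) = {δ | projH M g q p.1 δ.1 = δ.1 ∧
      derivH M g q p.1 δ.1 p.2 + projH M g q p.1 δ.2 = δ.2} := by
  ext Δ
  rw [SetLike.mem_coe, hM.mem_QHM hp, hM.mem_THM hp]
  constructor
  · rintro ⟨⟨-, h2⟩, h3⟩
    exact ⟨(hM.projH_eq_self hp.1).2 h3, h2⟩
  · rintro ⟨h1, h2⟩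
    have h3 := (hM.projH_eq_self hp.1).1 h1
    exact ⟨⟨h3.1, h2⟩, h3⟩

theorem contDiffOn_projH_fst (hM : IsSubmersedAmbient n m M g q gB) :
    ContDiffOn ℝ ∞ (fun p : E × E => projH M g q p.1) (HM M g q) :=
  hM.contDiffOn_projH.comp contDiff_fst.contDiffOn fun _ hp => hp.1

theorem contDiffOn_projV_fst (hM : IsSubmersedAmbient n m M g q gB) :
    ContDiffOn ℝ ∞ (fun p : E × E => projV M g q p.1) (HM M g q) :=
  hM.contDiffOn_projV.comp contDiff_fst.contDiffOn fun _ hp => hp.1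

theorem contDiffOn_derivH (hM : IsSubmersedAmbient n m M g q gB) {w : E × E → E}
    (hw : ContDiffOn ℝ ∞ w (HM M g q)) (hwt : ∀ p ∈ HM M g q, w p ∈ tangentSpaceAt M p.1) :
    ContDiffOn ℝ ∞ (fun p : E × E => derivH M g q p.1 (w p)) (HM M g q) :=
  hM.submanifold.isSmoothRetract.contDiffOn_fderivWithin hM.contDiffOn_projH
    contDiff_fst.contDiffOn hw (fun _ hp => hp.1) hwt

theorem contDiffOn_opQ (hM : IsSubmersedAmbient n m M g q gB) :
    ContDiffOn ℝ ∞ (opQ M g q) (HM M g q) := by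
  rw [contDiffOn_clm_apply]
  intro Δ
  have h1 := hM.contDiffOn_projH_fst.clm_apply (contDiffOn_const (c := Δ.1))
  refine h1.prodMk (ContDiffOn.add ?_ (hM.contDiffOn_projH_fst.clm_apply contDiffOn_const))
  exact (hM.contDiffOn_derivH h1 fun p _ => (projH_mem M g q p.1 Δ.1).1).clm_apply
    contDiff_snd.contDiffOn

theorem _root_.SubmersedAmbient.minSmoothness_le_infty : minSmoothness ℝ 2 ≤ ∞ := by
  rw [minSmoothness_of_isRCLikeNormedField]
  exact WithTop.coe_le_coe.2 (le_top : (2 : ℕ∞) ≤ ⊤)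

/-! ### Identities for the derivatives of the projections -/

theorem projT_projT (hM : IsSubmersedAmbient n m M g q gB) {x : E} (hx : x ∈ M) (u : E) :
    projT M g x (projT M g x u) = projT M g x u :=
  (hM.projT_eq_self hx).2 (opProj_mem _ _ _)

/-- On tangent vectors the derivative of the tangent projection is symmetric. -/
theorem fderivWithin_projT_symm (hM : IsSubmersedAmbient n m M g q gB) {x v w : E} (hx : x ∈ M)
    (hv : v ∈ tangentSpaceAt M x) (hw : w ∈ tangentSpaceAt M x) :
    fderivWithin ℝ (projT M g) M x v w = fderivWithin ℝ (projT M g) M x w v := by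
  obtain ⟨U, r, hxU, h⟩ := hM.submanifold.isSmoothRetract x hx
  have hr' : ContDiffAt ℝ ∞ (fderiv ℝ r) x :=
    (h.smooth.fderiv_of_isOpen h.isOpen (by simp)).contDiffAt (h.mem_nhds hxU)
  have hr : DifferentiableAt ℝ (fderiv ℝ r) x := hr'.differentiableAt (by simp)
  have hd := (hM.contDiffOn_projT x hx).differentiableWithinAt (by simp)
  have h1 : ∀ᶠ y in 𝓝[M] x, ∀ u, fderiv ℝ r y (projT M g y u) = projT M g y u := by
    filter_upwards [self_mem_nhdsWithin, mem_nhdsWithin_of_mem_nhds (h.mem_nhds hxU)]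
      with y hy hyU u
    exact (h.mem_tangentSpaceAt hy hyU).1 (opProj_mem _ _ _)
  -- The derivative of the identity `dr ∘ Π = Π` along `M`.
  have h2 : ∀ a ∈ tangentSpaceAt M x, ∀ b ∈ tangentSpaceAt M x,
      fderiv ℝ (fderiv ℝ r) x a b + fderiv ℝ r x (fderivWithin ℝ (projT M g) M x a b) =
        fderivWithin ℝ (projT M g) M x a b := by
    intro a ha b hb
    have h3 := fderivWithin_comp_of_eventuallyEq hx hr.differentiableWithinAt hd h1 ha b
    rwa [(hM.projT_eq_self hx).2 hb,
      fderivWithin_apply_of_eqOn Filter.univ_mem hx hr (fun _ _ _ => rfl) ha] at h3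
  have hsymm : fderiv ℝ (fderiv ℝ r) x v w = fderiv ℝ (fderiv ℝ r) x w v :=
    (h.contDiffAt hxU).isSymmSndFDerivAt minSmoothness_le_infty v w
  -- The symmetric second derivative of `r` cancels, so `dr` fixes the difference and the difference
  -- is tangent.
  have h4 : fderivWithin ℝ (projT M g) M x v w - fderivWithin ℝ (projT M g) M x w v ∈
      tangentSpaceAt M x := by
    rw [h.mem_tangentSpaceAt hx hxU, map_sub, eq_sub_of_add_eq' (h2 v hv w hw),
      eq_sub_of_add_eq' (h2 w hw v hv), hsymm, sub_sub_sub_cancel_right]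
  have h5 : ∀ a ∈ tangentSpaceAt M x, ∀ b ∈ tangentSpaceAt M x,
      projT M g x (fderivWithin ℝ (projT M g) M x a b) = 0 := fun a ha b hb =>
    proj_fderivWithin_apply hM.contDiffOn_projT (fun _ hy => hM.projT_projT hy) hx ha
      ((hM.projT_eq_self hx).2 hb)
  -- Being tangent, the difference equals its own image under `Π`; but `Π` kills both of its terms.
  rw [← sub_eq_zero, ← (hM.projT_eq_self hx).2 h4, map_sub, h5 v hv w hw, h5 w hw v hv, sub_self]

theorem fderivWithin_projT (hM : IsSubmersedAmbient n m M g q gB) {x w : E} (hx : x ∈ M)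
    (hw : w ∈ tangentSpaceAt M x) (u : E) :
    fderivWithin ℝ (projT M g) M x w u = derivH M g q x w u + derivV M g q x w u := by
  have h1 := ((hM.contDiffOn_projH x hx).differentiableWithinAt (by simp)).hasFDerivWithinAt.add
    ((hM.contDiffOn_projV x hx).differentiableWithinAt (by simp)).hasFDerivWithinAt
  have h2 := h1.congr (f₁ := projT M g) (fun y hy => by ext u; exact hM.projT_eq hy u)
    (by ext u; exact hM.projT_eq hx u)
  rw [HasFDerivWithinAt.fderivWithin_apply h2 hw]
  rfl

/-- Substitute `DΠ = D𝙷 + D𝚅` into the symmetry of `DΠ`. -/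
theorem opB_apply_eq (hM : IsSubmersedAmbient n m M g q gB) {p : E × E} (hp : p ∈ HM M g q) {ε : E}
    (hε : ε ∈ vertSpace M q p.1) :
    opB M g q p ε = derivV M g q p.1 p.2 ε - derivV M g q p.1 ε p.2 := by
  have h1 := vertSpace_le M q p.1 hε
  have h2 := hM.fderivWithin_projT_symm hp.1 h1 hp.2.1
  rw [hM.fderivWithin_projT hp.1 h1, hM.fderivWithin_projT hp.1 hp.2.1] at h2
  change derivH M g q p.1 ε p.2 - derivH M g q p.1 p.2 ε = _
  rw [sub_eq_sub_iff_add_eq_add, h2, add_comm]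

/-- Differentiate `𝙷 ∘ 𝙷 = 𝙷` and evaluate at `ε`, where `𝙷 ε = 0`: the derivative maps the kernel
of a projection into its image. The same argument serves `𝚅` below. -/
theorem derivH_mem_horSpace (hM : IsSubmersedAmbient n m M g q gB) {x w ε : E} (hx : x ∈ M)
    (hw : w ∈ tangentSpaceAt M x) (hε : ε ∈ vertSpace M q x) :
    derivH M g q x w ε ∈ horSpace M g q x := by
  have hd := (hM.contDiffOn_projH x hx).differentiableWithinAt (by simp)
  have h := fderivWithin_comp_of_eventuallyEq hx hd hd (Filter.eventually_of_mem
    self_mem_nhdsWithin fun _ hy => hM.projH_projH hy) hw ε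
  rw [hM.projH_apply_vert hx hε, map_zero, zero_add] at h
  exact (hM.projH_eq_self hx).1 h

theorem derivV_mem_vertSpace (hM : IsSubmersedAmbient n m M g q gB) {x w v : E} (hx : x ∈ M)
    (hw : w ∈ tangentSpaceAt M x) (hv : v ∈ horSpace M g q x) :
    derivV M g q x w v ∈ vertSpace M q x := by
  have hd := (hM.contDiffOn_projV x hx).differentiableWithinAt (by simp)
  have h := fderivWithin_comp_of_eventuallyEq hx hd hd (Filter.eventually_of_mem
    self_mem_nhdsWithin fun _ hy => hM.projV_projV hy) hw v
  rw [hM.projV_apply_hor hx hv, map_zero, zero_add] at h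
  exact (hM.projV_eq_self hx).1 h

/-! ### The vertical bundle of the differential -/

theorem mem_VHM (hM : IsSubmersedAmbient n m M g q gB) {U : Set E} {r : E → E} {p Δ : E × E}
    (h : IsAdapted n M q (q p.1) U r) (hp : p ∈ HM M g q) (hpU : p.1 ∈ U) :
    Δ ∈ VHM n M g q p ↔ Δ ∈ THM M g q p ∧ fderiv ℝ (chartMap n q (q p.1) ∘ r) p.1 Δ.1 = 0 ∧
      fderiv ℝ (fderiv ℝ (chartMap n q (q p.1) ∘ r)) p.1 Δ.1 p.2 +
        fderiv ℝ (chartMap n q (q p.1) ∘ r) p.1 Δ.2 = 0 := by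
  rw [VHM, Submodule.mem_inf]
  refine and_congr_right fun hΔ => ?_
  have h1 := (hM.ddq_apply h hp hpU hΔ).trans (hM.fderiv_dqChart h hpU Δ)
  change ddq n M g q p Δ = 0 ↔ _
  rw [h1]
  exact Prod.ext_iff

theorem fst_mem_vertSpace (hM : IsSubmersedAmbient n m M g q gB) {p Δ : E × E}
    (hp : p ∈ HM M g q) (hΔ : Δ ∈ VHM n M g q p) : Δ.1 ∈ vertSpace M q p.1 := by
  obtain ⟨U, r, hpU, h⟩ := hM.exists_adapted hp.1
  obtain ⟨h1, h2, -⟩ := (hM.mem_VHM h hp hpU).1 hΔ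
  exact (hM.mem_vertSpace h hp.1 hpU).2 ⟨((hM.mem_THM hp).1 h1).1, h2⟩

/-- Without a base component, tangency makes `Δ.2` horizontal, and the kernel condition makes it
vertical. -/
theorem eq_zero_of_mem_VHM (hM : IsSubmersedAmbient n m M g q gB) {p Δ : E × E}
    (hp : p ∈ HM M g q) (hΔ : Δ ∈ VHM n M g q p) (h0 : Δ.1 = 0) : Δ = 0 := by
  obtain ⟨U, r, hpU, h⟩ := hM.exists_adapted hp.1
  obtain ⟨h1, -, h3⟩ := (hM.mem_VHM h hp hpU).1 hΔ
  have h4 := ((hM.mem_THM hp).1 h1).2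
  simp only [h0, map_zero, zero_apply, zero_add] at h3 h4
  have h5 := (hM.projH_eq_self hp.1).1 h4
  exact Prod.ext h0 (hM.eq_zero_of_mem_hor_of_mem_vert hp.1 h5
    ((hM.mem_vertSpace h hp.1 hpU).2 ⟨h5.1, h3⟩))

/-- The central computation. Tangency is read off the expression of `B_v` by `𝙷`, the kernel
condition off the one by `𝚅`. -/
theorem bMap_mem_VHM (hM : IsSubmersedAmbient n m M g q gB) {p : E × E} (hp : p ∈ HM M g q)
    {ε : E} (hε : ε ∈ vertSpace M q p.1) : bMap M g q p ε ∈ VHM n M g q p := by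
  obtain ⟨U, r, hpU, h⟩ := hM.exists_adapted hp.1
  have hεT := vertSpace_le M q p.1 hε
  have hb : bMap M g q p ε = (ε, opB M g q p ε) := rfl
  have hB : opB M g q p ε = derivH M g q p.1 ε p.2 - derivH M g q p.1 p.2 ε := rfl
  rw [hM.mem_VHM h hp hpU, hM.mem_THM hp, hb]
  refine ⟨⟨hεT, ?_⟩, ((hM.mem_vertSpace h hp.1 hpU).1 hε).2, ?_⟩
  · change derivH M g q p.1 ε p.2 + projH M g q p.1 (opB M g q p ε) = opB M g q p ε
    rw [hB, map_sub, hM.projH_derivH hp hεT,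
      (hM.projH_eq_self hp.1).2 (hM.derivH_mem_horSpace hp.1 hp.2.1 hε)]
    abel
  · set L := fderiv ℝ (chartMap n q (q p.1) ∘ r) with hL
    have hLs : ContDiffAt ℝ ∞ L p.1 :=
      ((hM.contDiffOn_chartMap h).fderiv_of_isOpen h.1.isOpen (by simp)).contDiffAt
        (h.1.mem_nhds hpU)
    have hLd : DifferentiableAt ℝ L p.1 := hLs.differentiableAt (by simp)
    -- The differential of `q` kills vertical vectors at all nearby points of `M`. Differentiating
    -- this along `v` brings in the second derivative, which symmetry turns into the one required.
    have h1 : ∀ᶠ y in 𝓝[M] p.1, ∀ u, L y (projV M g q y u) =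
        (fun _ => (0 : E →L[ℝ] EuclideanSpace ℝ (Fin n))) y u := by
      filter_upwards [self_mem_nhdsWithin, mem_nhdsWithin_of_mem_nhds (h.1.mem_nhds hpU)]
        with y hy hyU u
      exact ((hM.mem_vertSpace h hy hyU).1 (projV_mem M g q y u)).2
    have h2 := fderivWithin_comp_of_eventuallyEq hp.1 hLd.differentiableWithinAt
      ((hM.contDiffOn_projV p.1 hp.1).differentiableWithinAt (by simp)) h1 hp.2.1 ε
    rw [(hM.projV_eq_self hp.1).2 hε,
      fderivWithin_apply_of_eqOn Filter.univ_mem hp.1 hLd (fun _ _ _ => rfl) hp.2.1] at h2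
    have hsymm : fderiv ℝ L p.1 ε p.2 = fderiv ℝ L p.1 p.2 ε :=
      (hM.contDiffAt_chartMap h hpU).isSymmSndFDerivAt minSmoothness_le_infty ε p.2
    have h3 : L p.1 (derivV M g q p.1 ε p.2) = 0 :=
      ((hM.mem_vertSpace h hp.1 hpU).1 (hM.derivV_mem_vertSpace hp.1 hεT hp.2)).2
    change fderiv ℝ L p.1 ε p.2 + L p.1 (opB M g q p ε) = 0
    rw [hsymm, hM.opB_apply_eq hp hε, map_sub, h3, sub_zero]
    simpa [derivV] using h2

theorem eq_bMap_of_mem_VHM (hM : IsSubmersedAmbient n m M g q gB) {p Δ : E × E}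
    (hp : p ∈ HM M g q) (hΔ : Δ ∈ VHM n M g q p) : Δ = bMap M g q p Δ.1 := by
  rw [← sub_eq_zero]
  refine hM.eq_zero_of_mem_VHM hp
    (sub_mem hΔ (hM.bMap_mem_VHM hp (hM.fst_mem_vertSpace hp hΔ))) ?_
  exact sub_self Δ.1

theorem VHM_eq_map (hM : IsSubmersedAmbient n m M g q gB) {p : E × E} (hp : p ∈ HM M g q) :
    VHM n M g q p = (vertSpace M q p.1).map (bMap M g q p).toLinearMap := by
  ext Δ
  constructor
  · intro hΔ
    exact ⟨Δ.1, hM.fst_mem_vertSpace hp hΔ, (hM.eq_bMap_of_mem_VHM hp hΔ).symm⟩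
  · rintro ⟨ε, hε, rfl⟩
    exact hM.bMap_mem_VHM hp hε

theorem _root_.SubmersedAmbient.bMap_injective (M : Set E) (g : E → E →L[ℝ] E) (q : E → B)
    (p : E × E) : Function.Injective (bMap M g q p) := fun _ _ h => (Prod.ext_iff.1 h).1

theorem bijOn_bMap (hM : IsSubmersedAmbient n m M g q gB) {p : E × E} (hp : p ∈ HM M g q) :
    BijOn (bMap M g q p) (vertSpace M q p.1) (VHM n M g q p) :=
  ⟨fun _ hε => hM.bMap_mem_VHM hp hε, (bMap_injective M g q p).injOn,
    fun Δ hΔ => ⟨Δ.1, hM.fst_mem_vertSpace hp hΔ, (hM.eq_bMap_of_mem_VHM hp hΔ).symm⟩⟩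

theorem finrank_VHM (hM : IsSubmersedAmbient n m M g q gB) {p : E × E} (hp : p ∈ HM M g q) :
    Module.finrank ℝ (VHM n M g q p) = m - n := by
  rw [hM.VHM_eq_map hp, ← hM.finrank_vertSpace hp.1]
  exact ((vertSpace M q p.1).equivMapOfInjective _ (bMap_injective M g q p)).finrank_eq.symm

theorem _root_.SubmersedAmbient.projVHM_apply (M : Set E) (g : E → E →L[ℝ] E) (q : E → B)
    (p Δ : E × E) : projVHM M g q p Δ = bMap M g q p (projV M g q p.1 Δ.1) := rfl

/-- `D𝙷` is smooth only when evaluated on smooth tangent fields, here `𝚅 Δm` and `v`. -/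
theorem contDiffOn_projVHM (hM : IsSubmersedAmbient n m M g q gB) :
    ContDiffOn ℝ ∞ (projVHM M g q) (HM M g q) := by
  rw [contDiffOn_clm_apply]
  intro Δ
  have h1 := hM.contDiffOn_projV_fst.clm_apply (contDiffOn_const (c := Δ.1))
  refine h1.prodMk (ContDiffOn.sub ?_ ?_)
  · exact (hM.contDiffOn_derivH h1 fun p _ =>
      vertSpace_le M q p.1 (projV_mem M g q p.1 Δ.1)).clm_apply contDiff_snd.contDiffOn
  · exact (hM.contDiffOn_derivH contDiff_snd.contDiffOn fun p hp => hp.2.1).clm_apply h1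

/-! ### The decomposition -/

theorem sub_projVHM_mem_QHM (hM : IsSubmersedAmbient n m M g q gB) {p Δ : E × E}
    (hp : p ∈ HM M g q) (hΔ : Δ ∈ THM M g q p) :
    (projH M g q p.1 Δ.1, Δ.2 - opB M g q p (projV M g q p.1 Δ.1)) ∈ QHM M g q p := by
  have h1 := hM.projH_add_projV hp.1 ((hM.mem_THM hp).1 hΔ).1
  have h2 : (projH M g q p.1 Δ.1, Δ.2 - opB M g q p (projV M g q p.1 Δ.1)) =
      Δ - bMap M g q p (projV M g q p.1 Δ.1) :=
    Prod.ext (eq_sub_of_add_eq h1) rfl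
  refine (hM.mem_QHM hp).2 ⟨?_, projH_mem M g q p.1 Δ.1⟩
  rw [h2]
  exact sub_mem hΔ (hM.bMap_mem_VHM hp (projV_mem M g q p.1 Δ.1)).1

theorem eq_add_projVHM (hM : IsSubmersedAmbient n m M g q gB) {p Δ : E × E}
    (hp : p ∈ HM M g q) (hΔ : Δ ∈ THM M g q p) :
    Δ = (projH M g q p.1 Δ.1, Δ.2 - opB M g q p (projV M g q p.1 Δ.1)) +
      (projV M g q p.1 Δ.1, opB M g q p (projV M g q p.1 Δ.1)) :=
  Prod.ext (hM.projH_add_projV hp.1 ((hM.mem_THM hp).1 hΔ).1).symm (sub_add_cancel _ _).symm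

theorem QHM_sup_VHM (hM : IsSubmersedAmbient n m M g q gB) {p : E × E} (hp : p ∈ HM M g q) :
    QHM M g q p ⊔ VHM n M g q p = THM M g q p := by
  refine le_antisymm (sup_le (fun _ hΔ => ((hM.mem_QHM hp).1 hΔ).1) inf_le_left) fun Δ hΔ => ?_
  rw [hM.eq_add_projVHM hp hΔ]
  exact Submodule.add_mem_sup (hM.sub_projVHM_mem_QHM hp hΔ)
    (hM.bMap_mem_VHM hp (projV_mem M g q p.1 Δ.1))

/-- The base component is horizontal and vertical, hence zero, and a vector of `VHM` is determined
by its base component. -/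
theorem QHM_inf_VHM (hM : IsSubmersedAmbient n m M g q gB) {p : E × E} (hp : p ∈ HM M g q) :
    QHM M g q p ⊓ VHM n M g q p = ⊥ := by
  rw [eq_bot_iff]
  rintro Δ ⟨h1, h2⟩
  exact hM.eq_zero_of_mem_VHM hp h2 (hM.eq_zero_of_mem_hor_of_mem_vert hp.1
    ((hM.mem_QHM hp).1 h1).2 (hM.fst_mem_vertSpace hp h2))

theorem finrank_QHM (hM : IsSubmersedAmbient n m M g q gB) {p : E × E} (hp : p ∈ HM M g q) :
    Module.finrank ℝ (QHM M g q p) = 2 * n := by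
  have h1 := Submodule.finrank_sup_add_finrank_inf_eq (QHM M g q p) (VHM n M g q p)
  rw [hM.QHM_sup_VHM hp, hM.QHM_inf_VHM hp, finrank_bot, hM.finrank_THM hp,
    hM.finrank_VHM hp] at h1
  have := hM.le_dim hp.1
  omega

theorem isSmoothSubbundle_QHM (hM : IsSubmersedAmbient n m M g q gB) :
    IsSmoothSubbundle (2 * n) (HM M g q) (QHM M g q) :=
  isSmoothSubbundle_of_projections hM.contDiffOn_opQ
    (fun _ hp Δ => (hM.mem_QHM hp).2 (hM.opQ_mem hp Δ))
    (fun _ hp _ hΔ => hM.opQ_eq_self hp ((hM.mem_QHM hp).1 hΔ).1 ((hM.mem_QHM hp).1 hΔ).2)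
    (fun _ hp => hM.finrank_QHM hp)

theorem isSmoothSubbundle_VHM (hM : IsSubmersedAmbient n m M g q gB) :
    IsSmoothSubbundle (m - n) (HM M g q) (VHM n M g q) :=
  isSmoothSubbundle_of_projections hM.contDiffOn_projVHM
    (fun p hp Δ => hM.bMap_mem_VHM hp (projV_mem M g q p.1 Δ.1))
    (fun _ hp _ hΔ => by
      rw [projVHM_apply, (hM.projV_eq_self hp.1).2 (hM.fst_mem_vertSpace hp hΔ)]
      exact (hM.eq_bMap_of_mem_VHM hp hΔ).symm)
    (fun _ hp => hM.finrank_VHM hp)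

/-- Injective because `QHM` meets the kernel in zero; surjective because preimages can be chosen
with horizontal base component. -/
theorem bijOn_ddq (hM : IsSubmersedAmbient n m M g q gB) {p : E × E} (hp : p ∈ HM M g q) :
    BijOn (ddq n M g q p) (QHM M g q p) univ := by
  refine ⟨mapsTo_univ _ _, fun Δ hΔ Δ' hΔ' h => ?_, fun c _ => ?_⟩
  · have h1 : Δ - Δ' ∈ QHM M g q p := sub_mem hΔ hΔ'
    have h2 : Δ - Δ' ∈ QHM M g q p ⊓ VHM n M g q p := by
      refine ⟨h1, ((hM.mem_QHM hp).1 h1).1, ?_⟩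
      change ddq n M g q p (Δ - Δ') = 0
      rw [map_sub, h, sub_self]
    rw [hM.QHM_inf_VHM hp] at h2
    exact sub_eq_zero.1 h2
  · obtain ⟨Δ, h1, h2, h3⟩ := hM.exists_ddq_eq hp c
    exact ⟨Δ, (hM.mem_QHM hp).2 ⟨h1, h2⟩, h3⟩

/-- Christoffel functions are symmetric on tangent vectors. -/
theorem christoffel_symm (hM : IsSubmersedAmbient n m M g q gB) {Γ : E → E →L[ℝ] E →L[ℝ] E}
    (hΓ : IsChristoffel M g Γ) {x v w : E} (hx : x ∈ M) (hv : v ∈ tangentSpaceAt M x)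
    (hw : w ∈ tangentSpaceAt M x) : Γ x v w = Γ x w v := by
  have hX : ∀ u, IsVectorField M (fun y => projT M g y u) := fun u =>
    ⟨hM.contDiffOn_projT.clm_apply contDiffOn_const, fun y _ => opProj_mem _ _ _⟩
  -- Projecting constant vectors gives tangent fields with the prescribed values at `x`. The
  -- derivative terms on the two sides cancel and leave only `Γ`.
  have h := hΓ.2.torsion_free _ _ (hX v) (hX w) x hx
  simp only [(hM.projT_eq_self hx).2 hv, (hM.projT_eq_self hx).2 hw] at h
  rw [add_sub_add_comm, add_eq_left] at h
  exact sub_eq_zero.1 h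

theorem opB_apply_eq_christoffelH (hM : IsSubmersedAmbient n m M g q gB)
    {Γ : E → E →L[ℝ] E →L[ℝ] E} (hΓ : IsChristoffel M g Γ) {p : E × E} (hp : p ∈ HM M g q) {ε : E}
    (hε : ε ∈ vertSpace M q p.1) :
    opB M g q p ε = christoffelH M g q Γ p.1 p.2 ε - christoffelH M g q Γ p.1 ε p.2 := by
  change derivH M g q p.1 ε p.2 - derivH M g q p.1 p.2 ε = _
  rw [christoffelH, christoffelH,
    hM.christoffel_symm hΓ hp.1 hp.2.1 (vertSpace_le M q p.1 hε)]
  abel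

end IsSubmersedAmbient

end Decomposition

/-! ### Invariance under isometries over the base -/

section Isometry

set_option linter.unusedSectionVars false

variable {E : Type*} [NormedAddCommGroup E] [InnerProductSpace ℝ E] [FiniteDimensional ℝ E]
  {E₂ : Type*} [NormedAddCommGroup E₂] [InnerProductSpace ℝ E₂] [FiniteDimensional ℝ E₂]
  {m n : ℕ} {B : Type*} [TopologicalSpace B] [ChartedSpace (EuclideanSpace ℝ (Fin n)) B]
  [IsManifold (𝓡 n) ∞ B] {M : Set E} {g : E → E →L[ℝ] E} {q : E → B}
  {M₂ : Set E₂} {g₂ : E₂ → E₂ →L[ℝ] E₂} {q₂ : E₂ → B} {φ : E → E₂}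
  {gB : Bundle.ContMDiffRiemannianMetric (𝓡 n) ∞ (EuclideanSpace ℝ (Fin n))
      (fun b : B => TangentSpace (𝓡 n) b)}

theorem fderivWithin_leftInverse {F G : Type*} [NormedAddCommGroup F] [NormedSpace ℝ F]
    [NormedAddCommGroup G] [NormedSpace ℝ G] {S : Set F} {S' : Set G} {f : F → G} {f' : G → F}
    (hf : ContDiffOn ℝ ∞ f S) (hf' : ContDiffOn ℝ ∞ f' S') (hm : MapsTo f S S')
    (hinv : ∀ x ∈ S, f' (f x) = x) {p w : F} (hp : p ∈ S) (hw : w ∈ tangentSpaceAt S p) :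
    fderivWithin ℝ f' S' (f p) (fderivWithin ℝ f S p w) = w := by
  rw [← fderivWithin_comp_apply_of_mem hf hf' hm hp hw]
  exact HasFDerivWithinAt.fderivWithin_apply
    ((hasFDerivWithinAt_id p S).congr hinv (hinv p hp)) hw

/-- All tangent spaces of `B` are definitionally the model space, so one vector `u` makes sense over
both base points. -/
theorem tangentBundle_mk_congr {b b' : B} (h : b = b') (u : EuclideanSpace ℝ (Fin n)) :
    (⟨b, u⟩ : TangentBundle (𝓡 n) B) = ⟨b', u⟩ := by
  rw [h]

namespace IsSubmersionIsometry

/-- The hypotheses are symmetric in the two structures, so each inclusion proved for `φ` also holds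
for its inverse. -/
theorem exists_inverse (hφ : IsSubmersionIsometry M g q M₂ g₂ q₂ φ) :
    ∃ ψ : E₂ → E, IsSubmersionIsometry M₂ g₂ q₂ M g q ψ ∧
      (∀ x ∈ M, ψ (φ x) = x) ∧ ∀ y ∈ M₂, φ (ψ y) = y := by
  obtain ⟨ψ, hψ, hψφ⟩ := hφ.smooth_inverse
  have hm : MapsTo ψ M₂ M := fun y hy => by
    obtain ⟨x, hx, rfl⟩ := hφ.bijOn.surjOn hy
    rwa [hψφ x hx]
  have hφψ : ∀ y ∈ M₂, φ (ψ y) = y := fun y hy => by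
    obtain ⟨x, hx, rfl⟩ := hφ.bijOn.surjOn hy
    rw [hψφ x hx]
  refine ⟨ψ, ⟨hψ, ?_, ⟨φ, hφ.smooth, hφψ⟩, ?_, ?_⟩, hψφ, hφψ⟩
  · exact InvOn.bijOn ⟨hφψ, hψφ⟩ hm hφ.bijOn.mapsTo
  · intro y hy ξ hξ η hη
    have h1 := hφ.metric (ψ y) (hm hy) _ (fderivWithin_mem_tangentSpaceAt hψ hm hy hξ) _
      (fderivWithin_mem_tangentSpaceAt hψ hm hy hη)
    rw [fderivWithin_leftInverse hψ hφ.smooth hm hφψ hy hξ,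
      fderivWithin_leftInverse hψ hφ.smooth hm hφψ hy hη, hφψ y hy] at h1
    exact h1.symm
  · intro y hy
    rw [← hφ.comp _ (hm hy), hφψ y hy]

theorem map_tangent (hφ : IsSubmersionIsometry M g q M₂ g₂ q₂ φ) {x ξ : E} (hx : x ∈ M)
    (hξ : ξ ∈ tangentSpaceAt M x) : fderivWithin ℝ φ M x ξ ∈ tangentSpaceAt M₂ (φ x) :=
  fderivWithin_mem_tangentSpaceAt hφ.smooth hφ.bijOn.mapsTo hx hξ

theorem map_vertSpace (hφ : IsSubmersionIsometry M g q M₂ g₂ q₂ φ) {x ε : E} (hx : x ∈ M)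
    (hε : ε ∈ vertSpace M q x) : fderivWithin ℝ φ M x ε ∈ vertSpace M₂ q₂ (φ x) := by
  have hsub : {y | y ∈ M ∧ q y = q x} ⊆ M := fun _ hy => hy.1
  have hm : MapsTo φ {y | y ∈ M ∧ q y = q x} {y | y ∈ M₂ ∧ q₂ y = q₂ (φ x)} := fun y hy =>
    ⟨hφ.bijOn.mapsTo hy.1, by rw [hφ.comp y hy.1, hφ.comp x hx, hy.2]⟩
  have h1 := fderivWithin_mem_tangentSpaceAt (hφ.smooth.mono hsub) hm ⟨hx, rfl⟩ hε
  -- The derivative within `M` is also one within the fiber, so the two agree on vertical vectors.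
  rwa [HasFDerivWithinAt.fderivWithin_apply
    (((hφ.smooth x hx).differentiableWithinAt (by simp)).hasFDerivWithinAt.mono hsub) hε] at h1

/-- Every vertical vector of `M₂` is the image of a vertical vector of `M`, by the inverse isometry,
and inner products are preserved. -/
theorem map_horSpace (hφ : IsSubmersionIsometry M g q M₂ g₂ q₂ φ) {x v : E} (hx : x ∈ M)
    (hv : v ∈ horSpace M g q x) : fderivWithin ℝ φ M x v ∈ horSpace M₂ g₂ q₂ (φ x) := by
  obtain ⟨ψ, hψ, hψφ, hφψ⟩ := hφ.exists_inverse
  refine ⟨hφ.map_tangent hx hv.1, fun ε hε => ?_⟩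
  have hy := hφ.bijOn.mapsTo hx
  have h1 := hψ.map_vertSpace hy hε
  have h2 := fderivWithin_leftInverse hψ.smooth hφ.smooth hψ.bijOn.mapsTo hφψ hy
    (vertSpace_le M₂ q₂ _ hε)
  rw [hψφ x hx] at h1 h2
  rw [← h2, hφ.metric x hx _ hv.1 _ (vertSpace_le M q x h1)]
  exact hv.2 _ h1

theorem mapsTo_tangentMapSet (hφ : IsSubmersionIsometry M g q M₂ g₂ q₂ φ) :
    MapsTo (tangentMapSet M φ) (HM M g q) (HM M₂ g₂ q₂) := fun _ hp =>
  ⟨hφ.bijOn.mapsTo hp.1, hφ.map_horSpace hp.1 hp.2⟩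

theorem tangentMapSet_leftInverse (hφ : IsSubmersionIsometry M g q M₂ g₂ q₂ φ) {ψ : E₂ → E}
    (hψ : IsSubmersionIsometry M₂ g₂ q₂ M g q ψ) (h : ∀ x ∈ M, ψ (φ x) = x) :
    ∀ p ∈ HM M g q, tangentMapSet M₂ ψ (tangentMapSet M φ p) = p := fun p hp =>
  Prod.ext (h p.1 hp.1)
    (fderivWithin_leftInverse hφ.smooth hψ.smooth hφ.bijOn.mapsTo h hp.1 hp.2.1)

theorem bijOn_tangentMapSet (hφ : IsSubmersionIsometry M g q M₂ g₂ q₂ φ) :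
    BijOn (tangentMapSet M φ) (HM M g q) (HM M₂ g₂ q₂) := by
  obtain ⟨ψ, hψ, hψφ, hφψ⟩ := hφ.exists_inverse
  exact InvOn.bijOn (f' := tangentMapSet M₂ ψ)
    ⟨hφ.tangentMapSet_leftInverse hψ hψφ, hψ.tangentMapSet_leftInverse hφ hφψ⟩
    hφ.mapsTo_tangentMapSet hψ.mapsTo_tangentMapSet

theorem contDiffOn_tangentMapSet (hφ : IsSubmersionIsometry M g q M₂ g₂ q₂ φ)
    (hM : IsSubmersedAmbient n m M g q gB) :
    ContDiffOn ℝ ∞ (tangentMapSet M φ) (HM M g q) := by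
  refine (hφ.smooth.comp contDiff_fst.contDiffOn fun _ hp => hp.1).prodMk ?_
  exact hM.submanifold.isSmoothRetract.contDiffOn_fderivWithin hφ.smooth contDiff_fst.contDiffOn
    contDiff_snd.contDiffOn (fun _ hp => hp.1) fun _ hp => hp.2.1

theorem map_THM (hφ : IsSubmersionIsometry M g q M₂ g₂ q₂ φ)
    (hM : IsSubmersedAmbient n m M g q gB) {p Δ : E × E} (hp : p ∈ HM M g q)
    (hΔ : Δ ∈ THM M g q p) : fderivWithin ℝ (tangentMapSet M φ) (HM M g q) p Δ ∈
      THM M₂ g₂ q₂ (tangentMapSet M φ p) :=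
  fderivWithin_mem_tangentSpaceAt (hφ.contDiffOn_tangentMapSet hM) hφ.mapsTo_tangentMapSet hp hΔ

theorem fst_fderivWithin (hφ : IsSubmersionIsometry M g q M₂ g₂ q₂ φ)
    (hM : IsSubmersedAmbient n m M g q gB) {p Δ : E × E} (hp : p ∈ HM M g q)
    (hΔ : Δ ∈ THM M g q p) : (fderivWithin ℝ (tangentMapSet M φ) (HM M g q) p Δ).1 =
      fderivWithin ℝ φ M p.1 Δ.1 := by
  have h1 := ((hφ.contDiffOn_tangentMapSet hM p hp).differentiableWithinAt
    (by simp)).hasFDerivWithinAt.fst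
  have h2 := (((hφ.smooth p.1 hp.1).differentiableWithinAt (by simp)).hasFDerivWithinAt).comp p
    (hasFDerivWithinAt_fst (s := HM M g q)) fun _ hy => hy.1
  exact HasFDerivWithinAt.eq_on_tangent h1 h2 hΔ

/-- The chain rule for `q₂ ∘ φ = q`, taken along a curve with velocity `v`: derivatives along a
curve are unique, those within `M` are not. -/
theorem dq_tangentMapSet (hφ : IsSubmersionIsometry M g q M₂ g₂ q₂ φ)
    (hM : IsSubmersedAmbient n m M g q gB) (hM₂ : IsSubmersedAmbient n m M₂ g₂ q₂ gB)
    {p : E × E} (hp : p ∈ HM M g q) : dq n M₂ q₂ (tangentMapSet M φ p) = dq n M q p := by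
  obtain ⟨U, r, hxU, hr⟩ := hM.submanifold.isSmoothRetract p.1 hp.1
  have hx₂ := hφ.bijOn.mapsTo hp.1
  obtain ⟨c, N, hN, -, hm, h0, hc⟩ := hr.isVelocity hp.1 hxU hp.2.1
  have hcM : ∀ᶠ t in 𝓝 (0 : ℝ), c t ∈ M := by filter_upwards [hN] with t ht using hm ht
  obtain ⟨x, v⟩ := p
  change c 0 = x at h0
  subst h0
  have hc₂ : HasDerivAt (φ ∘ c) (fderivWithin ℝ φ M (c 0) v) 0 :=
    hasDerivAt_comp_curve ((hφ.smooth _ hp.1).differentiableWithinAt (by simp)) hc hcM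
  have h1 := hasMFDerivAt_comp_curve
    ((hM.smooth_q _ hp.1).mdifferentiableWithinAt (by simp)) hc hcM
  have h2 := hasMFDerivAt_comp_curve (c := φ ∘ c)
    ((hM₂.smooth_q _ hx₂).mdifferentiableWithinAt (by simp)) hc₂
    (by filter_upwards [hcM] with t ht using hφ.bijOn.mapsTo ht)
  have h3 : q₂ ∘ φ ∘ c =ᶠ[𝓝 0] q ∘ c := by
    filter_upwards [hcM] with t ht using hφ.comp _ ht
  -- The derivative of a curve is a linear map on `ℝ`; evaluation at `1` returns its velocity, up to
  -- the factor `1`.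
  have h4 : dqAt n M₂ q₂ (φ (c 0)) ((1 : ℝ) • fderivWithin ℝ φ M (c 0) v) =
      dqAt n M q (c 0) ((1 : ℝ) • v) :=
    DFunLike.congr_fun (hasMFDerivAt_unique h2 (h1.congr_of_eventuallyEq h3)) (1 : ℝ)
  rw [one_smul, one_smul] at h4
  exact (congrArg (fun u => (⟨q₂ (φ (c 0)), u⟩ : TangentBundle (𝓡 n) B)) h4).trans
    (tangentBundle_mk_congr (hφ.comp _ hp.1) (dqAt n M q (c 0) v))

/-- The same argument one level higher, with `dq` in place of `q` and a curve in `HM`. -/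
theorem map_VHM (hφ : IsSubmersionIsometry M g q M₂ g₂ q₂ φ)
    (hM : IsSubmersedAmbient n m M g q gB) (hM₂ : IsSubmersedAmbient n m M₂ g₂ q₂ gB)
    {p Δ : E × E} (hp : p ∈ HM M g q) (hΔ : Δ ∈ VHM n M g q p) :
    fderivWithin ℝ (tangentMapSet M φ) (HM M g q) p Δ ∈
      VHM n M₂ g₂ q₂ (tangentMapSet M φ p) := by
  refine ⟨hφ.map_THM hM hp hΔ.1, ?_⟩
  obtain ⟨U, r, hpU, hr⟩ := hM.isEmbSubmanifold_HM.isSmoothRetract p hp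
  obtain ⟨c, N, hN, -, hm, h0, hc⟩ := hr.isVelocity hp hpU hΔ.1
  subst h0
  have hp₂ := hφ.mapsTo_tangentMapSet hp
  have hcS : ∀ᶠ t in 𝓝 (0 : ℝ), c t ∈ HM M g q := by filter_upwards [hN] with t ht using hm ht
  have hc₂ : HasDerivAt (tangentMapSet M φ ∘ c)
      (fderivWithin ℝ (tangentMapSet M φ) (HM M g q) (c 0) Δ) 0 :=
    hasDerivAt_comp_curve ((hφ.contDiffOn_tangentMapSet hM _ hp).differentiableWithinAt
      (by simp)) hc hcS
  have h1 := hasMFDerivAt_comp_curve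
    ((hM.contMDiffOn_dq _ hp).mdifferentiableWithinAt (by simp)) hc hcS
  have h2 := hasMFDerivAt_comp_curve (c := tangentMapSet M φ ∘ c)
    ((hM₂.contMDiffOn_dq _ hp₂).mdifferentiableWithinAt (by simp)) hc₂
    (by filter_upwards [hcS] with t ht using hφ.mapsTo_tangentMapSet ht)
  have h3 : dq n M₂ q₂ ∘ tangentMapSet M φ ∘ c =ᶠ[𝓝 0] dq n M q ∘ c := by
    filter_upwards [hcS] with t ht
    exact hφ.dq_tangentMapSet hM hM₂ ht
  have h4 : ddq n M₂ g₂ q₂ (tangentMapSet M φ (c 0))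
      ((1 : ℝ) • fderivWithin ℝ (tangentMapSet M φ) (HM M g q) (c 0) Δ) =
      ddq n M g q (c 0) ((1 : ℝ) • Δ) :=
    DFunLike.congr_fun (hasMFDerivAt_unique h2 (h1.congr_of_eventuallyEq h3)) (1 : ℝ)
  rw [one_smul, one_smul] at h4
  have h5 : ddq n M g q (c 0) Δ = 0 := hΔ.2
  exact h4.trans h5

/-- The image lies in the vertical bundle of the second structure, where a vector is `b` of its base
component. -/
theorem fderivWithin_bMap (hφ : IsSubmersionIsometry M g q M₂ g₂ q₂ φ)
    (hM : IsSubmersedAmbient n m M g q gB) (hM₂ : IsSubmersedAmbient n m M₂ g₂ q₂ gB)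
    {p : E × E} (hp : p ∈ HM M g q) {ε : E} (hε : ε ∈ vertSpace M q p.1) :
    fderivWithin ℝ (tangentMapSet M φ) (HM M g q) p (bMap M g q p ε) =
      bMap M₂ g₂ q₂ (tangentMapSet M φ p) (fderivWithin ℝ φ M p.1 ε) := by
  have h1 := hM.bMap_mem_VHM hp hε
  rw [hM₂.eq_bMap_of_mem_VHM (hφ.mapsTo_tangentMapSet hp) (hφ.map_VHM hM hM₂ hp h1),
    hφ.fst_fderivWithin hM hp h1.1]
  rfl

theorem fderivWithin_mem_QHM (hφ : IsSubmersionIsometry M g q M₂ g₂ q₂ φ)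
    (hM : IsSubmersedAmbient n m M g q gB) (hM₂ : IsSubmersedAmbient n m M₂ g₂ q₂ gB)
    {p Δ : E × E} (hp : p ∈ HM M g q) (hΔ : Δ ∈ QHM M g q p) :
    fderivWithin ℝ (tangentMapSet M φ) (HM M g q) p Δ ∈
      QHM M₂ g₂ q₂ (tangentMapSet M φ p) := by
  obtain ⟨h1, h2⟩ := (hM.mem_QHM hp).1 hΔ
  refine (hM₂.mem_QHM (hφ.mapsTo_tangentMapSet hp)).2 ⟨hφ.map_THM hM hp h1, ?_⟩
  rw [hφ.fst_fderivWithin hM hp h1]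
  exact hφ.map_horSpace hp.1 h2

/-- The inverse isometry provides the preimages needed for the reverse inclusion. -/
theorem map_QHM (hφ : IsSubmersionIsometry M g q M₂ g₂ q₂ φ)
    (hM : IsSubmersedAmbient n m M g q gB) (hM₂ : IsSubmersedAmbient n m M₂ g₂ q₂ gB)
    {p : E × E} (hp : p ∈ HM M g q) :
    (QHM M g q p).map (fderivWithin ℝ (tangentMapSet M φ) (HM M g q) p).toLinearMap =
      QHM M₂ g₂ q₂ (tangentMapSet M φ p) := by
  refine le_antisymm ?_ fun Δ hΔ => ?_
  · rintro _ ⟨Δ, hΔ, rfl⟩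
    exact hφ.fderivWithin_mem_QHM hM hM₂ hp hΔ
  · obtain ⟨ψ, hψ, hψφ, hφψ⟩ := hφ.exists_inverse
    have hp₂ := hφ.mapsTo_tangentMapSet hp
    have h1 := hψ.fderivWithin_mem_QHM hM₂ hM hp₂ hΔ
    have h2 := fderivWithin_leftInverse (hψ.contDiffOn_tangentMapSet hM₂)
      (hφ.contDiffOn_tangentMapSet hM) hψ.mapsTo_tangentMapSet
      (hψ.tangentMapSet_leftInverse hφ hφψ) hp₂ ((hM₂.mem_QHM hp₂).1 hΔ).1
    rw [hφ.tangentMapSet_leftInverse hψ hψφ p hp] at h1 h2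
    exact ⟨_, h1, h2⟩

theorem projV_fderivWithin (hφ : IsSubmersionIsometry M g q M₂ g₂ q₂ φ)
    (hM : IsSubmersedAmbient n m M g q gB) (hM₂ : IsSubmersedAmbient n m M₂ g₂ q₂ gB)
    {x ξ : E} (hx : x ∈ M) (hξ : ξ ∈ tangentSpaceAt M x) :
    projV M₂ g₂ q₂ (φ x) (fderivWithin ℝ φ M x ξ) = fderivWithin ℝ φ M x (projV M g q x ξ) := by
  have hy := hφ.bijOn.mapsTo hx
  conv_lhs => rw [← hM.projH_add_projV hx hξ]
  rw [map_add, map_add, hM₂.projV_apply_hor hy (hφ.map_horSpace hx (projH_mem M g q x ξ)),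
    (hM₂.projV_eq_self hy).2 (hφ.map_vertSpace hx (projV_mem M g q x ξ)), zero_add]

theorem fderivWithin_projVHM (hφ : IsSubmersionIsometry M g q M₂ g₂ q₂ φ)
    (hM : IsSubmersedAmbient n m M g q gB) (hM₂ : IsSubmersedAmbient n m M₂ g₂ q₂ gB)
    {p Δ : E × E} (hp : p ∈ HM M g q) (hΔ : Δ ∈ THM M g q p) :
    fderivWithin ℝ (tangentMapSet M φ) (HM M g q) p (projVHM M g q p Δ) =
      projVHM M₂ g₂ q₂ (tangentMapSet M φ p)
        (fderivWithin ℝ (tangentMapSet M φ) (HM M g q) p Δ) := by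
  rw [projVHM_apply, projVHM_apply, hφ.fderivWithin_bMap hM hM₂ hp (projV_mem M g q p.1 Δ.1),
    hφ.fst_fderivWithin hM hp hΔ]
  exact congrArg _ (hφ.projV_fderivWithin hM hM₂ hp.1 ((hM.mem_THM hp).1 hΔ).1).symm

end IsSubmersionIsometry

end Isometry

end SubmersedAmbient

/-! ### The main theorem -/

open SubmersedAmbient in
theorem mainTheorem7
    {E : Type*} [NormedAddCommGroup E] [InnerProductSpace ℝ E] [FiniteDimensional ℝ E]
    {m n : ℕ} {B : Type*} [TopologicalSpace B] [ChartedSpace (EuclideanSpace ℝ (Fin n)) B]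
    [IsManifold (𝓡 n) ∞ B] [T2Space B] [SigmaCompactSpace B]
    (M : Set E) (g : E → E →L[ℝ] E) (q : E → B)
    (gB : Bundle.ContMDiffRiemannianMetric (𝓡 n) ∞ (EuclideanSpace ℝ (Fin n))
      (fun b : B => TangentSpace (𝓡 n) b))
    (hM : IsSubmersedAmbient n m M g q gB) :
    -- the projections are smooth on the manifold, so that their derivatives make sense
    (ContDiffOn ℝ ∞ (projT M g) M ∧ ContDiffOn ℝ ∞ (projH M g q) M ∧
      ContDiffOn ℝ ∞ (projV M g q) M) ∧
    -- the horizontal bundle is a submanifold of E², cut out by the horizontal projection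
    (IsEmbSubmanifold (m + n) (HM M g q) ∧
      HM M g q = {p | p.1 ∈ M ∧ projH M g q p.1 p.2 = p.2}) ∧
    -- dq restricted to the horizontal bundle is a differentiable submersion onto TB
    (ContMDiffOn 𝓘(ℝ, E × E) (𝓡 n).tangent ∞ (dq n M q) (HM M g q) ∧
      SurjOn (dq n M q) (HM M g q) univ ∧
      ∀ p ∈ HM M g q, SurjOn (ddq n M g q p) (THM M g q p) univ) ∧
    -- its fibers are the submanifolds of horizontal lifts
    ((∀ x ∈ M, ∀ w : TangentBundle (𝓡 n) B, w.proj = q x →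
        ∃! v, v ∈ horSpace M g q x ∧ dq n M q (x, v) = w) ∧
      ∀ w : TangentBundle (𝓡 n) B,
        IsEmbSubmanifold (m - n) {p | p ∈ HM M g q ∧ dq n M q p = w} ∧
        {p | p ∈ HM M g q ∧ dq n M q p = w} =
          {p | p.1 ∈ M ∧ q p.1 = w.proj ∧ p.2 = horLift n M g q p.1 w}) ∧
    -- the tangent bundle of the horizontal bundle is a submanifold of E⁴, cut out by projections
    (IsEmbSubmanifold (2 * (m + n)) (tangentBundleSet (HM M g q)) ∧
      tangentBundleSet (HM M g q) =
        {z : (E × E) × (E × E) | z.1.1 ∈ M ∧ projH M g q z.1.1 z.1.2 = z.1.2 ∧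
          projT M g z.1.1 z.2.1 = z.2.1 ∧
          derivH M g q z.1.1 z.2.1 z.1.2 + projH M g q z.1.1 z.2.2 = z.2.2}) ∧
    -- Q is an idempotent bundle map of this tangent bundle, and its image is a subbundle
    (ContDiffOn ℝ ∞ (opQ M g q) (HM M g q) ∧
      (∀ p ∈ HM M g q, ∀ Δ ∈ THM M g q p,
        opQ M g q p Δ ∈ THM M g q p ∧ opQ M g q p (opQ M g q p Δ) = opQ M g q p Δ) ∧
      IsSmoothSubbundle (2 * n) (HM M g q) (QHM M g q) ∧
      ∀ p ∈ HM M g q, QHM M g q p ≤ THM M g q p ∧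
        (QHM M g q p : Set (E × E)) =
          {δ | projH M g q p.1 δ.1 = δ.1 ∧
            derivH M g q p.1 δ.1 p.2 + projH M g q p.1 δ.2 = δ.2}) ∧
    -- the vertical bundle of dq on the horizontal bundle is a subbundle, and b maps onto it
    (IsSmoothSubbundle (m - n) (HM M g q) (VHM n M g q) ∧
      ∀ p ∈ HM M g q,
        (∀ ε ∈ vertSpace M q p.1, (∃! εt : E, (ε, εt) ∈ VHM n M g q p) ∧
          ∀ εt : E, (ε, εt) ∈ VHM n M g q p →
            εt = derivH M g q p.1 ε p.2 - derivH M g q p.1 p.2 ε ∧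
            εt = derivV M g q p.1 p.2 ε - derivV M g q p.1 ε p.2 ∧
            ∀ Γ, IsChristoffel M g Γ →
              εt = christoffelH M g q Γ p.1 p.2 ε - christoffelH M g q Γ p.1 ε p.2) ∧
        (∀ ε ∈ vertSpace M q p.1, derivH M g q p.1 p.2 ε ∈ horSpace M g q p.1 ∧
          derivV M g q p.1 ε p.2 ∈ vertSpace M q p.1) ∧
        BijOn (bMap M g q p) (vertSpace M q p.1) (VHM n M g q p)) ∧
    -- the differentiable bundle decomposition
    (ContDiffOn ℝ ∞ (projVHM M g q) (HM M g q) ∧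
      ∀ p ∈ HM M g q,
        QHM M g q p ⊔ VHM n M g q p = THM M g q p ∧
        QHM M g q p ⊓ VHM n M g q p = ⊥ ∧
        ∀ Δ ∈ THM M g q p,
          (projH M g q p.1 Δ.1, Δ.2 - opB M g q p (projV M g q p.1 Δ.1)) ∈ QHM M g q p ∧
          (projV M g q p.1 Δ.1, opB M g q p (projV M g q p.1 Δ.1)) ∈ VHM n M g q p ∧
          Δ = (projH M g q p.1 Δ.1, Δ.2 - opB M g q p (projV M g q p.1 Δ.1)) +
            (projV M g q p.1 Δ.1, opB M g q p (projV M g q p.1 Δ.1))) ∧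
    -- the differential of dq is a linear bijection from each fiber of QHM to TTB
    (∀ p ∈ HM M g q, BijOn (ddq n M g q p) (QHM M g q p) univ) ∧
    -- b and QHM are intrinsic: first by a description through T(HM), dπ and d(dq) alone,
    (∀ p ∈ HM M g q,
      (QHM M g q p : Set (E × E)) = {Δ | Δ ∈ THM M g q p ∧ Δ.1 ∈ horSpace M g q p.1} ∧
      ∀ ε ∈ vertSpace M q p.1, ∀ Δ : E × E,
        Δ = bMap M g q p ε ↔ Δ ∈ THM M g q p ∧ Δ.1 = ε ∧ ddq n M g q p Δ = 0) ∧
    -- then by independence of the embedding and of the metric operator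
    (∀ {E₂ : Type*} [NormedAddCommGroup E₂] [InnerProductSpace ℝ E₂] [FiniteDimensional ℝ E₂]
      (M₂ : Set E₂) (g₂ : E₂ → E₂ →L[ℝ] E₂) (q₂ : E₂ → B) (φ : E → E₂),
      IsSubmersedAmbient n m M₂ g₂ q₂ gB → IsSubmersionIsometry M g q M₂ g₂ q₂ φ →
      BijOn (tangentMapSet M φ) (HM M g q) (HM M₂ g₂ q₂) ∧
      ContDiffOn ℝ ∞ (tangentMapSet M φ) (HM M g q) ∧
      ∀ p ∈ HM M g q,
        (∀ ε ∈ vertSpace M q p.1,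
          fderivWithin ℝ φ M p.1 ε ∈ vertSpace M₂ q₂ (φ p.1) ∧
          fderivWithin ℝ (tangentMapSet M φ) (HM M g q) p (bMap M g q p ε) =
            bMap M₂ g₂ q₂ (tangentMapSet M φ p) (fderivWithin ℝ φ M p.1 ε)) ∧
        (QHM M g q p).map
            (fderivWithin ℝ (tangentMapSet M φ) (HM M g q) p).toLinearMap =
          QHM M₂ g₂ q₂ (tangentMapSet M φ p) ∧
        ∀ Δ ∈ THM M g q p,
          fderivWithin ℝ (tangentMapSet M φ) (HM M g q) p (projVHM M g q p Δ) =
            projVHM M₂ g₂ q₂ (tangentMapSet M φ p)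
              (fderivWithin ℝ (tangentMapSet M φ) (HM M g q) p Δ)) := by
  refine ⟨⟨hM.contDiffOn_projT, hM.contDiffOn_projH, hM.contDiffOn_projV⟩,
    ⟨hM.isEmbSubmanifold_HM, hM.HM_eq_totalSet⟩,
    ⟨hM.contMDiffOn_dq, hM.surjOn_dq, fun p hp c _ => ?_⟩,
    ⟨fun x hx w hw => hM.existsUnique_horLift hx w hw,
      fun w => ⟨hM.isEmbSubmanifold_fiber_dq w, hM.fiber_dq_eq w⟩⟩,
    ⟨hM.isEmbSubmanifold_HM.tangentBundleSet, hM.tangentBundleSet_HM⟩,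
    ⟨hM.contDiffOn_opQ, fun p hp Δ _ => ?_, hM.isSmoothSubbundle_QHM,
      fun p hp => ⟨fun Δ hΔ => ((hM.mem_QHM hp).1 hΔ).1, hM.coe_QHM hp⟩⟩,
    ⟨hM.isSmoothSubbundle_VHM, fun p hp => ⟨fun ε hε => ?_, fun ε hε =>
      ⟨hM.derivH_mem_horSpace hp.1 hp.2.1 hε,
        hM.derivV_mem_vertSpace hp.1 (vertSpace_le M q p.1 hε) hp.2⟩, hM.bijOn_bMap hp⟩⟩,
    ⟨hM.contDiffOn_projVHM, fun p hp => ⟨hM.QHM_sup_VHM hp, hM.QHM_inf_VHM hp, fun Δ hΔ =>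
      ⟨hM.sub_projVHM_mem_QHM hp hΔ, hM.bMap_mem_VHM hp (projV_mem M g q p.1 Δ.1),
        hM.eq_add_projVHM hp hΔ⟩⟩⟩,
    fun p hp => hM.bijOn_ddq hp,
    fun p hp => ⟨Set.ext fun Δ => hM.mem_QHM hp, fun ε hε Δ => ⟨?_, ?_⟩⟩,
    fun M₂ g₂ q₂ φ hM₂ hφ => ⟨hφ.bijOn_tangentMapSet, hφ.contDiffOn_tangentMapSet hM,
      fun p hp => ⟨fun ε hε => ⟨hφ.map_vertSpace hp.1 hε, hφ.fderivWithin_bMap hM hM₂ hp hε⟩,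
        hφ.map_QHM hM hM₂ hp, fun Δ hΔ => hφ.fderivWithin_projVHM hM hM₂ hp hΔ⟩⟩⟩
  · obtain ⟨Δ, h1, -, h2⟩ := hM.exists_ddq_eq hp c
    exact ⟨Δ, h1, h2⟩
  · obtain ⟨h1, h2⟩ := hM.opQ_mem hp Δ
    exact ⟨h1, hM.opQ_eq_self hp h1 h2⟩
  · have huniq : ∀ εt : E, (ε, εt) ∈ VHM n M g q p → εt = opB M g q p ε := fun εt h =>
      (Prod.ext_iff.1 (hM.eq_bMap_of_mem_VHM hp h)).2
    refine ⟨⟨opB M g q p ε, hM.bMap_mem_VHM hp hε, huniq⟩, fun εt h => ?_⟩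
    rw [huniq εt h]
    exact ⟨rfl, hM.opB_apply_eq hp hε, fun Γ hΓ => hM.opB_apply_eq_christoffelH hΓ hp hε⟩
  · rintro rfl
    have h := hM.bMap_mem_VHM hp hε
    exact ⟨h.1, rfl, h.2⟩
  · rintro ⟨h1, rfl, h3⟩
    exact hM.eq_bMap_of_mem_VHM hp ⟨h1, h3⟩
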